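/- Let $N\ge 2$, let $\Omega\subset\mathbb{R}^N$ be an open set (no regularity, convexity or boundedness is assumed), and let $\Omega_1=B(x_0,R)$, $R>0$, be a ball with $\overline{\Omega}_1\subset\Omega$. Put $M=\partial\Omega_1$ and let $\nu(p)=(p-x_0)/R$ be its unit normal field. A \emph{variation} is a family $(\xi^t)_{|t|<\delta}$, $\delta>0$, of $C^2$ diffeomorphisms of $\mathbb{R}^N$ such that $(x,t)\mapsto\xi^t(x)$ is $C^2$, $\xi^0=\mathrm{id}$, and all $\xi^t$ are the identity outside a common compact set. It is \emph{admissible} if for all $|t|<\delta$ we have $\xi^t(\partial\Omega)=\partial\Omega$, and $\xi^t$ preserves the volume of both phases: $|\xi^t(\Omega_1)|=|\Omega_1|$ and $|\xi^t(\Omega\setminus\overline{\Omega}_1)|=|\Omega\setminus\overline{\Omega}_1|$. Let $w=\partial_t\xi^t|_{t=0}$ be its velocity and let $A$ denote area, i.e. $(N-1)$-dimensional Hausdorff measure. The variation is \emph{translational} if there is a vector $e\in\mathbb{R}^N$ with $w\cdot\nu=e\cdot\nu$ on $M$ (for $e=0$: $w$ has no normal component). Then the two-phase partitioning of $\Omega$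 defined by $M$ is stable after discarding translations: (a) it is minimal: $\delta A(M)=\frac{d}{dt}A(\xi^t(M))|_{t=0}$ exists and equals $0$ for every admissible variation; (b) for every admissible variation that is not translational, the second variation $\delta^2A(M)=\frac{d^2}{dt^2}A(\xi^t(M))|_{t=0}$ exists and $\delta^2A(M)>0$; (c) for every admissible translational variation, $\delta^2A(M)$ exists and equals $0$. Moreover, let $\Delta$ be the Laplace--Beltrami operator of the unit sphere $S^{N-1}\subset\mathbb{R}^N$, acting on real $C^2$ functions. Its set of eigenvalues (numbers $c$ such that $\Delta f=cf$ for some $C^2$ function $f\not\equiv0$) is exactly $\{-l(l+N-2): l=0,1,2,\dots\}$. The solutions of $\Delta f=0$ are exactly the constant functions, and the first nonconstant modes, i.e. the solutions of $\Delta f=-(N-1)f$ (the case $l=1$), are exactly the functions $f(p)=e\cdot p$ with $e\in\mathbb{R}^N$, the normal components of translations. -/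

import Mathlib

open Set MeasureTheory Metric
open scoped Gradient RealInnerProductSpace

noncomputable section

namespace Partitioning

/-- The ambient space `ℝᴺ`. -/
abbrev Space (N : ℕ) : Type := EuclideanSpace ℝ (Fin N)

/-- The area of a hypersurface `S ⊆ ℝᴺ`: its `(N-1)`-dimensional Hausdorff measure. Mathlib's `μH`
carries no normalising constant, so the usual factor `ω_{N-1} / 2^{N-1}` is inserted, where
`ω_{N-1}` is the volume of the unit ball of `ℝᴺ⁻¹`. -/
def area {N : ℕ} (S : Set (Space N)) : ℝ :=
  (volume (ball (0 : Space (N - 1)) 1)).toReal / 2 ^ (N - 1) *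
    (Measure.hausdorffMeasure ((N : ℝ) - 1) S).toReal

/-- A variation: a family of diffeomorphisms `ξ t` of `ℝᴺ`, `|t| < δ`, of class `C²` jointly in
time and space, with `ξ 0 = id`, all equal to the identity outside a common compact set.
(Values of `ξ t` for `|t| ≥ δ` carry no meaning and are never used.) -/
structure Variation (N : ℕ) where
  δ : ℝ
  δ_pos : 0 < δ
  ξ : ℝ → Space N → Space N
  contDiffOn : ContDiffOn ℝ 2 (fun q : ℝ × Space N => ξ q.1 q.2) (Ioo (-δ) δ ×ˢ univ)
  diffeo : ∀ t ∈ Ioo (-δ) δ, ∃ η : Space N → Space N, ContDiff ℝ 2 η ∧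
    Function.LeftInverse η (ξ t) ∧ Function.RightInverse η (ξ t)
  map_zero : ∀ x, ξ 0 x = x
  compact_support : ∃ K : Set (Space N), IsCompact K ∧
    ∀ t ∈ Ioo (-δ) δ, ∀ x, x ∉ K → ξ t x = x

namespace Variation

variable {N : ℕ}

/-- The first variation field (velocity field) `w(x) = ∂ξ/∂t (x, 0)`. -/
def velocity (v : Variation N) (x : Space N) : Space N :=
  deriv (fun t : ℝ => v.ξ t x) 0

/-- The area `A(Mᵗ)` of the deformed interface `Mᵗ = ξᵗ(M)`. -/
def areaAt (v : Variation N) (M : Set (Space N)) (t : ℝ) : ℝ :=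
  area (v.ξ t '' M)

end Variation

variable {N : ℕ}

/-- The interface of the two-phase partitioning of `Ω` into `Ω₁` and `Ω \ closure Ω₁`. -/
def interface (Ω Ω₁ : Set (Space N)) : Set (Space N) :=
  frontier Ω₁ ∩ Ω

/-- A variation is admissible for the two-phase partitioning of `Ω` into `Ω₁` and
`Ω \ closure Ω₁` if it preserves the boundary of the container `Ω` and the volume of each phase. -/
structure IsAdmissible (Ω Ω₁ : Set (Space N)) (v : Variation N) : Prop where
  boundary : ∀ t ∈ Ioo (-v.δ) v.δ, v.ξ t '' frontier Ω = frontier Ω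
  volume_phase₁ : ∀ t ∈ Ioo (-v.δ) v.δ, volume (v.ξ t '' Ω₁) = volume Ω₁
  volume_phase₂ : ∀ t ∈ Ioo (-v.δ) v.δ,
    volume (v.ξ t '' (Ω \ closure Ω₁)) = volume (Ω \ closure Ω₁)

/-- The partitioning is minimal (a critical point of area under the volume constraints): the first
variation of area exists and vanishes for every admissible variation. -/
def IsMinimal (Ω Ω₁ : Set (Space N)) : Prop :=
  ∀ v : Variation N, IsAdmissible Ω Ω₁ v → HasDerivAt (v.areaAt (interface Ω Ω₁)) 0 0

/-- `HasSecondVariation M v a`: the second variation `d²/dt² A(Mᵗ)` at `t = 0` exists and is `a`. -/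
def HasSecondVariation (M : Set (Space N)) (v : Variation N) (a : ℝ) : Prop :=
  (∀ᶠ t in nhds (0 : ℝ), DifferentiableAt ℝ (v.areaAt M) t) ∧
    HasDerivAt (deriv (v.areaAt M)) a 0

/-- To first order the variation moves `M` (with unit normal field `ν`) like a translation: the
normal component `w · ν` of its velocity equals `e · ν` on `M` for a constant vector `e`.
The case `e = 0` is that of a velocity without normal component. -/
def IsTranslational (M : Set (Space N)) (ν : Space N → Space N) (v : Variation N) : Prop :=
  ∃ e : Space N, ∀ p ∈ M, ⟪v.velocity p, ν p⟫ = ⟪e, ν p⟫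

/-- Stability of a two-phase partitioning after discarding translations: it is minimal, and the
second variation of area exists and is positive for every admissible variation, except for those
that act on the interface to first order as a translation. -/
def IsStableModTranslations (Ω Ω₁ : Set (Space N)) (ν : Space N → Space N) : Prop :=
  IsMinimal Ω Ω₁ ∧
    ∀ v : Variation N, IsAdmissible Ω Ω₁ v → ¬ IsTranslational (interface Ω Ω₁) ν v →
      ∃ a : ℝ, HasSecondVariation (interface Ω Ω₁) v a ∧ 0 < a

/-- Tangential gradient `∇ᴹF` at `x` of an ambient function, for a hypersurface with unit normal
field `ν`. -/
def tangentialGradient (ν : Space N → Space N) (F : Space N → ℝ) (x : Space N) : Space N :=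
  ∇ F x - ⟪∇ F x, ν x⟫ • ν x

/-- Tangential divergence `div_M X = ∑ᵢ ⟪D_{τᵢ} X, τᵢ⟫` at `x` (`τᵢ` an orthonormal basis of the
tangent space), for a hypersurface with unit normal field `ν`. -/
def tangentialDivergence (ν : Space N → Space N) (X : Space N → Space N) (x : Space N) : ℝ :=
  LinearMap.trace ℝ (Space N) (fderiv ℝ X x : Space N →ₗ[ℝ] Space N) - ⟪fderiv ℝ X x (ν x), ν x⟫

/-- Extension of a function on the unit sphere to `ℝᴺ \ {0}`, constant along rays. Only the values
of `f` on the unit sphere matter. -/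
def radialExtension (f : Space N → ℝ) (x : Space N) : ℝ :=
  f (‖x‖⁻¹ • x)

/-- The function `f` on the unit sphere is of class `C²`. -/
def IsC2OnSphere (f : Space N → ℝ) : Prop :=
  ContDiffOn ℝ 2 (radialExtension f) {0}ᶜ

/-- The Laplace-Beltrami operator `Δf = div_M (∇ᴹ f)` of the unit sphere `M = Sᴺ⁻¹`, with unit
normal field `x / |x|`. -/
def sphereLaplacian (f : Space N → ℝ) (p : Space N) : ℝ :=
  tangentialDivergence (fun x => ‖x‖⁻¹ • x)
    (tangentialGradient (fun x => ‖x‖⁻¹ • x) (radialExtension f)) p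

/-- `f` is a solution on the unit sphere of `Δf = c f`, of class `C²`. -/
def IsSphereMode (f : Space N → ℝ) (c : ℝ) : Prop :=
  IsC2OnSphere f ∧ ∀ p ∈ sphere (0 : Space N) 1, sphereLaplacian f p = c * f p

/-- The set of eigenvalues of the Laplace-Beltrami operator of the unit sphere of `ℝᴺ`. -/
def sphereEigenvalues (N : ℕ) : Set ℝ :=
  {c | ∃ f : Space N → ℝ, IsSphereMode f c ∧ ∃ p ∈ sphere (0 : Space N) 1, f p ≠ 0}

end Partitioning

end

/-! After rescaling, the interface is the unit sphere. For small `t` the moved interface is a radial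
graph `r = exp (s t p)` over it, with `s` of class C² and `∂ₜ s` at time 0 equal to the rescaled
normal velocity `u` (`exists_radialGraph`). In terms of `s` the enclosed volume is `1/N` times the
integral of `exp (N s)`, and the area is a positive constant times the integral of `exp ((N-1) s)
√(1 + |∇s|²)`.

Conservation of volume says that `∂ₜ s · exp (N s)` has integral zero at every time. Subtracting `N
- 1` times this from the derivative of the area leaves products having a factor that vanishes at `t
= 0`. So the first variation is zero, and the second is, up to the constant, the integral of `|∇u|²
- (N-1) u²` over mean-zero `u`, although `s` need not have third derivatives
(`radialGraph_variation`).

The area formula rests on `hausdorffMeasure_level_eq`: the Hausdorff measure of a star-shaped level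
set `{q = 1}` is a constant times the integral of `|∇q|` over `{q < 1}`. It is exact for hyperplane
slices of cones. In general `{q = 1}` is compared with its tangent planes by central projection
inside thin cones, with errors tending to 1. Only the sign of the constant matters, so it is not
evaluated.

The spectral part is algebraic. With Euler operator `E`, the operator `E² + (N-2) E - Δ` on
polynomials induces minus the Laplace-Beltrami operator on the sphere. It is symmetric in L² by
Green's formula (`integral_fderiv_mul_pderiv`), and modulo lower degree it multiplies polynomials of
degree `k` by `k (k + N - 2)` (`sphereOp_sub_smul_mem`). Polynomials are dense by Stone-Weierstrass.
Projecting onto increasing degrees then bounds the Dirichlet integral below by `N - 1` on the linear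
part and by `2N` beyond it (`le_energy`), which gives positivity off translations. The same
triangular structure shows that a mode is orthogonal to everything outside its own degree
(`inner_eq_zero_of_weak_mode`), which gives the spectrum and the modes for `l = 0, 1`. No eigenbasis
is constructed. -/

noncomputable section

namespace Partitioning

/-- The surface measure of the unit sphere of `ℝᴺ`. -/
abbrev sphereMeasure (N : ℕ) : Measure (sphere (0 : Space N) 1) :=
  (volume : Measure (Space N)).toSphere

/-! ### Polar coordinates and functions constant along rays -/

section Polar

variable {N : ℕ}

lemma lintegral_polar (hN : 1 ≤ N) (F : Space N → ENNReal) (hF : Measurable F) :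
    ∫⁻ x, F x = ∫⁻ p : sphere (0 : Space N) 1, (∫⁻ r in Ioi (0 : ℝ),
      ENNReal.ofReal (r ^ (N - 1)) * F (r • (p : Space N))) ∂(sphereMeasure N) := by
  have : Nonempty (Fin N) := ⟨⟨0, hN⟩⟩
  have h1 : ∫⁻ x, F x = ∫⁻ x : ({(0 : Space N)}ᶜ : Set (Space N)), F x
      ∂(Measure.comap (↑) (volume : Measure (Space N))) := by
    rw [lintegral_subtype_comap (measurableSet_singleton _).compl,
      restrict_compl_singleton]
  have h2 := (volume : Measure (Space N)).measurePreserving_homeomorphUnitSphereProd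
  have h3 := h2.lintegral_comp_emb (Homeomorph.measurableEmbedding _)
    (fun y => F (y.2.1 • (y.1 : Space N)))
  rw [h1]
  have h4 : ∀ x : ({(0 : Space N)}ᶜ : Set (Space N)),
      F (((homeomorphUnitSphereProd (Space N)) x).2.1 •
        (((homeomorphUnitSphereProd (Space N)) x).1 : Space N)) = F x := by
    intro x
    have hx : ‖(x : Space N)‖ ≠ 0 := norm_ne_zero_iff.2 x.2
    simp [smul_smul, hx]
  simp_rw [h4] at h3
  rw [h3, lintegral_prod]
  · congr 1
    ext p
    rw [Measure.volumeIoiPow, lintegral_withDensity_eq_lintegral_mul, finrank_euclideanSpace_fin]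
    · exact lintegral_subtype_comap measurableSet_Ioi
        (fun r => ENNReal.ofReal (r ^ (N - 1)) * F (r • (p : Space N)))
    · fun_prop
    · fun_prop
  · refine (hF.comp ?_).aemeasurable
    exact ((measurable_subtype_coe.comp measurable_snd).smul
      (measurable_subtype_coe.comp measurable_fst))

/-- No integrability is needed, because the Bochner integral of a product function over a product
measure always factors. -/
lemma integral_polar_mul (hN : 1 ≤ N) (F : Space N → ℝ) (φ : ℝ → ℝ) (h : Space N → ℝ)
    (hF : ∀ r > 0, ∀ p ∈ sphere (0 : Space N) 1, F (r • p) = φ r * h p) :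
    ∫ x, F x = (∫ r in Ioi (0 : ℝ), r ^ (N - 1) * φ r) *
      ∫ p : sphere (0 : Space N) 1, h p ∂(sphereMeasure N) := by
  have : Nonempty (Fin N) := ⟨⟨0, hN⟩⟩
  have h1 : ∫ x, F x = ∫ x : ({(0 : Space N)}ᶜ : Set (Space N)), F x
      ∂(Measure.comap (↑) (volume : Measure (Space N))) := by
    rw [integral_subtype_comap (measurableSet_singleton _).compl,
      restrict_compl_singleton]
  have h2 := (volume : Measure (Space N)).measurePreserving_homeomorphUnitSphereProd
  have h3 := h2.integral_comp (Homeomorph.measurableEmbedding _)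
    (fun y => h (y.1 : Space N) * φ y.2.1)
  have h4 : ∀ x : ({(0 : Space N)}ᶜ : Set (Space N)),
      h (((homeomorphUnitSphereProd (Space N)) x).1 : Space N) *
      φ (((homeomorphUnitSphereProd (Space N)) x).2.1)  = F x := by
    intro x
    have hx : ‖(x : Space N)‖ ≠ 0 := norm_ne_zero_iff.2 x.2
    have := hF ‖(x : Space N)‖ (by positivity) (‖(x : Space N)‖⁻¹ • (x : Space N))
      (by simp [norm_smul, hx])
    rw [smul_smul, mul_inv_cancel₀ hx, one_smul] at this
    simp [this, mul_comm]
  simp_rw [h4] at h3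
  rw [h1, h3, integral_prod_mul (fun p : sphere (0 : Space N) 1 => h p)
    (fun r : Ioi (0 : ℝ) => φ r), mul_comm]
  congr 1
  simp only [Measure.volumeIoiPow, ENNReal.ofReal]
  rw [integral_withDensity_eq_integral_smul, finrank_euclideanSpace_fin,
    integral_subtype_comap measurableSet_Ioi fun a : ℝ ↦ Real.toNNReal (a ^ (N - 1)) • φ a]
  · refine setIntegral_congr_fun measurableSet_Ioi fun x hx => ?_
    simp [NNReal.smul_def, Real.coe_toNNReal _ (pow_nonneg (le_of_lt hx) _)]
  · exact (measurable_subtype_coe.pow_const _).real_toNNReal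

/-- A function that is constant along the rays issuing from the origin. -/
def IsRadiallyConstant (h : Space N → ℝ) : Prop :=
  ∀ r : ℝ, 0 < r → ∀ x, h (r • x) = h x

lemma IsRadiallyConstant.fderiv_smul {h : Space N → ℝ} (hh : IsRadiallyConstant h)
    {r : ℝ} (hr : 0 < r) (x v : Space N) :
    fderiv ℝ h (r • x) v = r⁻¹ * fderiv ℝ h x v := by
  have h1 : (fun y => h (r • y)) = h := funext (hh r hr)
  have h2 := fderiv_comp_smul (𝕜 := ℝ) (f := h) (x := x) r
  rw [h1] at h2
  rw [h2]
  simp [hr.ne']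

lemma IsRadiallyConstant.fderiv_self {h : Space N → ℝ} (hh : IsRadiallyConstant h)
    (x : Space N) (hx : DifferentiableAt ℝ h x) : fderiv ℝ h x x = 0 := by
  have h1 : HasDerivAt (fun r : ℝ => h (r • x)) (fderiv ℝ h x x) 1 := by
    have h3 : HasDerivAt (fun r : ℝ => r • x) x 1 := by
      simpa using (hasDerivAt_id (1 : ℝ)).smul_const x
    have h4 : HasFDerivAt h (fderiv ℝ h x) ((1 : ℝ) • x) := by
      rw [one_smul]; exact hx.hasFDerivAt
    exact h4.comp_hasDerivAt (1 : ℝ) h3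
  have h2 : HasDerivAt (fun r : ℝ => h (r • x)) 0 1 := by
    refine (hasDerivAt_const (1 : ℝ) (h x)).congr_of_eventuallyEq ?_
    filter_upwards [lt_mem_nhds (zero_lt_one : (0 : ℝ) < 1)] with r hr
    exact hh r hr x
  exact h1.unique h2

lemma isRadiallyConstant_radialExtension (f : Space N → ℝ) :
    IsRadiallyConstant (radialExtension f) := by
  intro r hr x
  simp only [radialExtension, norm_smul, Real.norm_eq_abs, abs_of_pos hr, smul_smul]
  congr 2
  field_simp

lemma radialExtension_of_mem_sphere (f : Space N → ℝ) {p : Space N}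
    (hp : p ∈ sphere (0 : Space N) 1) : radialExtension f p = f p := by
  simp [radialExtension, mem_sphere_zero_iff_norm.1 hp]

end Polar

/-! ### The divergence theorem on the unit sphere -/

section Divergence

variable {N : ℕ}

/-- The bump lives in `[1, 3]`, so integration by parts on the half line has no boundary term and
can be done on the whole line. -/
lemma integral_Ioi_deriv_bump (φ : ContDiffBump (2 : ℝ)) (hφ : φ.rOut = 1) (n : ℕ) :
    ∫ r in Ioi (0 : ℝ), r ^ n * deriv φ r = - (n * ∫ r in Ioi (0 : ℝ), r ^ (n - 1) * φ r) := by
  have hsupp : tsupport (φ : ℝ → ℝ) ⊆ Ioi 0 := by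
    rw [φ.tsupport_eq, hφ]
    intro x hx
    rw [Real.closedBall_eq_Icc] at hx
    exact lt_of_lt_of_le (by norm_num) hx.1
  have h0 : ∀ r, r ∉ Ioi (0 : ℝ) → φ r = 0 := fun r hr =>
    image_eq_zero_of_notMem_tsupport fun h => hr (hsupp h)
  have h0' : ∀ r, r ∉ Ioi (0 : ℝ) → deriv φ r = 0 := fun r hr => by
    by_contra h
    exact hr (hsupp (support_deriv_subset h))
  have hd : Differentiable ℝ (φ : ℝ → ℝ) := (φ.contDiff (n := 1)).differentiable one_ne_zero
  have hc : Continuous (deriv (φ : ℝ → ℝ)) := (φ.contDiff (n := 1)).continuous_deriv le_rfl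
  rw [setIntegral_eq_integral_of_forall_compl_eq_zero (fun r hr => by rw [h0' r hr, mul_zero]),
    setIntegral_eq_integral_of_forall_compl_eq_zero (fun r hr => by rw [h0 r hr, mul_zero]),
    ← integral_const_mul, integral_mul_deriv_eq_deriv_mul_of_integrable
      (u := fun r : ℝ => r ^ n) (v := φ) (u' := fun r : ℝ => n * r ^ (n - 1)) (v' := deriv φ)]
  · simp [mul_assoc]
  · exact fun x _ => hasDerivAt_pow n x
  · exact fun x _ => (hd x).hasDerivAt
  · refine Continuous.integrable_of_hasCompactSupport (by fun_prop) ?_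
    exact φ.hasCompactSupport.deriv.mul_left
  · refine Continuous.integrable_of_hasCompactSupport
      (by have := φ.continuous; fun_prop) ?_
    exact φ.hasCompactSupport.mul_left
  · refine Continuous.integrable_of_hasCompactSupport
      (by have := φ.continuous; fun_prop) ?_
    exact φ.hasCompactSupport.mul_left

/-- The norm fails to be smooth only at the origin, near which the bump vanishes. -/
lemma contDiff_bump_norm (φ : ContDiffBump (2 : ℝ)) (hφ : φ.rOut = 1) :
    ContDiff ℝ 1 (fun x : Space N => φ ‖x‖) := by
  rw [contDiff_iff_contDiffAt]
  intro x
  by_cases hx : x = 0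
  · have : (fun x : Space N => φ ‖x‖) =ᶠ[nhds x] fun _ => 0 := by
      have : ∀ᶠ y in nhds x, ‖y‖ < 1 := by
        rw [hx]
        exact (continuous_norm.tendsto (0 : Space N)).eventually_lt_const (by simp)
      filter_upwards [this] with y hy
      refine φ.zero_of_le_dist ?_
      rw [hφ, Real.dist_eq, abs_of_neg (by linarith)]
      linarith
    exact contDiffAt_const.congr_of_eventuallyEq this
  · exact (φ.contDiff (n := 1)).contDiffAt.comp x (contDiffAt_norm ℝ hx)

/-- Divergence theorem on the unit sphere, for the components of a vector field extended
constantly along rays. -/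
theorem integral_sphere_fderiv (hN : 2 ≤ N) {h : Space N → ℝ} (hh : IsRadiallyConstant h)
    (hc : ContDiffOn ℝ 1 h {0}ᶜ) (v : Space N) :
    ∫ p : sphere (0 : Space N) 1, fderiv ℝ h p v ∂(sphereMeasure N) =
      (N - 1 : ℝ) * ∫ p : sphere (0 : Space N) 1, h p * ⟪(p : Space N), v⟫ ∂(sphereMeasure N) := by
  -- The cutoff `φ ‖x‖` is supported in the shell `1 ≤ ‖x‖ ≤ 3`, away from the origin where `h` is
  -- singular. Integrating `φ ‖x‖ · ∂ᵥ h` by parts over the whole space and separating variables in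
  -- polar coordinates turns both sides into a radial integral times a spherical one.
  set φ : ContDiffBump (2 : ℝ) := ⟨1 / 2, 1, by norm_num, by norm_num⟩ with hφdef
  have hφ : φ.rOut = 1 := rfl
  have hφ1 : ∀ r : ℝ, r ≤ 1 → φ r = 0 := fun r hr => by
    refine φ.zero_of_le_dist ?_
    rw [hφ, Real.dist_eq, abs_of_neg (by linarith)]
    linarith
  set f : Space N → ℝ := fun x => φ ‖x‖ with hf
  have hfc : ContDiff ℝ 1 f := contDiff_bump_norm φ hφ
  have hfs : HasCompactSupport f := by
    refine HasCompactSupport.of_support_subset_isCompact (isCompact_closedBall (0 : Space N) 3) ?_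
    intro x hx
    rw [Function.mem_support] at hx
    by_contra h3
    apply hx
    refine φ.zero_of_le_dist ?_
    rw [mem_closedBall_zero_iff, not_le] at h3
    rw [hφ, Real.dist_eq, abs_of_pos (by linarith)]
    linarith
  have hft : tsupport f ⊆ {0}ᶜ := by
    have : tsupport f ⊆ {x | 1 ≤ ‖x‖} := by
      refine closure_minimal ?_ (isClosed_le continuous_const continuous_norm)
      intro x hx
      by_contra h3
      exact hx (hφ1 _ (not_le.1 h3).le)
    intro x hx h0
    have := this hx
    rw [mem_singleton_iff.1 h0] at this
    norm_num at this
  have hopen : IsOpen ({0}ᶜ : Set (Space N)) := isOpen_compl_singleton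
  have hcont : ContinuousOn (fun x => fderiv ℝ h x v) {0}ᶜ :=
    (hc.continuousOn_fderiv_of_isOpen hopen le_rfl).clm_apply continuousOn_const
  have hcm : ∀ g : Space N → ℝ, ContinuousOn g {0}ᶜ → Continuous fun x => f x * g x := by
    intro g hg
    refine continuous_of_tsupport fun x hx => hfc.continuous.continuousAt.mul
      (hg.continuousAt (hopen.mem_nhds (hft (tsupport_mul_subset_left hx))))
  have key := integral_mul_fderiv_eq_neg_fderiv_mul_of_integrable (μ := (volume : Measure (Space N)))
    (f := f) (g := h) (v := v) ?_ ?_ ?_ (fun x _ => hfc.differentiable one_ne_zero x)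
    (fun x hx => (hc.differentiableOn one_ne_zero).differentiableAt (hopen.mem_nhds (hft hx)))
  rotate_left
  · refine Continuous.integrable_of_hasCompactSupport ?_ ?_
    · refine continuous_iff_continuousAt.2 fun x => ?_
      by_cases hx : x ∈ tsupport f
      · exact ((hfc.continuous_fderiv one_ne_zero).clm_apply continuous_const).continuousAt.mul
          (hc.continuousOn.continuousAt (hopen.mem_nhds (hft hx)))
      · have : (fun x => fderiv ℝ f x v * h x) =ᶠ[nhds x] fun _ => 0 := by
          filter_upwards [(isClosed_tsupport f).isOpen_compl.mem_nhds hx] with y hy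
          have : fderiv ℝ f y = 0 := by
            by_contra h4
            exact hy (support_fderiv_subset ℝ h4)
          simp [this]
        exact continuousAt_const.congr this.symm
    · exact (hfs.fderiv_apply (𝕜 := ℝ) v).mul_right
  · refine Continuous.integrable_of_hasCompactSupport ?_ hfs.mul_right
    exact hcm _ hcont
  · refine Continuous.integrable_of_hasCompactSupport ?_ hfs.mul_right
    exact hcm _ hc.continuousOn
  rw [integral_polar_mul (by omega) _ (fun r => φ r * r⁻¹) (fun p => fderiv ℝ h p v),
    integral_polar_mul (by omega) _ (fun r => deriv φ r) (fun p => h p * ⟪p, v⟫)] at key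
  · obtain ⟨m, rfl⟩ : ∃ m, N = m + 2 := ⟨N - 2, by omega⟩
    have h1 := integral_Ioi_deriv_bump φ hφ (m + 1)
    have h2 : ∫ r in Ioi (0 : ℝ), r ^ (m + 2 - 1) * (φ r * r⁻¹) =
        ∫ r in Ioi (0 : ℝ), r ^ m * φ r := by
      refine setIntegral_congr_fun measurableSet_Ioi fun r hr => ?_
      have : r ≠ 0 := (ne_of_gt hr)
      simp only [show m + 2 - 1 = m + 1 by omega]
      field_simp
      ring
    have hpos : 0 < ∫ r in Ioi (0 : ℝ), r ^ m * φ r := by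
      have hint : Integrable (fun r : ℝ => r ^ m * φ r) :=
        Continuous.integrable_of_hasCompactSupport (by have := φ.continuous; fun_prop)
          φ.hasCompactSupport.mul_left
      rw [setIntegral_pos_iff_support_of_nonneg_ae _ hint.integrableOn]
      · refine lt_of_lt_of_le ?_ (measure_mono (s := Ioo (3/2 : ℝ) 2) ?_)
        · simp; norm_num
        · intro r hr
          have hr0 : (0 : ℝ) < r := by linarith [hr.1]
          refine ⟨?_, hr0⟩
          have : 0 < φ r := φ.pos_of_mem_ball (by
            rw [hφ, Real.ball_eq_Ioo]; constructor <;> linarith [hr.1, hr.2])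
          exact (mul_pos (pow_pos hr0 _) this).ne'
      · filter_upwards [ae_restrict_mem measurableSet_Ioi] with r hr
        exact mul_nonneg (pow_nonneg (le_of_lt hr) _) φ.nonneg
    rw [h2, show m + 2 - 1 = m + 1 by omega, h1] at key
    simp only [Nat.add_sub_cancel] at key
    push_cast at key ⊢
    -- Both sides carry the same radial integral of `r ^ m * φ r`; the factor `N - 1 = m + 1` comes
    -- from differentiating `r ^ (m + 1)`.
    apply mul_left_cancel₀ hpos.ne'
    rw [key]
    ring
  · intro r hr p hp
    have hp1 := mem_sphere_zero_iff_norm.1 hp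
    have hp0 : r • p ≠ 0 := by
      rw [Ne, smul_eq_zero, not_or]
      exact ⟨hr.ne', fun h0 => by simp [h0] at hp1⟩
    have hd : HasFDerivAt (fun x : Space N => ‖x‖) (fderiv ℝ (fun x : Space N => ‖x‖) (r • p))
      (r • p) := ((contDiffAt_norm ℝ hp0 (n := 1)).differentiableAt one_ne_zero).hasFDerivAt
    have hn : fderiv ℝ (fun x : Space N => ‖x‖) (r • p) v = ⟪p, v⟫ := by
      have h5 : HasFDerivAt (fun x : Space N => ‖x‖ ^ 2) (2 • (innerSL ℝ (r • p))) (r • p) :=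
        (hasStrictFDerivAt_norm_sq (r • p)).hasFDerivAt
      have h6 := congrArg (fun L => L v) ((hd.pow 2).unique h5)
      simp only [norm_smul, hp1, abs_of_pos hr, Real.norm_eq_abs, map_smul] at h6
      simp at h6
      apply mul_left_cancel₀ (mul_pos two_pos hr).ne'
      linarith
    have h7 : HasFDerivAt f ((deriv φ ‖r • p‖) • fderiv ℝ (fun x : Space N => ‖x‖) (r • p))
        (r • p) := by
      have h8 : HasDerivAt φ (deriv φ ‖r • p‖) ‖r • p‖ :=
        ((φ.contDiff (n := 1)).differentiable one_ne_zero _).hasDerivAt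
      exact h8.comp_hasFDerivAt (r • p) hd
    simp only [h7.fderiv, hh r hr]
    simp [norm_smul, hp1, abs_of_pos hr, hn]
    ring
  · intro r hr p hp
    have hp1 := mem_sphere_zero_iff_norm.1 hp
    simp only [hf, norm_smul, hp1, Real.norm_eq_abs, abs_of_pos hr, mul_one, hh.fderiv_smul hr]
    ring

end Divergence

/-! ### Hyperplane slices of cones -/

section FlatCone

open scoped ENNReal NNReal Pointwise

/-- Invariance of a set under positive dilations. -/
def IsConeSet {N : ℕ} (B : Set (Space N)) : Prop :=
  ∀ r : ℝ, 0 < r → ∀ x, r • x ∈ B ↔ x ∈ B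

/-- The ratio of Hausdorff measure to Lebesgue measure on `ℝⁿ`. -/
def hausdorffFactor (n : ℕ) : ℝ≥0 :=
  (Measure.hausdorffMeasure (Module.finrank ℝ (Space n)) : Measure (Space n)).addHaarScalarFactor
    volume

lemma hausdorffFactor_pos (n : ℕ) : 0 < hausdorffFactor n :=
  Measure.addHaarScalarFactor_pos_of_isAddHaarMeasure _ _

/-- Both measures are translation invariant, so uniqueness of Haar measure applies; the constant is
left unevaluated. -/
lemma hausdorffMeasure_eq_smul_volume (n : ℕ) (s : Set (Space n)) :
    Measure.hausdorffMeasure (n : ℝ) s = hausdorffFactor n * volume s := by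
  have h := Measure.isAddLeftInvariant_eq_smul
    (Measure.hausdorffMeasure (Module.finrank ℝ (Space n)) : Measure (Space n)) volume
  have h2 := congrArg (fun m : Measure (Space n) => m s) h
  simp only [Measure.smul_apply, finrank_euclideanSpace_fin] at h2
  rw [h2, ENNReal.smul_def, smul_eq_mul]
  simp [hausdorffFactor]

/-- The point of `ℝⁿ⁺¹` with first coordinate `c` and remaining coordinates `y`. -/
def consPoint {n : ℕ} (c : ℝ) (y : Space n) : Space (n + 1) :=
  WithLp.toLp 2 (Fin.cons c y.ofLp : Fin (n + 1) → ℝ)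

variable {n : ℕ}

@[simp] lemma consPoint_zero (c : ℝ) (y : Space n) : consPoint c y 0 = c := rfl

lemma smul_consPoint (r c : ℝ) (y : Space n) :
    r • consPoint c y = consPoint (r * c) (r • y) := by
  ext i
  refine Fin.cases ?_ (fun j => ?_) i <;> simp [consPoint]

lemma isometry_consPoint (c : ℝ) : Isometry (consPoint (n := n) c) := by
  refine Isometry.of_dist_eq fun x y => ?_
  simp [EuclideanSpace.dist_eq, consPoint, Fin.sum_univ_succ]

lemma exists_consPoint (x : Space (n + 1)) : ∃ y : Space n, consPoint (x 0) y = x :=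
  ⟨WithLp.toLp 2 (fun i => x i.succ), by
    ext i
    refine Fin.cases ?_ (fun j => ?_) i <;> simp [consPoint]⟩

lemma volume_eq_lintegral_consPoint {A : Set (Space (n + 1))} (hA : MeasurableSet A) :
    volume A = ∫⁻ z : ℝ, volume {y : Space n | consPoint z y ∈ A} := by
  have h1 := (volume_preserving_piFinSuccAbove (fun _ : Fin (n + 1) => ℝ) 0).symm
  have h2 := PiLp.volume_preserving_toLp (Fin (n + 1))
  have h3 := h2.comp h1
  have h4 : MeasurePreserving (fun p : ℝ × Space n => consPoint p.1 p.2)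
      ((volume : Measure ℝ).prod volume) volume := by
    have h5 := (MeasurePreserving.id (volume : Measure ℝ)).prod
      (PiLp.volume_preserving_ofLp (Fin n))
    have h6 := h3.comp h5
    have h7 : (fun p : ℝ × Space n => consPoint p.1 p.2) =
        (WithLp.toLp 2 ∘ (MeasurableEquiv.piFinSuccAbove (fun _ => ℝ) 0).symm) ∘
          Prod.map id WithLp.ofLp := by
      funext p
      ext i
      simp only [consPoint, Function.comp, Prod.map, id]
      refine Fin.cases ?_ (fun j => ?_) i <;> simp
    rw [h7]
    exact h6
  rw [← h4.measure_preimage hA.nullMeasurableSet, Measure.prod_apply (h4.measurable hA)]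
  rfl

/-- The slice of the cone at height `z` is the dilate by `z / c` of the slice at height `c`. By
Fubini the truncated cone has volume `c / (n + 1)` times that of the slice, as for a pyramid. -/
lemma hausdorffMeasure_cone_inter_hyperplane_zero {B : Set (Space (n + 1))} (hB : MeasurableSet B)
    (hc : IsConeSet B) {c : ℝ} (hc0 : 0 < c) :
    Measure.hausdorffMeasure (n : ℝ) (B ∩ {x | x 0 = c}) =
      hausdorffFactor n * (n + 1) * ENNReal.ofReal c⁻¹ * volume (B ∩ {x | 0 < x 0 ∧ x 0 < c}) := by
  set F : Set (Space n) := {y | consPoint c y ∈ B} with hF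
  have h1 : B ∩ {x | x 0 = c} = consPoint c '' F := by
    ext x
    constructor
    · rintro ⟨hx, hx0⟩
      obtain ⟨y, hy⟩ := exists_consPoint x
      rw [mem_ofPred_eq.mp hx0] at hy
      exact ⟨y, by rw [hF, mem_ofPred_eq, hy]; exact hx, hy⟩
    · rintro ⟨y, hy, rfl⟩
      exact ⟨hy, by simp⟩
  rw [h1, (isometry_consPoint c).hausdorffMeasure_image (Or.inl n.cast_nonneg),
    hausdorffMeasure_eq_smul_volume]
  have hm : MeasurableSet {x : Space (n + 1) | 0 < x 0 ∧ x 0 < c} := by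
    have : Measurable fun x : Space (n + 1) => x 0 := by fun_prop
    exact (measurableSet_lt measurable_const this).inter (measurableSet_lt this measurable_const)
  rw [volume_eq_lintegral_consPoint (hB.inter hm)]
  have h2 : ∀ z : ℝ, volume {y : Space n | consPoint z y ∈ B ∩ {x | 0 < x 0 ∧ x 0 < c}} =
      (Ioo 0 c).indicator (fun z => ENNReal.ofReal ((z / c) ^ n) * volume F) z := by
    intro z
    by_cases hz : z ∈ Ioo 0 c
    · rw [indicator_of_mem hz]
      have hzc : 0 < z / c := div_pos hz.1 hc0
      have : {y : Space n | consPoint z y ∈ B ∩ {x | 0 < x 0 ∧ x 0 < c}} = (z / c) • F := by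
        ext y
        rw [mem_smul_set_iff_inv_smul_mem₀ hzc.ne', hF, mem_ofPred_eq, mem_ofPred_eq,
          ← hc (z / c) hzc, smul_consPoint, smul_inv_smul₀ hzc.ne', div_mul_cancel₀ _ hc0.ne']
        simp [hz.1, hz.2]
      rw [this, Measure.addHaar_smul, finrank_euclideanSpace_fin,
        abs_of_nonneg (pow_nonneg hzc.le _)]
    · rw [indicator_of_notMem hz]
      have : {y : Space n | consPoint z y ∈ B ∩ {x | 0 < x 0 ∧ x 0 < c}} = ∅ := by
        ext y
        simp only [mem_ofPred_eq, mem_inter_iff, consPoint_zero, mem_empty_iff_false, iff_false]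
        exact fun h => hz h.2
      rw [this, measure_empty]
  simp_rw [h2]
  rw [lintegral_indicator measurableSet_Ioo, lintegral_mul_const _ (by fun_prop),
    Measure.restrict_congr_set Ioo_ae_eq_Ioc, ← ofReal_integral_eq_lintegral_ofReal,
    ← intervalIntegral.integral_of_le hc0.le]
  · have h3 : ∫ z in (0 : ℝ)..c, (z / c) ^ n = c / (n + 1) := by
      simp_rw [div_pow]
      rw [intervalIntegral.integral_div, integral_pow]
      field_simp
      simp [pow_succ]
    rw [h3]
    have h4 : ((n : ℝ≥0∞) + 1) = ENNReal.ofReal (n + 1) := by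
      rw [ENNReal.ofReal_add n.cast_nonneg zero_le_one]; simp
    have h5 : ((n : ℝ≥0∞) + 1) * ENNReal.ofReal c⁻¹ * ENNReal.ofReal (c / (n + 1)) = 1 := by
      rw [h4, ← ENNReal.ofReal_mul (by positivity), ← ENNReal.ofReal_mul (by positivity)]
      rw [show ((n : ℝ) + 1) * c⁻¹ * (c / (n + 1)) = 1 by field_simp]
      simp
    calc (hausdorffFactor n : ℝ≥0∞) * volume F
        = hausdorffFactor n * (((n : ℝ≥0∞) + 1) * ENNReal.ofReal c⁻¹ *
          ENNReal.ofReal (c / (n + 1))) * volume F := by rw [h5, mul_one]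
      _ = _ := by ring
  · have : ContinuousOn (fun z : ℝ => (z / c) ^ n) (Icc 0 c) := by fun_prop
    exact (this.integrableOn_Icc).mono_set Ioc_subset_Icc_self
  · filter_upwards [ae_restrict_mem measurableSet_Ioc] with z hz
    exact pow_nonneg (div_nonneg hz.1.le hc0.le) _

/-- The constant relating the area of a star-shaped hypersurface to a volume integral. -/
def coneFactor (n : ℕ) : ℝ≥0 := hausdorffFactor n * (n + 1)

lemma coneFactor_pos (n : ℕ) : 0 < coneFactor n := mul_pos (hausdorffFactor_pos n) (by positivity)

/-- A reflection carries the vector representing `ℓ` to `‖ℓ‖` times the first basis vector, so `{ℓ =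
1}` becomes the coordinate hyperplane at height `‖ℓ‖⁻¹`. -/
lemma hausdorffMeasure_cone_inter_hyperplane {B : Set (Space (n + 1))} (hB : MeasurableSet B)
    (hc : IsConeSet B) {ℓ : Space (n + 1) →L[ℝ] ℝ} (hℓ : ℓ ≠ 0) :
    Measure.hausdorffMeasure (n : ℝ) (B ∩ {x | ℓ x = 1}) =
      coneFactor n * ‖ℓ‖ₑ * volume (B ∩ {x | 0 < ℓ x ∧ ℓ x < 1}) := by
  set e : Space (n + 1) := EuclideanSpace.single 0 1 with he
  have he1 : ‖e‖ = 1 := by simp [he]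
  set b : Space (n + 1) := (InnerProductSpace.toDual ℝ (Space (n + 1))).symm ℓ with hb
  have hℓb : ∀ x, ℓ x = ⟪b, x⟫ := fun x => by rw [hb, InnerProductSpace.toDual_symm_apply]
  have hbn : ‖b‖ = ‖ℓ‖ := by rw [hb, LinearIsometryEquiv.norm_map]
  have hℓ0 : 0 < ‖ℓ‖ := norm_pos_iff.2 hℓ
  set O : Space (n + 1) ≃ₗᵢ[ℝ] Space (n + 1) := ((ℝ ∙ (b - ‖ℓ‖ • e))ᗮ).reflection with hO
  have hOb : O b = ‖ℓ‖ • e := Submodule.reflection_sub (by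
    rw [norm_smul, he1, hbn, mul_one, norm_norm])
  have hOx : ∀ x, ℓ (O.symm x) = ‖ℓ‖ * x 0 := by
    intro x
    rw [hℓb, ← O.inner_map_map, hOb, O.apply_symm_apply, inner_smul_left, he,
      EuclideanSpace.inner_single_left]
    simp
  have hOim : ∀ s : Set (Space (n + 1)), O '' s = O.symm ⁻¹' s := fun s => by
    ext x
    constructor
    · rintro ⟨y, hy, rfl⟩
      simpa using hy
    · exact fun hx => ⟨O.symm x, hx, by simp⟩
  have hB' : MeasurableSet (O '' B) := by
    rw [hOim]; exact O.symm.continuous.measurable hB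
  have hc' : IsConeSet (O '' B) := by
    intro r hr x
    rw [hOim, mem_preimage, mem_preimage, map_smul, hc r hr]
  have key := hausdorffMeasure_cone_inter_hyperplane_zero hB' hc' (inv_pos.2 hℓ0)
  have h1 : O '' B ∩ {x | x 0 = ‖ℓ‖⁻¹} = O '' (B ∩ {x | ℓ x = 1}) := by
    rw [image_inter O.injective, hOim {x | ℓ x = 1}]
    congr 1
    ext x
    simp only [mem_ofPred_eq, mem_preimage, hOx]
    rw [mul_comm, mul_eq_one_iff_eq_inv₀ hℓ0.ne']
  have h2 : O '' B ∩ {x | 0 < x 0 ∧ x 0 < ‖ℓ‖⁻¹} = O '' (B ∩ {x | 0 < ℓ x ∧ ℓ x < 1}) := by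
    rw [image_inter O.injective, hOim {x | 0 < ℓ x ∧ ℓ x < 1}]
    congr 1
    ext x
    simp only [mem_ofPred_eq, mem_preimage, hOx]
    rw [mul_pos_iff_of_pos_left hℓ0, ← one_div, lt_div_iff₀' hℓ0]
  rw [h1, h2, O.isometry.hausdorffMeasure_image (Or.inl n.cast_nonneg), inv_inv] at key
  rw [key, hOim, O.symm.measurePreserving.measure_preimage_emb
    O.symm.toHomeomorph.measurableEmbedding, coneFactor,
    ← ofReal_norm]
  push_cast
  rfl

end FlatCone

/-! ### Area of star-shaped hypersurfaces -/

section ConeArea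

open scoped ENNReal NNReal Pointwise Topology

variable {n : ℕ}

/-- Positive homogeneity of degree one. -/
def IsPosHomogeneous {N : ℕ} (q : Space N → ℝ) : Prop :=
  ∀ r : ℝ, 0 < r → ∀ x, q (r • x) = r * q x

/-- If `a` and `b` agree to first order at `y₀`, the central projection `y ↦ y / b y` of a level
set of `a` is almost an isometry near `y₀`. -/
lemma eventually_lipschitzOnWith_central_projection {N : ℕ} {a b : Space N → ℝ} {y₀ : Space N}
    {ℓ : Space N →L[ℝ] ℝ} (ha : HasStrictFDerivAt a ℓ y₀) (hb : HasStrictFDerivAt b ℓ y₀)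
    (hb1 : b y₀ = 1) {K : ℝ≥0} (hK : 1 < K) :
    ∃ W ∈ 𝓝 y₀, LipschitzOnWith K (fun y => (b y)⁻¹ • y) (W ∩ {y | a y = 1}) := by
  set M : ℝ := ‖y₀‖ + 1 with hM
  have hMpos : 0 < M := by positivity
  obtain ⟨ε, hε, hεK⟩ : ∃ ε : ℝ, 0 < ε ∧ ∀ᶠ z : ℝ × ℝ in 𝓝 ((1 : ℝ), (1 : ℝ)),
      z.1⁻¹ + M * ε * z.1⁻¹ * z.2⁻¹ ≤ K := by
    have hK' : (1 : ℝ) < K := by exact_mod_cast hK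
    -- With this `ε` the bound equals `1 + (K - 1) / 2 < K` when both values are 1, and it stays
    -- below `K` nearby.
    refine ⟨(K - 1) / (2 * M), by have := sub_pos.2 hK'; positivity, ?_⟩
    have hcont : ContinuousAt (fun z : ℝ × ℝ => z.1⁻¹ + M * ((K - 1) / (2 * M)) * z.1⁻¹ * z.2⁻¹)
        ((1 : ℝ), (1 : ℝ)) := by
      have h1 : ContinuousAt (fun z : ℝ × ℝ => z.1⁻¹) ((1 : ℝ), (1 : ℝ)) :=
        continuousAt_fst.inv₀ one_ne_zero
      have h2 : ContinuousAt (fun z : ℝ × ℝ => z.2⁻¹) ((1 : ℝ), (1 : ℝ)) :=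
        continuousAt_snd.inv₀ one_ne_zero
      exact h1.add ((continuousAt_const.mul h1).mul h2)
    have hlt : (1 : ℝ)⁻¹ + M * ((K - 1) / (2 * M)) * (1 : ℝ)⁻¹ * (1 : ℝ)⁻¹ < K := by
      have : M * ((K - 1) / (2 * M)) = (K - 1) / 2 := by field_simp
      rw [this]; simp; linarith
    have h3 := hcont.eventually_lt continuousAt_const hlt
    exact h3.mono fun z hz => le_of_lt hz
  -- The function `a - b` has strict derivative zero at `y₀`, and on `{a = 1}` its increments are
  -- those of `-b`. So `b` is `ε`-Lipschitz on the level set near `y₀`.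
  have hab := (ha.sub hb).isLittleO.def hε
  rw [nhds_prod_eq] at hab
  have hbt : Filter.Tendsto b (𝓝 y₀) (𝓝 1) := hb1 ▸ hb.hasFDerivAt.continuousAt.tendsto
  have h2 : ∀ᶠ z in 𝓝 y₀ ×ˢ 𝓝 y₀, (b z.1)⁻¹ + M * ε * (b z.1)⁻¹ * (b z.2)⁻¹ ≤ K := by
    rw [← nhds_prod_eq]
    have h5 : Filter.Tendsto (fun z : Space N × Space N => (b z.1, b z.2)) (𝓝 (y₀, y₀))
        (𝓝 ((1 : ℝ), (1 : ℝ))) := by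
      rw [nhds_prod_eq, nhds_prod_eq]
      exact hbt.prodMap hbt
    exact h5.eventually hεK
  have h3 : ∀ᶠ y in 𝓝 y₀, 0 < b y := hbt.eventually_const_lt zero_lt_one
  have h4 : ∀ᶠ y in 𝓝 y₀, ‖y‖ ≤ M :=
    (continuous_norm.continuousAt.eventually_lt continuousAt_const (by rw [hM]; linarith)).mono
      fun y hy => le_of_lt hy
  obtain ⟨W, hW, hWW⟩ := Filter.mem_prod_self_iff.1 (hab.and h2)
  refine ⟨W ∩ {y | 0 < b y} ∩ {y | ‖y‖ ≤ M}, Filter.inter_mem (Filter.inter_mem hW h3) h4, ?_⟩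
  refine LipschitzOnWith.of_dist_le_mul fun y hy z hz => ?_
  obtain ⟨⟨⟨hyW, hy0⟩, hyM⟩, hya⟩ := hy
  obtain ⟨⟨⟨hzW, hz0⟩, hzM⟩, hza⟩ := hz
  simp only [mem_ofPred_eq] at hy0 hyM hya hz0 hzM hza
  obtain ⟨h5, h6⟩ := hWW (mk_mem_prod hyW hzW)
  simp only [Pi.sub_apply, hya, hza, sub_self, zero_apply] at h5
  rw [dist_eq_norm, dist_eq_norm]
  have h7 : (b y)⁻¹ • y - (b z)⁻¹ • z =
      (b y)⁻¹ • (y - z) + ((b z - b y) * (b y)⁻¹ * (b z)⁻¹) • z := by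
    have : (b z - b y) * (b y)⁻¹ * (b z)⁻¹ = (b y)⁻¹ - (b z)⁻¹ := by
      field_simp
    rw [this, smul_sub, sub_smul]
    abel
  have h8 : |b z - b y| ≤ ε * ‖y - z‖ := by
    refine le_trans (le_of_eq ?_) h5
    rw [Real.norm_eq_abs]
    congr 1
    ring
  calc ‖(b y)⁻¹ • y - (b z)⁻¹ • z‖
      ≤ ‖(b y)⁻¹ • (y - z)‖ + ‖((b z - b y) * (b y)⁻¹ * (b z)⁻¹) • z‖ := by
        rw [h7]; exact norm_add_le _ _
    _ = (b y)⁻¹ * ‖y - z‖ + |b z - b y| * (b y)⁻¹ * (b z)⁻¹ * ‖z‖ := by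
        rw [norm_smul, norm_smul, Real.norm_eq_abs, Real.norm_eq_abs, abs_mul, abs_mul,
          abs_of_pos (inv_pos.2 hy0), abs_of_pos (inv_pos.2 hz0)]
    _ ≤ (b y)⁻¹ * ‖y - z‖ + (ε * ‖y - z‖) * (b y)⁻¹ * (b z)⁻¹ * M := by
        gcongr
    _ = ((b y)⁻¹ + M * ε * (b y)⁻¹ * (b z)⁻¹) * ‖y - z‖ := by ring
    _ ≤ K * ‖y - z‖ := by gcongr

/-- Inside a cone, central projection carries `{a = 1}` onto `{b = 1}`, since every ray of the cone
meets `{a = 1}`. -/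
lemma hausdorffMeasure_level_le {N : ℕ} {a b : Space N → ℝ} (ha : IsPosHomogeneous a)
    (hb : IsPosHomogeneous b) {B W : Set (Space N)} (hB : IsConeSet B)
    (ha0 : ∀ x ∈ B, 0 < a x) (hW : ∀ x ∈ B, (a x)⁻¹ • x ∈ W) {K : ℝ≥0}
    (hL : LipschitzOnWith K (fun y => (b y)⁻¹ • y) (W ∩ {y | a y = 1})) (d : ℕ) :
    Measure.hausdorffMeasure (d : ℝ) (B ∩ {x | b x = 1}) ≤
      (K : ℝ≥0∞) ^ d * Measure.hausdorffMeasure (d : ℝ) (B ∩ {x | a x = 1}) := by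
  have h1 : B ∩ {x | b x = 1} ⊆ (fun y => (b y)⁻¹ • y) '' (B ∩ {x | a x = 1}) := by
    rintro x ⟨hx, hbx⟩
    have hax := inv_pos.2 (ha0 x hx)
    refine ⟨(a x)⁻¹ • x, ⟨(hB _ hax x).2 hx, ?_⟩, ?_⟩
    · simp [ha _ hax, (ha0 x hx).ne']
    · simp only [mem_ofPred_eq] at hbx
      simp [hb _ hax, hbx, smul_smul, (ha0 x hx).ne']
  have h2 : B ∩ {x | a x = 1} ⊆ W ∩ {y | a y = 1} := by
    rintro x ⟨hx, hax⟩
    refine ⟨?_, hax⟩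
    have := hW x hx
    rwa [mem_ofPred_eq.mp hax, inv_one, one_smul] at this
  refine (measure_mono h1).trans ?_
  have := (hL.mono h2).hausdorffMeasure_image_le d.cast_nonneg
  rwa [ENNReal.rpow_natCast] at this

/-- By homogeneity, `B ∩ {b < 1}` lies in the `K`-fold dilate of `B ∩ {a < 1}`. -/
lemma volume_sublevel_le {N : ℕ} {a b : Space N → ℝ} (ha : IsPosHomogeneous a)
    {B : Set (Space N)} (hB : IsConeSet B) {K : ℝ≥0} (hK : 0 < K)
    (hab : ∀ x ∈ B, a x ≤ K * b x) :
    volume (B ∩ {x | b x < 1}) ≤ (K : ℝ≥0∞) ^ N * volume (B ∩ {x | a x < 1}) := by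
  have hK0 : (0 : ℝ) < K := by exact_mod_cast hK
  have h1 : B ∩ {x | b x < 1} ⊆ (K : ℝ) • (B ∩ {x | a x < 1}) := by
    rintro x ⟨hx, hbx⟩
    rw [mem_smul_set_iff_inv_smul_mem₀ hK0.ne']
    refine ⟨(hB _ (inv_pos.2 hK0) x).2 hx, ?_⟩
    rw [mem_ofPred_eq] at hbx
    rw [mem_ofPred_eq, ha _ (inv_pos.2 hK0), inv_mul_lt_iff₀ hK0]
    exact (hab x hx).trans_lt (by gcongr)
  refine (measure_mono h1).trans ?_
  rw [Measure.addHaar_smul, finrank_euclideanSpace_fin, abs_of_nonneg (by positivity),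
    ENNReal.ofReal_pow hK0.le, ENNReal.ofReal_coe_nnreal]

lemma IsPosHomogeneous.fderiv_smul {N : ℕ} {q : Space N → ℝ} (hq : IsPosHomogeneous q)
    {r : ℝ} (hr : 0 < r) (x : Space N) : fderiv ℝ q (r • x) = fderiv ℝ q x := by
  have h1 : (fun y => q (r • y)) = r • q := funext (hq r hr)
  have h2 := fderiv_comp_smul (𝕜 := ℝ) (f := q) (x := x) r
  rw [h1, fderiv_const_smul_field] at h2
  exact (smul_right_injective _ hr.ne' h2).symm

lemma IsPosHomogeneous.fderiv_self {N : ℕ} {q : Space N → ℝ} (hq : IsPosHomogeneous q)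
    {x : Space N} (hx : DifferentiableAt ℝ q x) : fderiv ℝ q x x = q x := by
  have h1 : HasDerivAt (fun r : ℝ => q (r • x)) (fderiv ℝ q x x) 1 := by
    have h3 : HasDerivAt (fun r : ℝ => r • x) x 1 := by
      simpa using (hasDerivAt_id (1 : ℝ)).smul_const x
    have h4 : HasFDerivAt q (fderiv ℝ q x) ((1 : ℝ) • x) := by
      rw [one_smul]; exact hx.hasFDerivAt
    exact h4.comp_hasDerivAt (1 : ℝ) h3
  have h2 : HasDerivAt (fun r : ℝ => q (r • x)) (q x) 1 := by
    have h5 : HasDerivAt (fun r : ℝ => r * q x) (q x) 1 := by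
      simpa using (hasDerivAt_id (1 : ℝ)).mul_const (q x)
    refine h5.congr_of_eventuallyEq ?_
    filter_upwards [lt_mem_nhds (zero_lt_one : (0 : ℝ) < 1)] with r hr
    exact hq r hr x
  exact h1.unique h2

/-- Local comparison of the area of a star-shaped hypersurface with a volume integral. -/
lemma exists_cone_nhd_area_comparison {q : Space (n + 1) → ℝ} (hq : IsPosHomogeneous q)
    (hpos : ∀ x ≠ 0, 0 < q x) (hc : ContDiffOn ℝ 1 q {0}ᶜ) {p : Space (n + 1)} (hp : p ≠ 0)
    {K : ℝ≥0} (hK : 1 < K) :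
    ∃ U, IsOpen U ∧ p ∈ U ∧ IsConeSet U ∧ ∀ B ⊆ U, MeasurableSet B → IsConeSet B →
      Measure.hausdorffMeasure (n : ℝ) (B ∩ {x | q x = 1}) ≤ (K : ℝ≥0∞) ^ (2 * n + 2) *
        (coneFactor n * ∫⁻ x in B ∩ {x | q x < 1}, ‖fderiv ℝ q x‖ₑ) ∧
      coneFactor n * ∫⁻ x in B ∩ {x | q x < 1}, ‖fderiv ℝ q x‖ₑ ≤ (K : ℝ≥0∞) ^ (2 * n + 2) *
        Measure.hausdorffMeasure (n : ℝ) (B ∩ {x | q x = 1}) := by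
  have hopen : IsOpen ({0}ᶜ : Set (Space (n + 1))) := isOpen_compl_singleton
  have hK0 : 0 < K := zero_lt_one.trans hK
  have hKr : (1 : ℝ) < K := by exact_mod_cast hK
  -- This is the point of `{q = 1}` on the ray through `p`. Euler's identity gives `ℓ y₀ = q y₀ = 1`
  -- for the derivative `ℓ` there, so `q` and `ℓ` agree to first order at `y₀` and `{ℓ = 1}` is the
  -- tangent plane.
  set y₀ : Space (n + 1) := (q p)⁻¹ • p with hy₀
  have hqp := hpos p hp
  have hy₀0 : y₀ ≠ 0 := smul_ne_zero (inv_pos.2 hqp).ne' hp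
  have hcd : ContDiffAt ℝ 1 q y₀ := hc.contDiffAt (hopen.mem_nhds hy₀0)
  set ℓ := fderiv ℝ q y₀ with hℓ
  have hs : HasStrictFDerivAt q ℓ y₀ := hcd.hasStrictFDerivAt one_ne_zero
  have hqy : q y₀ = 1 := by rw [hy₀, hq _ (inv_pos.2 hqp), inv_mul_cancel₀ hqp.ne']
  have hℓy : ℓ y₀ = 1 := by rw [hℓ, hq.fderiv_self (hcd.differentiableAt one_ne_zero), hqy]
  have hℓ0 : ℓ ≠ 0 := fun h => by simp [h] at hℓy
  have hℓn : 0 < ‖ℓ‖ := norm_pos_iff.2 hℓ0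
  have hℓq : IsPosHomogeneous (fun x => ℓ x) := fun r _ x => by simp
  obtain ⟨W₁, hW₁, hL₁⟩ := eventually_lipschitzOnWith_central_projection hs
    ℓ.hasStrictFDerivAt hℓy hK
  obtain ⟨W₂, hW₂, hL₂⟩ := eventually_lipschitzOnWith_central_projection
    ℓ.hasStrictFDerivAt hs hqy hK
  have hqc : ContinuousAt q y₀ := hcd.continuousAt
  have hqdc : ContinuousAt (fun x => ‖fderiv ℝ q x‖) y₀ :=
    ((hc.continuousOn_fderiv_of_isOpen hopen le_rfl).continuousAt (hopen.mem_nhds hy₀0)).norm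
  have e1 : ∀ᶠ y in 𝓝 y₀, q y < K := hqc.eventually_lt continuousAt_const (by rw [hqy]; exact hKr)
  have e2 : ∀ᶠ y in 𝓝 y₀, 1 < K * q y :=
    continuousAt_const.eventually_lt (continuousAt_const.mul hqc) (by rw [hqy, mul_one]; exact hKr)
  have e3 : ∀ᶠ y in 𝓝 y₀, ‖fderiv ℝ q y‖ < K * ‖ℓ‖ :=
    hqdc.eventually_lt continuousAt_const (by rw [← hℓ]; exact lt_mul_left hℓn hKr)
  have e4 : ∀ᶠ y in 𝓝 y₀, ‖ℓ‖ < K * ‖fderiv ℝ q y‖ :=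
    continuousAt_const.eventually_lt (continuousAt_const.mul hqdc)
      (by rw [← hℓ]; exact lt_mul_left hℓn hKr)
  obtain ⟨W, hWsub, hWo, hyW⟩ := _root_.mem_nhds_iff.1 (Filter.inter_mem (Filter.inter_mem hW₁ hW₂)
    (e1.and (e2.and (e3.and e4))))
  -- Rays whose intersections with both `{q = 1}` and `{ℓ = 1}` lie in the good neighbourhood `W`;
  -- the condition depends only on the ray, so `U` is a cone.
  set U : Set (Space (n + 1)) := {x | x ≠ 0 ∧ 0 < ℓ x ∧ (q x)⁻¹ • x ∈ W ∧ (ℓ x)⁻¹ • x ∈ W} with hU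
  have hUo : IsOpen U := by
    have h1 : IsOpen ({0}ᶜ ∩ (fun x => (q x)⁻¹ • x) ⁻¹' W) := by
      refine ContinuousOn.isOpen_inter_preimage ?_ hopen hWo
      exact (hc.continuousOn.inv₀ fun x hx => (hpos x hx).ne').smul continuousOn_id
    have hV : IsOpen {x : Space (n + 1) | 0 < ℓ x} := isOpen_lt continuous_const ℓ.continuous
    have h2 : IsOpen ({x | 0 < ℓ x} ∩ (fun x => (ℓ x)⁻¹ • x) ⁻¹' W) := by
      refine ContinuousOn.isOpen_inter_preimage ?_ hV hWo
      exact (ℓ.continuous.continuousOn.inv₀ fun x hx => (ne_of_gt hx)).smul continuousOn_id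
    have : U = ({0}ᶜ ∩ (fun x => (q x)⁻¹ • x) ⁻¹' W) ∩
        ({x | 0 < ℓ x} ∩ (fun x => (ℓ x)⁻¹ • x) ⁻¹' W) := by
      ext x
      simp only [hU, mem_ofPred_eq, mem_inter_iff, mem_preimage, mem_compl_iff, mem_singleton_iff]
      tauto
    rw [this]
    exact h1.inter h2
  have hUc : IsConeSet U := by
    intro r hr x
    have h1 : (q (r • x))⁻¹ • r • x = (q x)⁻¹ • x := by
      rw [hq r hr, smul_smul, mul_inv, mul_right_comm, inv_mul_cancel₀ hr.ne', one_mul]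
    have h2 : (ℓ (r • x))⁻¹ • r • x = (ℓ x)⁻¹ • x := by
      rw [map_smul, smul_eq_mul, smul_smul, mul_inv, mul_right_comm, inv_mul_cancel₀ hr.ne',
        one_mul]
    simp only [hU, mem_ofPred_eq, h1, h2]
    simp only [map_smul, smul_eq_mul, mul_pos_iff_of_pos_left hr, Ne,
      smul_eq_zero, hr.ne', false_or]
  refine ⟨U, hUo, ?_, hUc, fun B hBU hB hBc => ?_⟩
  · have : y₀ ∈ U := ⟨hy₀0, by rw [hℓy]; exact one_pos, by rw [hqy, inv_one, one_smul]; exact hyW,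
      by rw [hℓy, inv_one, one_smul]; exact hyW⟩
    rwa [hy₀, hUc _ (inv_pos.2 hqp)] at this
  have hBq : ∀ x ∈ B, 0 < q x := fun x hx => hpos x (hBU hx).1
  have hBℓ : ∀ x ∈ B, 0 < ℓ x := fun x hx => (hBU hx).2.1
  have hH₁ := hausdorffMeasure_level_le hq hℓq hBc hBq
    (fun x hx => (hWsub (hBU hx).2.2.1).1.1) hL₁ n
  have hH₂ := hausdorffMeasure_level_le hℓq hq hBc hBℓ
    (fun x hx => (hWsub (hBU hx).2.2.2).1.2) hL₂ n
  have hV₁ := volume_sublevel_le (b := fun x => ℓ x) hq hBc hK0 fun x hx => by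
    have h1 := (hWsub (hBU hx).2.2.2).2.1
    rw [hq _ (inv_pos.2 (hBℓ x hx)), inv_mul_lt_iff₀ (hBℓ x hx), mul_comm] at h1
    exact h1.le
  have hV₂ := volume_sublevel_le (b := q) hℓq hBc hK0 fun x hx => by
    have h1 := (hWsub (hBU hx).2.2.2).2.2.1
    rw [hq _ (inv_pos.2 (hBℓ x hx)), mul_left_comm,
      ← div_eq_inv_mul, one_lt_div (hBℓ x hx)] at h1
    exact h1.le
  have hflat := hausdorffMeasure_cone_inter_hyperplane hB hBc hℓ0
  have hset : B ∩ {x | 0 < ℓ x ∧ ℓ x < 1} = B ∩ {x | ℓ x < 1} := by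
    ext x
    simp only [mem_inter_iff, mem_ofPred_eq]
    exact ⟨fun h => ⟨h.1, h.2.2⟩, fun h => ⟨h.1, hBℓ x h.1, h.2⟩⟩
  rw [hset] at hflat
  have hqm : Measurable q := measurable_of_continuousOn_compl_singleton 0 hc.continuousOn
  have hms : MeasurableSet (B ∩ {x | q x < 1}) := hB.inter (measurableSet_lt hqm measurable_const)
  have hdx : ∀ x ∈ B, fderiv ℝ q ((q x)⁻¹ • x) = fderiv ℝ q x := fun x hx =>
    hq.fderiv_smul (inv_pos.2 (hBq x hx)) x
  have hI₁ : ‖ℓ‖ₑ * volume (B ∩ {x | q x < 1}) ≤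
      K * ∫⁻ x in B ∩ {x | q x < 1}, ‖fderiv ℝ q x‖ₑ := by
    rw [← lintegral_const_mul' _ _ ENNReal.coe_ne_top, ← setLIntegral_const]
    refine setLIntegral_mono' hms fun x hx => ?_
    have h1 := (hWsub (hBU hx.1).2.2.1).2.2.2.2
    rw [hdx x hx.1] at h1
    have h2 : ‖ℓ‖₊ ≤ K * ‖fderiv ℝ q x‖₊ := by exact_mod_cast h1.le
    rw [enorm_eq_nnnorm, enorm_eq_nnnorm]
    exact_mod_cast h2
  have hI₂ : ∫⁻ x in B ∩ {x | q x < 1}, ‖fderiv ℝ q x‖ₑ ≤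
      K * (‖ℓ‖ₑ * volume (B ∩ {x | q x < 1})) := by
    rw [← mul_assoc, ← setLIntegral_const]
    refine setLIntegral_mono' hms fun x hx => ?_
    have h1 := (hWsub (hBU hx.1).2.2.1).2.2.2.1
    rw [hdx x hx.1] at h1
    have h2 : ‖fderiv ℝ q x‖₊ ≤ K * ‖ℓ‖₊ := by exact_mod_cast h1.le
    rw [enorm_eq_nnnorm, enorm_eq_nnnorm]
    exact_mod_cast h2
  -- In each direction the losses are `K ^ n` for projecting the hypersurface, `K ^ (n + 1)` for
  -- comparing the sublevel sets and `K` for freezing the gradient: in all `K ^ (2 * n + 2)`.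
  constructor
  · calc Measure.hausdorffMeasure (n : ℝ) (B ∩ {x | q x = 1})
        ≤ K ^ n * Measure.hausdorffMeasure (n : ℝ) (B ∩ {x | ℓ x = 1}) := hH₂
      _ = K ^ n * (coneFactor n * ‖ℓ‖ₑ * volume (B ∩ {x | ℓ x < 1})) := by rw [hflat]
      _ ≤ K ^ n * (coneFactor n * ‖ℓ‖ₑ * (K ^ (n + 1) * volume (B ∩ {x | q x < 1}))) := by
          gcongr
      _ = K ^ n * K ^ (n + 1) * coneFactor n * (‖ℓ‖ₑ * volume (B ∩ {x | q x < 1})) := by ring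
      _ ≤ K ^ n * K ^ (n + 1) * coneFactor n *
          (K * ∫⁻ x in B ∩ {x | q x < 1}, ‖fderiv ℝ q x‖ₑ) := by gcongr
      _ = _ := by ring
  · calc coneFactor n * ∫⁻ x in B ∩ {x | q x < 1}, ‖fderiv ℝ q x‖ₑ
        ≤ coneFactor n * (K * (‖ℓ‖ₑ * volume (B ∩ {x | q x < 1}))) := by gcongr
      _ ≤ coneFactor n * (K * (‖ℓ‖ₑ * (K ^ (n + 1) * volume (B ∩ {x | ℓ x < 1})))) := by gcongr
      _ = K * K ^ (n + 1) * (coneFactor n * ‖ℓ‖ₑ * volume (B ∩ {x | ℓ x < 1})) := by ring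
      _ = K * K ^ (n + 1) * Measure.hausdorffMeasure (n : ℝ) (B ∩ {x | ℓ x = 1}) := by rw [hflat]
      _ ≤ K * K ^ (n + 1) * (K ^ n * Measure.hausdorffMeasure (n : ℝ) (B ∩ {x | q x = 1})) := by
          gcongr
      _ = _ := by ring

/-- Area of a star-shaped hypersurface `{q = 1}` as a volume integral. -/
theorem hausdorffMeasure_level_eq {q : Space (n + 1) → ℝ} (hq : IsPosHomogeneous q)
    (hpos : ∀ x ≠ 0, 0 < q x) (hc : ContDiffOn ℝ 1 q {0}ᶜ) :
    Measure.hausdorffMeasure (n : ℝ) {x | q x = 1} =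
      coneFactor n * ∫⁻ x in {x | q x < 1}, ‖fderiv ℝ q x‖ₑ := by
  have hqm : Measurable q := measurable_of_continuousOn_compl_singleton 0 hc.continuousOn
  have hm1 : MeasurableSet {x | q x = 1} := hqm (measurableSet_singleton 1)
  have hm2 : MeasurableSet {x | q x < 1} := measurableSet_lt hqm measurable_const
  set μ₁ : Measure (Space (n + 1)) := (Measure.hausdorffMeasure (n : ℝ)).restrict {x | q x = 1}
    with hμ₁
  set μ₂ : Measure (Space (n + 1)) := (coneFactor n : ℝ≥0∞) •
    (volume.restrict {x | q x < 1}).withDensity fun x => ‖fderiv ℝ q x‖ₑ with hμ₂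
  have h1 : ∀ B, MeasurableSet B → μ₁ B = Measure.hausdorffMeasure (n : ℝ) (B ∩ {x | q x = 1}) :=
    fun B hB => Measure.restrict_apply hB
  have h2 : ∀ B, MeasurableSet B →
      μ₂ B = coneFactor n * ∫⁻ x in B ∩ {x | q x < 1}, ‖fderiv ℝ q x‖ₑ := fun B hB => by
    rw [hμ₂, Measure.smul_apply, withDensity_apply _ hB, Measure.restrict_restrict hB, smul_eq_mul]
  have hq0 : q 0 = 0 := by
    have := hq 2 two_pos 0
    rw [smul_zero] at this
    linarith
  -- The local comparison is made global by compactness of the unit sphere. The inductive property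
  -- concerns all measurable subcones of `U`, so for a union a cone `B` splits into `B ∩ U` and `B \
  -- U`, which are again cones.
  have key : ∀ K : ℝ≥0, 1 < K → μ₁ {0}ᶜ ≤ K ^ (2 * n + 2) * μ₂ {0}ᶜ ∧
      μ₂ {0}ᶜ ≤ K ^ (2 * n + 2) * μ₁ {0}ᶜ := by
    intro K hK
    obtain ⟨U, hSU, hUm, hUc, hU⟩ : ∃ U : Set (Space (n + 1)), sphere (0 : Space (n + 1)) 1 ⊆ U ∧
        MeasurableSet U ∧ IsConeSet U ∧ ∀ B ⊆ U, MeasurableSet B → IsConeSet B →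
        μ₁ B ≤ K ^ (2 * n + 2) * μ₂ B ∧ μ₂ B ≤ K ^ (2 * n + 2) * μ₁ B := by
      refine (isCompact_sphere (0 : Space (n + 1)) 1).induction_on
        (p := fun s => ∃ U : Set (Space (n + 1)), s ⊆ U ∧ MeasurableSet U ∧ IsConeSet U ∧
          ∀ B ⊆ U, MeasurableSet B → IsConeSet B →
          μ₁ B ≤ K ^ (2 * n + 2) * μ₂ B ∧ μ₂ B ≤ K ^ (2 * n + 2) * μ₁ B) ?_ ?_ ?_ ?_
      · refine ⟨∅, subset_rfl, MeasurableSet.empty, fun r _ x => by simp, fun B hB _ _ => ?_⟩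
        rw [subset_empty_iff.1 hB]
        simp
      · rintro s t hst ⟨U, htU, hU⟩
        exact ⟨U, hst.trans htU, hU⟩
      · rintro s t ⟨U, hsU, hUm, hUc, hU⟩ ⟨V, htV, hVm, hVc, hV⟩
        refine ⟨U ∪ V, union_subset_union hsU htV, hUm.union hVm, fun r hr x => ?_,
          fun B hB hBm hBc => ?_⟩
        · rw [mem_union, mem_union, hUc r hr, hVc r hr]
        have a1 := hU (B ∩ U) inter_subset_right (hBm.inter hUm) fun r hr x => by
          rw [mem_inter_iff, mem_inter_iff, hBc r hr, hUc r hr]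
        have a2 := hV (B \ U) (fun x hx => (hB hx.1).resolve_left hx.2) (hBm.diff hUm)
          fun r hr x => by rw [mem_sdiff, mem_sdiff, hBc r hr, hUc r hr]
        rw [← measure_inter_add_sdiff B hUm, ← measure_inter_add_sdiff (μ := μ₂) B hUm, mul_add,
          mul_add]
        exact ⟨add_le_add a1.1 a2.1, add_le_add a1.2 a2.2⟩
      · intro p hp
        have hp0 : p ≠ 0 := ne_zero_of_mem_unit_sphere ⟨p, hp⟩
        obtain ⟨U, hUo, hpU, hUc, hU⟩ := exists_cone_nhd_area_comparison hq hpos hc hp0 hK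
        refine ⟨U, mem_nhdsWithin_of_mem_nhds (hUo.mem_nhds hpU), U, subset_rfl, hUo.measurableSet,
          hUc, fun B hBU hB hBc => ?_⟩
        rw [h1 B hB, h2 B hB]
        exact hU B hBU hB hBc
    refine hU {0}ᶜ (fun x hx => ?_) (measurableSet_singleton 0).compl fun r hr x => ?_
    · have hx0 : ‖x‖ ≠ 0 := norm_ne_zero_iff.2 hx
      rw [← hUc ‖x‖⁻¹ (by positivity)]
      exact hSU (by simp [norm_smul, hx0])
    · simp [hr.ne']
  -- Letting `K` decrease to 1 removes the error factor.
  have hlim : ∀ a b : ℝ≥0∞, (∀ K : ℝ≥0, 1 < K → a ≤ K ^ (2 * n + 2) * b) → a ≤ b := by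
    intro a b hab
    have ht : Filter.Tendsto (fun K : ℝ≥0 => (K : ℝ≥0∞) ^ (2 * n + 2) * b) (𝓝[>] 1)
        (𝓝 ((1 : ℝ≥0∞) ^ (2 * n + 2) * b)) := by
      refine ENNReal.Tendsto.mul_const ?_ (Or.inl (by simp))
      refine ENNReal.Tendsto.pow ?_
      exact (ENNReal.continuous_coe.tendsto 1).mono_left nhdsWithin_le_nhds
    rw [one_pow, one_mul] at ht
    have hne : (𝓝[>] (1 : ℝ≥0)).NeBot := inferInstance
    exact ge_of_tendsto ht (by
      filter_upwards [self_mem_nhdsWithin] with K hK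
      exact hab K hK)
  have heq : μ₁ {0}ᶜ = μ₂ {0}ᶜ :=
    le_antisymm (hlim _ _ fun K hK => (key K hK).1) (hlim _ _ fun K hK => (key K hK).2)
  have h3 : {x | q x = 1} ⊆ {0}ᶜ := by
    intro x hx h0
    rw [mem_ofPred_eq, mem_singleton_iff.1 h0, hq0] at hx
    exact zero_ne_one hx
  rw [h1 _ (measurableSet_singleton 0).compl, inter_eq_self_of_subset_right h3,
    h2 _ (measurableSet_singleton 0).compl] at heq
  rw [heq]
  congr 1
  refine setLIntegral_congr ?_
  have : ({0}ᶜ : Set (Space (n + 1))) =ᵐ[volume] univ :=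
    ae_eq_univ.2 (by simp)
  simpa using this.inter (Filter.EventuallyEq.refl _ {x | q x < 1})

end ConeArea

/-! ### Area and volume of radial graphs -/

section RadialGraph

open scoped ENNReal NNReal

variable {n : ℕ}

/-- On the ray through `p` the sublevel set is `r < (q p)⁻¹` and `G` is constant, so the radial
integral is that of `r ^ n`. -/
lemma lintegral_sublevel {q : Space (n + 1) → ℝ} (hq : IsPosHomogeneous q)
    (hpos : ∀ x ≠ 0, 0 < q x) (hqm : Measurable q) {G : Space (n + 1) → ℝ≥0∞}
    (hG : ∀ r : ℝ, 0 < r → ∀ x, G (r • x) = G x) (hGm : Measurable G) :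
    ∫⁻ x in {x | q x < 1}, G x = ∫⁻ p : sphere (0 : Space (n + 1)) 1,
      ENNReal.ofReal ((q p)⁻¹ ^ (n + 1) / (n + 1)) * G p ∂(sphereMeasure (n + 1)) := by
  have hm2 : MeasurableSet {x | q x < 1} := measurableSet_lt hqm measurable_const
  rw [← lintegral_indicator hm2, lintegral_polar (by omega) _ (hGm.indicator hm2)]
  congr 1
  ext p
  have hqp : 0 < q p := hpos _ (ne_zero_of_mem_unit_sphere p)
  have h1 : ∀ r ∈ Ioi (0 : ℝ), ENNReal.ofReal (r ^ (n + 1 - 1)) *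
      {x | q x < 1}.indicator G (r • (p : Space (n + 1))) =
      (Iio (q p)⁻¹).indicator (fun r => ENNReal.ofReal (r ^ n) * G p) r := by
    intro r hr
    have h2 : r • (p : Space (n + 1)) ∈ {x | q x < 1} ↔ r ∈ Iio (q p)⁻¹ := by
      rw [mem_ofPred_eq, hq r hr, mem_Iio, ← one_div, lt_div_iff₀ hqp]
    by_cases h : r ∈ Iio (q p)⁻¹
    · rw [indicator_of_mem h, indicator_of_mem (h2.2 h), hG r hr, Nat.add_sub_cancel]
    · rw [indicator_of_notMem h, indicator_of_notMem (mt h2.1 h), mul_zero]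
  rw [setLIntegral_congr_fun measurableSet_Ioi h1, setLIntegral_indicator measurableSet_Iio,
    lintegral_mul_const _ (by fun_prop), inter_comm, Ioi_inter_Iio]
  congr 1
  rw [Measure.restrict_congr_set Ioo_ae_eq_Ioc, ← ofReal_integral_eq_lintegral_ofReal,
    ← intervalIntegral.integral_of_le (inv_pos.2 hqp).le, integral_pow]
  · simp
  · have : ContinuousOn (fun z : ℝ => z ^ n) (Icc 0 (q p)⁻¹) := by fun_prop
    exact (this.integrableOn_Icc).mono_set Ioc_subset_Icc_self
  · filter_upwards [ae_restrict_mem measurableSet_Ioc] with z hz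
    exact pow_nonneg hz.1.le _

/-- The gauge of the star-shaped domain whose boundary is the radial graph of `exp s`. -/
def starGauge {N : ℕ} (s : Space N → ℝ) (x : Space N) : ℝ := ‖x‖ * Real.exp (-s x)

section

variable {N : ℕ} {s : Space N → ℝ}

lemma isPosHomogeneous_starGauge (hs : IsRadiallyConstant s) :
    IsPosHomogeneous (starGauge s) := by
  intro r hr x
  simp only [starGauge, norm_smul, hs r hr, Real.norm_eq_abs, abs_of_pos hr, mul_assoc]

lemma starGauge_pos {x : Space N} (hx : x ≠ 0) : 0 < starGauge s x :=
  mul_pos (norm_pos_iff.2 hx) (Real.exp_pos _)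

lemma contDiffOn_starGauge (hc : ContDiffOn ℝ 1 s {0}ᶜ) :
    ContDiffOn ℝ 1 (starGauge s) {0}ᶜ := by
  refine ContDiffOn.mul (fun x hx => (contDiffAt_norm ℝ hx).contDiffWithinAt) ?_
  exact Real.contDiff_exp.comp_contDiffOn hc.neg

lemma hasFDerivAt_norm_of_mem_sphere {p : Space N} (hp : p ∈ sphere (0 : Space N) 1) :
    HasFDerivAt (fun x : Space N => ‖x‖) (innerSL ℝ p) p := by
  have hp1 : ‖p‖ = 1 := mem_sphere_zero_iff_norm.1 hp
  have hp0 : p ≠ 0 := ne_zero_of_mem_unit_sphere ⟨p, hp⟩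
  have hd : HasFDerivAt (fun x : Space N => ‖x‖) (fderiv ℝ (fun x : Space N => ‖x‖) p) p :=
    ((contDiffAt_norm ℝ hp0 (n := 1)).differentiableAt one_ne_zero).hasFDerivAt
  have h5 : HasFDerivAt (fun x : Space N => ‖x‖ ^ 2) (2 • (innerSL ℝ p)) p :=
    (hasStrictFDerivAt_norm_sq p).hasFDerivAt
  have h6 := (hd.pow 2).unique h5
  have h7 : fderiv ℝ (fun x : Space N => ‖x‖) p = innerSL ℝ p := by
    ext v
    have h8 := congrArg (fun L => L v) h6
    simp [hp1] at h8
    simpa using h8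
  rwa [h7] at hd

/-- At a point of the sphere the gradient of the gauge is `exp (-s p) • (p - ∇s)`, and `∇s` is
orthogonal to the unit vector `p` because `s` is constant along rays. -/
lemma norm_fderiv_starGauge (hs : IsRadiallyConstant s) (hc : ContDiffOn ℝ 1 s {0}ᶜ)
    {p : Space N} (hp : p ∈ sphere (0 : Space N) 1) :
    ‖fderiv ℝ (starGauge s) p‖ = Real.exp (-s p) * √(1 + ‖fderiv ℝ s p‖ ^ 2) := by
  have hp1 : ‖p‖ = 1 := mem_sphere_zero_iff_norm.1 hp
  have hp0 : p ≠ 0 := ne_zero_of_mem_unit_sphere ⟨p, hp⟩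
  have hsd : DifferentiableAt ℝ s p := (hc.differentiableOn one_ne_zero).differentiableAt
    (isOpen_compl_singleton.mem_nhds hp0)
  have hn := hasFDerivAt_norm_of_mem_sphere hp
  have h1 : HasFDerivAt (starGauge s)
      (Real.exp (-s p) • (innerSL ℝ p - fderiv ℝ s p)) p := by
    have h2 := hn.mul (hsd.hasFDerivAt.neg.exp)
    refine h2.congr_fderiv ?_
    ext v
    simp [hp1]
    ring
  rw [h1.fderiv, norm_smul, Real.norm_eq_abs, abs_of_pos (Real.exp_pos _)]
  congr 1
  set g := (InnerProductSpace.toDual ℝ (Space N)).symm (fderiv ℝ s p) with hg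
  have hgx : ∀ x, ⟪g, x⟫ = fderiv ℝ s p x := fun x => by
    rw [hg, InnerProductSpace.toDual_symm_apply]
  have h3 : innerSL ℝ p - fderiv ℝ s p = innerSL ℝ (p - g) := by
    ext v
    simp [hgx]
  have h4 : ‖g‖ = ‖fderiv ℝ s p‖ := by rw [hg, LinearIsometryEquiv.norm_map]
  rw [h3, innerSL_apply_norm, ← h4, eq_comm, Real.sqrt_eq_iff_mul_self_eq_of_pos]
  · have := norm_sub_sq_real p g
    rw [real_inner_comm, hgx, hs.fderiv_self p hsd, hp1] at this
    rw [← pow_two, this]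
    ring
  · rw [norm_pos_iff, sub_ne_zero]
    intro h
    have := hgx p
    rw [hs.fderiv_self p hsd, ← h, real_inner_self_eq_norm_sq, hp1] at this
    norm_num at this

end

lemma integrable_sphere_of_continuousOn {N : ℕ} {f : Space N → ℝ} (hf : ContinuousOn f {0}ᶜ) :
    Integrable (fun p : sphere (0 : Space N) 1 => f p) (sphereMeasure N) := by
  have hc : Continuous fun p : sphere (0 : Space N) 1 => f p :=
    hf.comp_continuous continuous_subtype_val fun p => ne_zero_of_mem_unit_sphere p
  rw [← integrableOn_univ]
  exact hc.continuousOn.integrableOn_compact isCompact_univ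

lemma continuousOn_sqrt_one_add_norm_fderiv {N : ℕ} {s : Space N → ℝ}
    (hc : ContDiffOn ℝ 1 s {0}ᶜ) :
    ContinuousOn (fun x => √(1 + ‖fderiv ℝ s x‖ ^ 2)) {0}ᶜ := by
  have := hc.continuousOn_fderiv_of_isOpen isOpen_compl_singleton le_rfl
  fun_prop

/-- Area of a radial graph over the unit sphere. -/
theorem hausdorffMeasure_radialGraph {s : Space (n + 1) → ℝ} (hs : IsRadiallyConstant s)
    (hc : ContDiffOn ℝ 1 s {0}ᶜ) :
    (Measure.hausdorffMeasure (n : ℝ) {x | starGauge s x = 1}).toReal =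
      coneFactor n / (n + 1) * ∫ p : sphere (0 : Space (n + 1)) 1,
        Real.exp (n * s p) * √(1 + ‖fderiv ℝ s p‖ ^ 2) ∂(sphereMeasure (n + 1)) := by
  have hq := isPosHomogeneous_starGauge hs
  have hqc := contDiffOn_starGauge hc
  rw [hausdorffMeasure_level_eq hq (fun x hx => starGauge_pos hx) hqc,
    lintegral_sublevel hq (fun x hx => starGauge_pos hx)
      (measurable_of_continuousOn_compl_singleton 0 hqc.continuousOn)
      (fun r hr x => by rw [hq.fderiv_smul hr]) (measurable_fderiv ℝ _).enorm,
    ENNReal.toReal_mul, ENNReal.coe_toReal, div_mul_eq_mul_div, mul_div_assoc, ← integral_div]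
  congr 1
  rw [integral_eq_lintegral_of_nonneg_ae]
  · congr 1
    refine lintegral_congr fun p => ?_
    rw [← ofReal_norm, ← ENNReal.ofReal_mul (by
      have := starGauge_pos (s := s) (ne_zero_of_mem_unit_sphere p); positivity),
      norm_fderiv_starGauge hs hc p.2]
    congr 1
    have hp1 : ‖(p : Space (n + 1))‖ = 1 := mem_sphere_zero_iff_norm.1 p.2
    -- The polar factor contributes `exp ((n + 1) s)` and the gradient `exp (-s)`, leaving `exp (n
    -- s)`.
    rw [starGauge, hp1, one_mul, Real.exp_neg, inv_inv, pow_succ, Real.exp_nat_mul]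
    field_simp
  · exact Filter.Eventually.of_forall fun p => by positivity
  · refine (integrable_sphere_of_continuousOn (f := fun x => Real.exp (n * s x) *
      √(1 + ‖fderiv ℝ s x‖ ^ 2) / (n + 1)) ?_).aestronglyMeasurable
    have h1 := hc.continuousOn
    have h2 := continuousOn_sqrt_one_add_norm_fderiv hc
    fun_prop

/-- Volume of a star-shaped domain. -/
theorem volume_radialGraph {s : Space (n + 1) → ℝ} (hs : IsRadiallyConstant s)
    (hc : ContDiffOn ℝ 1 s {0}ᶜ) :
    (volume {x | starGauge s x < 1}).toReal = 1 / (n + 1) *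
      ∫ p : sphere (0 : Space (n + 1)) 1, Real.exp ((n + 1) * s p) ∂(sphereMeasure (n + 1)) := by
  have hq := isPosHomogeneous_starGauge hs
  have hqc := contDiffOn_starGauge hc
  rw [← setLIntegral_one, lintegral_sublevel hq (fun x hx => starGauge_pos hx)
      (measurable_of_continuousOn_compl_singleton 0 hqc.continuousOn)
      (fun r hr x => rfl) measurable_const, ← integral_const_mul,
    integral_eq_lintegral_of_nonneg_ae]
  · congr 1
    refine lintegral_congr fun p => ?_
    have hp1 : ‖(p : Space (n + 1))‖ = 1 := mem_sphere_zero_iff_norm.1 p.2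
    rw [starGauge, hp1, one_mul, Real.exp_neg, inv_inv, mul_one, ← Real.exp_nat_mul]
    congr 1
    push_cast
    ring
  · exact Filter.Eventually.of_forall fun p => by positivity
  · refine (integrable_sphere_of_continuousOn (f := fun x => 1 / ((n : ℝ) + 1) *
      Real.exp ((n + 1) * s x)) ?_).aestronglyMeasurable
    have h1 := hc.continuousOn
    fun_prop

end RadialGraph

/-! ### Inverse families and crossing radii -/

section Isotopy

open scoped Topology

variable {N : ℕ}

/-- The inverses of a `C²` family of `C²` diffeomorphisms form a `C²` family. -/
lemma contDiffAt_inverse_family {I : Set ℝ} (hI : IsOpen I) {ψ η : ℝ → Space N → Space N}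
    (hψ : ContDiffOn ℝ 2 (fun q : ℝ × Space N => ψ q.1 q.2) (I ×ˢ univ))
    (hη : ∀ t ∈ I, ContDiff ℝ 2 (η t)) (hl : ∀ t ∈ I, Function.LeftInverse (η t) (ψ t))
    (hr : ∀ t ∈ I, Function.RightInverse (η t) (ψ t)) {t₀ : ℝ} (ht₀ : t₀ ∈ I) (y₀ : Space N) :
    ContDiffAt ℝ 2 (fun q : ℝ × Space N => η q.1 q.2) (t₀, y₀) := by
  set x₀ := η t₀ y₀ with hx₀
  -- The inverse function theorem is applied in space-time. The derivative of `Ξ` is block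
  -- triangular, and injective because `η t₀ ∘ ψ t₀ = id` makes its spatial block injective. Near
  -- `(t₀, y₀)` the local inverse of `Ξ` must then have `η` as its spatial component.
  set Ξ : ℝ × Space N → ℝ × Space N := fun q => (q.1, ψ q.1 q.2) with hΞ
  have hopen : IsOpen (I ×ˢ (univ : Set (Space N))) := hI.prod isOpen_univ
  have hmem : (t₀, x₀) ∈ I ×ˢ (univ : Set (Space N)) := ⟨ht₀, mem_univ _⟩
  have hψc : ContDiffAt ℝ 2 (fun q : ℝ × Space N => ψ q.1 q.2) (t₀, x₀) :=
    hψ.contDiffAt (hopen.mem_nhds hmem)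
  have hΞc : ContDiffAt ℝ 2 Ξ (t₀, x₀) := contDiffAt_fst.prodMk hψc
  have hΞ0 : Ξ (t₀, x₀) = (t₀, y₀) := by
    simp only [hΞ, hx₀, hr t₀ ht₀ y₀]
  set P := fderiv ℝ (fun q : ℝ × Space N => ψ q.1 q.2) (t₀, x₀) with hP
  have hPd : HasFDerivAt (fun q : ℝ × Space N => ψ q.1 q.2) P (t₀, x₀) :=
    (hψc.differentiableAt two_ne_zero).hasFDerivAt
  set D : ℝ × Space N →L[ℝ] ℝ × Space N := (ContinuousLinearMap.fst ℝ ℝ (Space N)).prod P with hD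
  have hΞd : HasFDerivAt Ξ D (t₀, x₀) := hasFDerivAt_fst.prodMk hPd
  have hinj : Function.Injective D := by
    rw [injective_iff_map_eq_zero]
    rintro ⟨τ, k⟩ h
    have hτ : τ = 0 := congrArg Prod.fst h
    have hk : P (0, k) = 0 := by
      have := congrArg Prod.snd h
      rwa [hτ] at this
    have h1 : HasFDerivAt (ψ t₀) (P.comp (ContinuousLinearMap.inr ℝ ℝ (Space N))) x₀ := by
      have h2 : HasFDerivAt (fun x : Space N => (t₀, x)) (ContinuousLinearMap.inr ℝ ℝ (Space N)) x₀ :=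
        hasFDerivAt_prodMk_right t₀ x₀
      exact hPd.comp x₀ h2
    have h3 : HasFDerivAt (η t₀) (fderiv ℝ (η t₀) (ψ t₀ x₀)) (ψ t₀ x₀) :=
      ((hη t₀ ht₀).differentiable two_ne_zero _).hasFDerivAt
    have h4 := h3.comp x₀ h1
    have h5 : η t₀ ∘ ψ t₀ = id := funext (hl t₀ ht₀)
    rw [h5] at h4
    have h6 := congrArg (fun L => L k) (h4.unique (hasFDerivAt_id x₀))
    simp [hk] at h6
    simp [hτ, ← h6]
  set e : (ℝ × Space N) ≃L[ℝ] (ℝ × Space N) :=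
    (LinearEquiv.ofInjectiveEndo (D : ℝ × Space N →ₗ[ℝ] ℝ × Space N) hinj).toContinuousLinearEquiv
    with he
  have hed : HasFDerivAt Ξ (e : ℝ × Space N →L[ℝ] ℝ × Space N) (t₀, x₀) := by
    refine hΞd.congr_fderiv ?_
    ext v <;> simp [he]
  have hloc := hΞc.to_localInverse hed two_ne_zero
  have hev := (hΞc.hasStrictFDerivAt' hed two_ne_zero).eventually_right_inverse
  rw [hΞ0] at hloc hev
  have hsnd := contDiffAt_snd.comp (t₀, y₀) hloc
  refine hsnd.congr_of_eventuallyEq ?_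
  have hIev : ∀ᶠ q : ℝ × Space N in 𝓝 (t₀, y₀), q.1 ∈ I :=
    continuousAt_fst.eventually (hI.mem_nhds ht₀)
  filter_upwards [hev, hIev] with q hq hqI
  set z := hΞc.localInverse hed two_ne_zero q with hz
  have hq' : Ξ z = q := hq
  have h1 : (Ξ z).1 = q.1 := by rw [hq']
  have h2 : (Ξ z).2 = q.2 := by rw [hq']
  change z.1 = q.1 at h1
  change ψ z.1 z.2 = q.2 at h2
  rw [h1] at h2
  show η q.1 q.2 = z.2
  rw [← h2, hl _ hqI]

/-- A positive function of `r` along each ray crossing the value `1` transversally in an annulus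
and only there: the crossing radius is a `C²` function. -/
lemma exists_contDiff_crossing_radius {I : Set ℝ} (hI : IsOpen I) {h : ℝ × Space N → ℝ}
    (hh : ContDiffOn ℝ 2 h (I ×ˢ univ))
    (hlow : ∀ t ∈ I, ∀ y : Space N, ‖y‖ ≤ 1 / 2 → h (t, y) < 1)
    (hhigh : ∀ t ∈ I, ∀ y : Space N, 2 ≤ ‖y‖ → 1 < h (t, y))
    (hder : ∀ t ∈ I, ∀ y : Space N, 1 / 2 ≤ ‖y‖ → ‖y‖ ≤ 2 → 0 < fderiv ℝ h (t, y) (0, y)) :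
    ∃ g : ℝ → Space N → ℝ, ContDiffOn ℝ 2 (fun q : ℝ × Space N => g q.1 q.2) (I ×ˢ {0}ᶜ) ∧
      (∀ t x, 0 < g t x) ∧ (∀ t, IsRadiallyConstant (g t)) ∧
      ∀ t ∈ I, ∀ x : Space N, x ≠ 0 → (h (t, x) < 1 ↔ ‖x‖ < g t x) ∧
        (h (t, x) = 1 ↔ ‖x‖ = g t x) := by
  have hopen : IsOpen (I ×ˢ (univ : Set (Space N))) := hI.prod isOpen_univ
  have hcd : ∀ t ∈ I, ∀ y, ContDiffAt ℝ 2 h (t, y) := fun t ht y =>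
    hh.contDiffAt (hopen.mem_nhds ⟨ht, mem_univ _⟩)
  have hderiv : ∀ t ∈ I, ∀ u : Space N, ∀ r : ℝ,
      HasDerivAt (fun r : ℝ => h (t, r • u)) (fderiv ℝ h (t, r • u) (0, u)) r := by
    intro t ht u r
    have h1 : HasDerivAt (fun r : ℝ => (t, r • u)) ((0 : ℝ), u) r := by
      refine (hasDerivAt_const r t).prodMk ?_
      simpa using (hasDerivAt_id r).smul_const u
    exact ((hcd t ht (r • u)).differentiableAt two_ne_zero).hasFDerivAt.comp_hasDerivAt r h1
  have hpos : ∀ t ∈ I, ∀ u : Space N, ‖u‖ = 1 → ∀ r ∈ Icc (1 / 2 : ℝ) 2,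
      0 < fderiv ℝ h (t, r • u) (0, u) := by
    intro t ht u hu r hr
    have hr0 : 0 < r := by linarith [hr.1]
    have hn : ‖r • u‖ = r := by rw [norm_smul, hu, mul_one, Real.norm_eq_abs, abs_of_pos hr0]
    have h1 := hder t ht (r • u) (by rw [hn]; exact hr.1) (by rw [hn]; exact hr.2)
    have h2 : ((0 : ℝ), r • u) = r • ((0 : ℝ), u) := by simp
    rw [h2, map_smul, smul_eq_mul] at h1
    exact (mul_pos_iff_of_pos_left hr0).1 h1
  have hmono : ∀ t ∈ I, ∀ u : Space N, ‖u‖ = 1 →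
      StrictMonoOn (fun r : ℝ => h (t, r • u)) (Icc (1 / 2) 2) := by
    intro t ht u hu
    refine strictMonoOn_of_deriv_pos (convex_Icc _ _) ?_ ?_
    · exact fun r _ => (hderiv t ht u r).continuousAt.continuousWithinAt
    · intro r hr
      rw [(hderiv t ht u r).deriv]
      exact hpos t ht u hu r (interior_subset hr)
  have hex : ∀ t ∈ I, ∀ u : Space N, ‖u‖ = 1 → ∃ r₀ ∈ Ioo (1 / 2 : ℝ) 2,
      ∀ r : ℝ, 0 < r → (h (t, r • u) < 1 ↔ r < r₀) ∧ (h (t, r • u) = 1 ↔ r = r₀) := by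
    intro t ht u hu
    have hn : ∀ r : ℝ, 0 < r → ‖r • u‖ = r := fun r hr => by
      rw [norm_smul, hu, mul_one, Real.norm_eq_abs, abs_of_pos hr]
    have hl : ∀ r : ℝ, 0 < r → r ≤ 1 / 2 → h (t, r • u) < 1 := fun r hr h2 =>
      hlow t ht _ (by rwa [hn r hr])
    have hg : ∀ r : ℝ, 2 ≤ r → 1 < h (t, r • u) := fun r hr =>
      hhigh t ht _ (by rwa [hn r (by linarith)])
    have hcont : ContinuousOn (fun r : ℝ => h (t, r • u)) (Icc (1 / 2) 2) :=
      fun r _ => (hderiv t ht u r).continuousAt.continuousWithinAt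
    obtain ⟨r₀, hr₀, hr₁⟩ := intermediate_value_Ioo (by norm_num : (1 / 2 : ℝ) ≤ 2) hcont
      ⟨hl (1 / 2) (by norm_num) le_rfl, hg 2 le_rfl⟩
    have hr₁' : h (t, r₀ • u) = 1 := hr₁
    refine ⟨r₀, hr₀, fun r hr => ?_⟩
    have hm := hmono t ht u hu
    have hr₀' : r₀ ∈ Icc (1 / 2 : ℝ) 2 := Ioo_subset_Icc_self hr₀
    rcases le_or_gt r (1 / 2) with h1 | h1
    · have := hl r hr h1
      exact ⟨iff_of_true this (h1.trans_lt hr₀.1), iff_of_false this.ne (h1.trans_lt hr₀.1).ne⟩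
    rcases le_or_gt 2 r with h2 | h2
    · have := hg r h2
      exact ⟨iff_of_false this.not_gt (hr₀.2.trans_le h2).not_gt,
        iff_of_false this.ne' (hr₀.2.trans_le h2).ne'⟩
    have hrm : r ∈ Icc (1 / 2 : ℝ) 2 := ⟨h1.le, h2.le⟩
    constructor
    · rw [← hr₁']
      exact hm.lt_iff_lt hrm hr₀'
    · rw [← hr₁']
      exact hm.injOn.eq_iff hrm hr₀'
  classical
  -- The default value 1 keeps `G` positive everywhere, so that its logarithm can be taken without
  -- side conditions.
  set G : ℝ → Space N → ℝ := fun t u => if H : t ∈ I ∧ ‖u‖ = 1 then (hex t H.1 u H.2).choose else 1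
    with hG
  have hGspec : ∀ t ∈ I, ∀ u : Space N, ‖u‖ = 1 → G t u ∈ Ioo (1 / 2 : ℝ) 2 ∧
      ∀ r : ℝ, 0 < r → (h (t, r • u) < 1 ↔ r < G t u) ∧ (h (t, r • u) = 1 ↔ r = G t u) := by
    intro t ht u hu
    have : G t u = (hex t ht u hu).choose := by
      simp only [hG]
      rw [dif_pos (⟨ht, hu⟩ : t ∈ I ∧ ‖u‖ = 1)]
    rw [this]
    exact (hex t ht u hu).choose_spec
  have hGpos : ∀ t u, 0 < G t u := by
    intro t u
    by_cases H : t ∈ I ∧ ‖u‖ = 1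
    · linarith [(hGspec t H.1 u H.2).1.1]
    · simp only [hG]
      rw [dif_neg H]
      exact one_pos
  have hunit : ∀ x : Space N, x ≠ 0 → ‖‖x‖⁻¹ • x‖ = 1 := fun x hx => by
    rw [norm_smul, norm_inv, norm_norm, inv_mul_cancel₀ (norm_ne_zero_iff.2 hx)]
  refine ⟨fun t => radialExtension (G t), ?_, fun t x => hGpos _ _,
    fun t => isRadiallyConstant_radialExtension _, ?_⟩
  · rintro ⟨t₀, x₀⟩ ⟨ht₀, hx₀⟩
    refine ContDiffAt.contDiffWithinAt ?_
    have hx₀' : x₀ ≠ 0 := hx₀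
    set u₀ := ‖x₀‖⁻¹ • x₀ with hu₀
    have hu₀1 : ‖u₀‖ = 1 := hunit x₀ hx₀'
    set r₀ := G t₀ u₀ with hr₀
    obtain ⟨hr₀I, hr₀h⟩ := hGspec t₀ ht₀ u₀ hu₀1
    have hr₀pos : 0 < r₀ := hGpos _ _
    -- The crossing radius solves `f = 1` for the last variable, with nonzero radial derivative. The
    -- implicit function theorem yields a local C² solution, and uniqueness of the crossing
    -- identifies it with the radius chosen above.
    set f : (ℝ × Space N) × ℝ → ℝ := fun v => h (v.1.1, v.2 • ‖v.1.2‖⁻¹ • v.1.2) with hf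
    have hfc : ContDiffAt ℝ 2 f ((t₀, x₀), r₀) := by
      have h1 : ContDiffAt ℝ 2 (fun v : (ℝ × Space N) × ℝ =>
          (v.1.1, v.2 • ‖v.1.2‖⁻¹ • v.1.2)) ((t₀, x₀), r₀) := by
        have h2 : ContDiffAt ℝ 2 (fun v : (ℝ × Space N) × ℝ => v.1.2) ((t₀, x₀), r₀) :=
          contDiffAt_snd.comp _ contDiffAt_fst
        have h3 : ContDiffAt ℝ 2 (fun v : (ℝ × Space N) × ℝ => ‖v.1.2‖⁻¹) ((t₀, x₀), r₀) :=
          (h2.norm ℝ hx₀').inv (norm_ne_zero_iff.2 hx₀')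
        exact (contDiffAt_fst.comp _ contDiffAt_fst).prodMk (contDiffAt_snd.smul (h3.smul h2))
      exact (hcd t₀ ht₀ (r₀ • u₀)).comp ((t₀, x₀), r₀) h1
    have hf1 : f ((t₀, x₀), r₀) = 1 := ((hr₀h r₀ hr₀pos).2).2 rfl
    have hinr : fderiv ℝ f ((t₀, x₀), r₀) (0, 1) = fderiv ℝ h (t₀, r₀ • u₀) (0, u₀) := by
      have h1 : HasDerivAt (fun r : ℝ => ((t₀, x₀), r)) ((0 : ℝ × Space N), (1 : ℝ)) r₀ :=
        (hasDerivAt_const r₀ (t₀, x₀)).prodMk (hasDerivAt_id r₀)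
      have h2 := (hfc.differentiableAt two_ne_zero).hasFDerivAt.comp_hasDerivAt r₀ h1
      exact h2.unique (hderiv t₀ ht₀ u₀ r₀)
    have hne : fderiv ℝ f ((t₀, x₀), r₀) (0, 1) ≠ 0 := by
      rw [hinr]
      exact (hpos t₀ ht₀ u₀ hu₀1 r₀ (Ioo_subset_Icc_self hr₀I)).ne'
    have hinv : (fderiv ℝ f ((t₀, x₀), r₀) ∘L
        ContinuousLinearMap.inr ℝ (ℝ × Space N) ℝ).IsInvertible := by
      refine ⟨ContinuousLinearEquiv.unitsEquivAut ℝ (Units.mk0 _ hne), ?_⟩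
      ext
      simp
    have himp := hfc.contDiffAt_implicitFunction two_ne_zero hinv
    have hself := hfc.implicitFunction_apply_self two_ne_zero hinv
    have hev := hfc.eventually_apply_implicitFunction two_ne_zero hinv
    set φ := hfc.implicitFunction two_ne_zero hinv with hφ
    refine himp.congr_of_eventuallyEq ?_
    have hφpos : ∀ᶠ v in 𝓝 (t₀, x₀), 0 < φ v :=
      continuousAt_const.eventually_lt himp.continuousAt (by
        show (0 : ℝ) < φ (t₀, x₀)
        rw [show φ (t₀, x₀) = r₀ from hself]; exact hr₀pos)
    have hIev : ∀ᶠ q : ℝ × Space N in 𝓝 (t₀, x₀), q.1 ∈ I :=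
      continuousAt_fst.eventually (hI.mem_nhds ht₀)
    have hxev : ∀ᶠ q : ℝ × Space N in 𝓝 (t₀, x₀), q.2 ≠ 0 :=
      continuousAt_snd.eventually (isOpen_compl_singleton.mem_nhds hx₀)
    filter_upwards [hev, hφpos, hIev, hxev] with v hv hv0 hvI hvx
    rw [hf1] at hv
    exact (((hGspec v.1 hvI _ (hunit v.2 hvx)).2 (φ v) hv0).2.1 hv).symm
  · intro t ht x hx
    have hx0 : 0 < ‖x‖ := norm_pos_iff.2 hx
    have h1 := (hGspec t ht _ (hunit x hx)).2 ‖x‖ hx0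
    rw [smul_smul, mul_inv_cancel₀ hx0.ne', one_smul] at h1
    exact h1

end Isotopy

/-! ### Moved spheres as radial graphs -/

section Isotopy

open scoped Topology

variable {N : ℕ}

/-- For small times the image of the unit sphere under a `C²` isotopy is the radial graph of
`exp (s t)`, with `s` of class `C²` and `∂ₜ s` the normal velocity at time `0`. -/
theorem exists_radialGraph {δ : ℝ} (hδ : 0 < δ) {ψ η : ℝ → Space N → Space N}
    (hψ : ContDiffOn ℝ 2 (fun q : ℝ × Space N => ψ q.1 q.2) (Ioo (-δ) δ ×ˢ univ))
    (hη : ∀ t ∈ Ioo (-δ) δ, ContDiff ℝ 2 (η t))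
    (hl : ∀ t ∈ Ioo (-δ) δ, Function.LeftInverse (η t) (ψ t))
    (hr : ∀ t ∈ Ioo (-δ) δ, Function.RightInverse (η t) (ψ t))
    (h0 : ∀ x, ψ 0 x = x) :
    ∃ ε > 0, ∃ s : ℝ → Space N → ℝ, ε ≤ δ ∧
      ContDiffOn ℝ 2 (fun q : ℝ × Space N => s q.1 q.2) (Ioo (-ε) ε ×ˢ {0}ᶜ) ∧
      (∀ t, IsRadiallyConstant (s t)) ∧
      (∀ t ∈ Ioo (-ε) ε, ψ t '' sphere 0 1 = {x | starGauge (s t) x = 1}) ∧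
      (∀ t ∈ Ioo (-ε) ε, ψ t '' ball 0 1 = {x | starGauge (s t) x < 1}) ∧
      (∀ x ≠ 0, s 0 x = 0) ∧
      ∀ p ∈ sphere (0 : Space N) 1,
        deriv (fun t => s t p) 0 = ⟪deriv (fun t => ψ t p) 0, p⟫ := by
  have hδ0 : (0 : ℝ) ∈ Ioo (-δ) δ := ⟨by linarith, hδ⟩
  have hη0 : ∀ x, η 0 x = x := fun x => by
    conv_lhs => rw [← h0 x]
    exact hl 0 hδ0 x
  have hηc : ContDiffOn ℝ 2 (fun q : ℝ × Space N => η q.1 q.2) (Ioo (-δ) δ ×ˢ univ) :=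
    fun q hq => (contDiffAt_inverse_family isOpen_Ioo hψ hη hl hr hq.1 q.2).contDiffWithinAt
  -- The images of the ball and the sphere are `{h < 1}` and `{h = 1}`. At time 0 this is `‖y‖²`,
  -- with radial derivative `2 ‖y‖²`; the strict inequalities needed for a single crossing persist
  -- for small times on compact sets.
  set h : ℝ × Space N → ℝ := fun q => ‖η q.1 q.2‖ ^ 2 with hh
  have hhc : ContDiffOn ℝ 2 h (Ioo (-δ) δ ×ˢ univ) := hηc.norm_sq ℝ
  have hopen : IsOpen (Ioo (-δ) δ ×ˢ (univ : Set (Space N))) := isOpen_Ioo.prod isOpen_univ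
  have hnhds : ∀ y : Space N, Ioo (-δ) δ ×ˢ (univ : Set (Space N)) ∈ 𝓝 ((0 : ℝ), y) :=
    fun y => hopen.mem_nhds ⟨hδ0, mem_univ _⟩
  have e1 : ∀ᶠ t in 𝓝 (0 : ℝ), ∀ y ∈ closedBall (0 : Space N) (1 / 2), h (t, y) < 1 := by
    refine (isCompact_closedBall _ _).eventually_forall_of_forall_eventually fun y hy => ?_
    refine (hhc.continuousOn.continuousAt (hnhds y)).eventually_lt continuousAt_const ?_
    rw [mem_closedBall_zero_iff] at hy
    simp only [hh, hη0]
    nlinarith [norm_nonneg y]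
  -- The region `‖y‖ ≥ 2` is not compact, so `h > 1` there is obtained indirectly: the image of the
  -- closed unit ball stays inside radius 2.
  have e2 : ∀ᶠ t in 𝓝 (0 : ℝ), ∀ x ∈ closedBall (0 : Space N) 1, ‖ψ t x‖ < 2 := by
    refine (isCompact_closedBall _ _).eventually_forall_of_forall_eventually fun y hy => ?_
    refine (hψ.continuousOn.continuousAt (hnhds y)).norm.eventually_lt continuousAt_const ?_
    rw [mem_closedBall_zero_iff] at hy
    simp only [h0]
    linarith
  have e3 : ∀ᶠ t in 𝓝 (0 : ℝ), ∀ y ∈ closedBall (0 : Space N) 2 \ ball 0 (1 / 2),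
      0 < fderiv ℝ h (t, y) (0, y) := by
    refine ((isCompact_closedBall _ _).diff
      isOpen_ball).eventually_forall_of_forall_eventually fun y hy => ?_
    have h1 : ContinuousAt (fun q : ℝ × Space N => fderiv ℝ h q (0, q.2)) (0, y) :=
      ((hhc.continuousOn_fderiv_of_isOpen hopen one_le_two).continuousAt (hnhds y)).clm_apply
        (by fun_prop)
    refine continuousAt_const.eventually_lt h1 ?_
    have h2 : HasDerivAt (fun r : ℝ => ((0 : ℝ), r • y)) ((0 : ℝ), y) 1 := by
      refine (hasDerivAt_const _ _).prodMk ?_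
      simpa using (hasDerivAt_id (1 : ℝ)).smul_const y
    have h3 : HasFDerivAt h (fderiv ℝ h (0, y)) ((0 : ℝ), (1 : ℝ) • y) := by
      rw [one_smul]
      exact ((hhc.contDiffAt (hnhds y)).differentiableAt two_ne_zero).hasFDerivAt
    have h4 := h3.comp_hasDerivAt (1 : ℝ) h2
    have h5 : HasDerivAt (h ∘ fun r : ℝ => ((0 : ℝ), r • y)) (2 * ‖y‖ ^ 2) 1 := by
      have h6 : (h ∘ fun r : ℝ => ((0 : ℝ), r • y)) = fun r => r ^ 2 * ‖y‖ ^ 2 := by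
        funext r
        simp [hh, hη0, norm_smul, mul_pow]
      rw [h6]
      simpa using (hasDerivAt_pow 2 (1 : ℝ)).mul_const (‖y‖ ^ 2)
    rw [h4.unique h5]
    have : 1 / 2 ≤ ‖y‖ := by
      have := hy.2
      rwa [mem_ball_zero_iff, not_lt] at this
    positivity
  obtain ⟨ε₀, hε₀, hε⟩ := Metric.eventually_nhds_iff.1 (e1.and (e2.and e3))
  set ε := min ε₀ δ with hεdef
  have hεpos : 0 < ε := lt_min hε₀ hδ
  have hεδ : ε ≤ δ := min_le_right _ _
  have hsub : Ioo (-ε) ε ⊆ Ioo (-δ) δ := Ioo_subset_Ioo (by linarith) hεδ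
  have hall : ∀ t ∈ Ioo (-ε) ε, _ := fun t ht => hε (y := t) (by
    rw [Real.dist_eq, sub_zero, abs_lt]
    exact ⟨by linarith [ht.1, min_le_left ε₀ δ], ht.2.trans_le (min_le_left _ _)⟩)
  have hε0 : (0 : ℝ) ∈ Ioo (-ε) ε := ⟨by linarith, hεpos⟩
  obtain ⟨g, hgc, hgpos, hgr, hgh⟩ := exists_contDiff_crossing_radius isOpen_Ioo
    (hhc.mono (prod_mono hsub subset_rfl))
    (fun t ht y hy => (hall t ht).1 y (mem_closedBall_zero_iff.2 hy))
    (fun t ht y hy => by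
      by_contra hcon
      have h1 : ‖η t y‖ ≤ 1 := by
        have : ‖η t y‖ ^ 2 ≤ 1 := not_lt.1 hcon
        exact (sq_le_one_iff₀ (norm_nonneg _)).1 this
      have h2 := (hall t ht).2.1 (η t y) (mem_closedBall_zero_iff.2 h1)
      rw [hr t (hsub ht)] at h2
      linarith)
    (fun t ht y hy hy' => (hall t ht).2.2 y ⟨mem_closedBall_zero_iff.2 hy', by
      rw [mem_ball_zero_iff]; exact not_lt.2 hy⟩)
  have hgauge : ∀ t x, starGauge (fun x => Real.log (g t x)) x = ‖x‖ / g t x := fun t x => by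
    rw [starGauge, Real.exp_neg, Real.exp_log (hgpos t x), div_eq_mul_inv]
  have himg : ∀ t ∈ Ioo (-ε) ε, ∀ S : Set (Space N), ψ t '' S = η t ⁻¹' S := fun t ht S =>
    congrFun (Set.image_eq_preimage_of_inverse (hl t (hsub ht)) (hr t (hsub ht))) S
  have hsphere : ∀ t ∈ Ioo (-ε) ε, ψ t '' sphere 0 1 =
      {x | starGauge (fun x => Real.log (g t x)) x = 1} := by
    intro t ht
    rw [himg t ht]
    ext x
    rw [mem_preimage, mem_sphere_zero_iff_norm, mem_ofPred_eq, hgauge, div_eq_one_iff_eq (hgpos t x).ne']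
    have h1 : ‖η t x‖ = 1 ↔ h (t, x) = 1 := (pow_eq_one_iff_of_nonneg (norm_nonneg _) two_ne_zero).symm
    rw [h1]
    by_cases hx : x = 0
    · have h2 := (hall t ht).1 0 (by simp)
      rw [hx, norm_zero]
      exact iff_of_false h2.ne (hgpos t 0).ne
    · exact (hgh t ht x hx).2
  have hball : ∀ t ∈ Ioo (-ε) ε, ψ t '' ball 0 1 =
      {x | starGauge (fun x => Real.log (g t x)) x < 1} := by
    intro t ht
    rw [himg t ht]
    ext x
    rw [mem_preimage, mem_ball_zero_iff, mem_ofPred_eq, hgauge, div_lt_one (hgpos t x)]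
    have h1 : ‖η t x‖ < 1 ↔ h (t, x) < 1 := (sq_lt_one_iff₀ (norm_nonneg _)).symm
    rw [h1]
    by_cases hx : x = 0
    · have h2 := (hall t ht).1 0 (by simp)
      rw [hx, norm_zero]
      exact iff_of_true h2 (hgpos t 0)
    · exact (hgh t ht x hx).1
  have hsc : ContDiffOn ℝ 2 (fun q : ℝ × Space N => Real.log (g q.1 q.2))
      (Ioo (-ε) ε ×ˢ {0}ᶜ) := hgc.log fun q _ => (hgpos _ _).ne'
  have hs0 : ∀ x ≠ 0, Real.log (g 0 x) = 0 := by
    intro x hx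
    have hx0 : 0 < ‖x‖ := norm_pos_iff.2 hx
    have h1 : h (0, ‖x‖⁻¹ • x) = 1 := by
      simp [hh, hη0, norm_smul, hx0.ne']
    have h2 := (hgh 0 hε0 (‖x‖⁻¹ • x) (smul_ne_zero (inv_pos.2 hx0).ne' hx)).2.1 h1
    rw [hgr 0 _ (inv_pos.2 hx0), norm_smul, norm_inv, norm_norm, inv_mul_cancel₀ hx0.ne'] at h2
    rw [← h2, Real.log_one]
  refine ⟨ε, hεpos, fun t x => Real.log (g t x), hεδ, hsc, fun t r hr x => congrArg Real.log (hgr t r hr x),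
    hsphere, hball, hs0, fun p hp => ?_⟩
  have hp0 : p ≠ 0 := ne_zero_of_mem_unit_sphere ⟨p, hp⟩
  have hopen' : IsOpen (Ioo (-ε) ε ×ˢ ({0}ᶜ : Set (Space N))) :=
    isOpen_Ioo.prod isOpen_compl_singleton
  set L := fderiv ℝ (fun q : ℝ × Space N => Real.log (g q.1 q.2)) (0, p) with hL
  have hLd : HasFDerivAt (fun q : ℝ × Space N => Real.log (g q.1 q.2)) L (0, p) :=
    ((hsc.contDiffAt (hopen'.mem_nhds (mk_mem_prod hε0 hp0))).differentiableAt two_ne_zero).hasFDerivAt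
  have hLx : ∀ v, L (0, v) = 0 := by
    intro v
    have h1 : HasFDerivAt (fun x : Space N => Real.log (g 0 x))
        (L.comp (ContinuousLinearMap.inr ℝ ℝ (Space N))) p :=
      hLd.comp p (hasFDerivAt_prodMk_right 0 p)
    have h2 : HasFDerivAt (fun x : Space N => Real.log (g 0 x)) (0 : Space N →L[ℝ] ℝ) p := by
      refine (hasFDerivAt_const (0 : ℝ) p).congr_of_eventuallyEq ?_
      filter_upwards [isOpen_compl_singleton.mem_nhds (show p ∈ ({0}ᶜ : Set (Space N)) from hp0)]
        with x hx
      exact hs0 x hx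
    have h3 := congrArg (fun M => M v) (h1.unique h2)
    simpa using h3
  have hLt : HasDerivAt (fun t => Real.log (g t p)) (L (1, 0)) 0 := by
    have h1 : HasDerivAt (fun t : ℝ => (t, p)) ((1 : ℝ), (0 : Space N)) 0 :=
      (hasDerivAt_id (0 : ℝ)).prodMk (hasDerivAt_const _ _)
    exact hLd.comp_hasDerivAt (0 : ℝ) h1
  have hψd : HasDerivAt (fun t => ψ t p) (deriv (fun t => ψ t p) 0) 0 := by
    have h1 : HasDerivAt (fun t : ℝ => (t, p)) ((1 : ℝ), (0 : Space N)) 0 :=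
      (hasDerivAt_id (0 : ℝ)).prodMk (hasDerivAt_const _ _)
    have h2 : HasFDerivAt (fun q : ℝ × Space N => ψ q.1 q.2)
      (fderiv ℝ (fun q : ℝ × Space N => ψ q.1 q.2) (0, p)) (0, p) :=
      ((hψ.contDiffAt (hnhds p)).differentiableAt two_ne_zero).hasFDerivAt
    exact (h2.comp_hasDerivAt (0 : ℝ) h1).differentiableAt.hasDerivAt
  set w := deriv (fun t => ψ t p) 0 with hw
  rw [hLt.deriv]
  -- The velocity of the graph comes from differentiating at 0 the identity `‖ψ t p‖² = exp (2 s t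
  -- (ψ t p))`. Since `s 0` vanishes off the origin, the motion of the base point contributes
  -- nothing.
  have hA : HasDerivAt (fun t => ‖ψ t p‖ ^ 2) (2 * ⟪p, w⟫) 0 := by
    simpa [h0] using hψd.norm_sq
  have hB : HasDerivAt (fun t => Real.exp (2 * Real.log (g t (ψ t p)))) (2 * L (1, w)) 0 := by
    have h1 : HasDerivAt (fun t : ℝ => (t, ψ t p)) ((1 : ℝ), w) 0 :=
      (hasDerivAt_id (0 : ℝ)).prodMk hψd
    have h2 : HasFDerivAt (fun q : ℝ × Space N => Real.log (g q.1 q.2)) L (0, ψ 0 p) := by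
      rw [h0]; exact hLd
    have h3 := ((h2.comp_hasDerivAt (0 : ℝ) h1).const_mul 2).exp
    simpa [h0, hs0 p hp0] using h3
  have hAB : (fun t => ‖ψ t p‖ ^ 2) =ᶠ[𝓝 0] fun t => Real.exp (2 * Real.log (g t (ψ t p))) := by
    filter_upwards [Ioo_mem_nhds hε0.1 hε0.2] with t ht
    have h1 : ψ t p ∈ {x | starGauge (fun x => Real.log (g t x)) x = 1} :=
      hsphere t ht ▸ mem_image_of_mem _ hp
    rw [mem_ofPred_eq, hgauge, div_eq_one_iff_eq (hgpos t _).ne'] at h1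
    rw [two_mul, Real.exp_add, Real.exp_log (hgpos t _), h1, pow_two]
  have h5 := hA.unique (hB.congr_of_eventuallyEq hAB)
  have h6 : L (1, w) = L (1, 0) := by
    have : ((1 : ℝ), w) = (1, 0) + (0, w) := by simp
    rw [this, map_add, hLx, add_zero]
  rw [h6, real_inner_comm] at h5
  linarith

end Isotopy

/-! ### Differentiation under the integral sign -/

section ParametricIntegrals

open scoped Topology

variable {X : Type*} [TopologicalSpace X]

lemma continuous_slice {I : Set ℝ} {F : ℝ → X → ℝ}
    (hF : ContinuousOn (fun q : ℝ × X => F q.1 q.2) (I ×ˢ univ)) {t : ℝ} (ht : t ∈ I) :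
    Continuous (F t) :=
  hF.comp_continuous (f := fun x : X => (t, x)) (by fun_prop) fun x => ⟨ht, mem_univ _⟩

variable [CompactSpace X]

lemma exists_nhds_bound {I : Set ℝ} (hI : IsOpen I) {F : ℝ → X → ℝ}
    (hF : ContinuousOn (fun q : ℝ × X => F q.1 q.2) (I ×ˢ univ)) {t₀ : ℝ} (ht₀ : t₀ ∈ I) :
    ∃ r > 0, ball t₀ r ⊆ I ∧ ∃ C, ∀ t ∈ ball t₀ r, ∀ x, ‖F t x‖ ≤ C := by
  obtain ⟨r, hr, hrI⟩ := Metric.nhds_basis_closedBall.mem_iff.1 (hI.mem_nhds ht₀)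
  obtain ⟨C, hC⟩ := ((isCompact_closedBall t₀ r).prod (isCompact_univ (X := X))
    ).exists_bound_of_continuousOn (hF.mono (prod_mono hrI subset_rfl))
  exact ⟨r, hr, ball_subset_closedBall.trans hrI, C, fun t ht x =>
    hC (t, x) ⟨ball_subset_closedBall ht, mem_univ _⟩⟩

variable [T2Space X] [MeasurableSpace X] [BorelSpace X] {μ : Measure X} [IsFiniteMeasure μ]

lemma integrable_of_continuous {f : X → ℝ} (hf : Continuous f) : Integrable f μ := by
  rw [← integrableOn_univ]
  exact hf.continuousOn.integrableOn_compact isCompact_univ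

/-- Differentiation under the integral sign over a compact space. -/
lemma hasDerivAt_integral_of_continuousOn {I : Set ℝ} (hI : IsOpen I) {F F' : ℝ → X → ℝ}
    (hF : ContinuousOn (fun q : ℝ × X => F q.1 q.2) (I ×ˢ univ))
    (hF' : ContinuousOn (fun q : ℝ × X => F' q.1 q.2) (I ×ˢ univ))
    (hd : ∀ t ∈ I, ∀ x, HasDerivAt (fun t => F t x) (F' t x) t) {t₀ : ℝ} (ht₀ : t₀ ∈ I) :
    HasDerivAt (fun t => ∫ x, F t x ∂μ) (∫ x, F' t₀ x ∂μ) t₀ := by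
  obtain ⟨r, hr, hrI, C, hC⟩ := exists_nhds_bound hI hF' ht₀
  refine (hasDerivAt_integral_of_dominated_loc_of_deriv_le (bound := fun _ => C)
    (ball_mem_nhds t₀ hr) ?_ (integrable_of_continuous (continuous_slice hF ht₀))
    (continuous_slice hF' ht₀).aestronglyMeasurable
    (Filter.Eventually.of_forall fun x t ht => hC t ht x) (integrable_const C)
    (Filter.Eventually.of_forall fun x t ht => hd t (hrI ht) x)).2
  filter_upwards [hI.mem_nhds ht₀] with t ht
  exact (continuous_slice hF ht).aestronglyMeasurable

/-- Differentiability at a common zero `t₀` of the first factor of the integral of a product,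
the second factor being merely continuous. -/
lemma hasDerivAt_integral_mul_of_vanishing {I : Set ℝ} (hI : IsOpen I) {k k' c : ℝ → X → ℝ}
    (hk : ContinuousOn (fun q : ℝ × X => k q.1 q.2) (I ×ˢ univ))
    (hk' : ContinuousOn (fun q : ℝ × X => k' q.1 q.2) (I ×ˢ univ))
    (hc : ContinuousOn (fun q : ℝ × X => c q.1 q.2) (I ×ˢ univ))
    (hd : ∀ t ∈ I, ∀ x, HasDerivAt (fun t => k t x) (k' t x) t) {t₀ : ℝ} (ht₀ : t₀ ∈ I)
    (hk0 : ∀ x, k t₀ x = 0) :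
    HasDerivAt (fun t => ∫ x, k t x * c t x ∂μ) (∫ x, k' t₀ x * c t₀ x ∂μ) t₀ := by
  obtain ⟨r, hr, hrI, C, hC⟩ := exists_nhds_bound hI hk' ht₀
  obtain ⟨r', hr', hrI', C', hC'⟩ := exists_nhds_bound hI hc ht₀
  set ρ := min r r' with hρ
  have hρ0 : 0 < ρ := lt_min hr hr'
  have hb : ball t₀ ρ ⊆ ball t₀ r := ball_subset_ball (min_le_left _ _)
  have hb' : ball t₀ ρ ⊆ ball t₀ r' := ball_subset_ball (min_le_right _ _)
  have hkc : ContinuousOn (fun q : ℝ × X => (fun t x => k t x * c t x) q.1 q.2) (I ×ˢ univ) :=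
    hk.mul hc
  have hkc' : ContinuousOn (fun q : ℝ × X => (fun t x => k' t x * c t x) q.1 q.2) (I ×ˢ univ) :=
    hk'.mul hc
  have hct : ∀ x, ContinuousAt (fun t => c t x) t₀ := fun x =>
    (hc.comp (f := fun t : ℝ => (t, x)) (by fun_prop)
      (fun t ht => mk_mem_prod ht (mem_univ x))).continuousAt (hI.mem_nhds ht₀)
  -- Because `k` vanishes at `t₀`, the difference quotient of the product is that of `k` times `c t
  -- x`, and continuity of `c` suffices. The bound on `k` below makes these quotients uniformly
  -- bounded.
  have hprod : ∀ x, HasDerivAt (fun t => k t x * c t x) (k' t₀ x * c t₀ x) t₀ := by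
    intro x
    have h1 := (hd t₀ ht₀ x)
    rw [hasDerivAt_iff_tendsto_slope] at h1 ⊢
    refine (h1.mul ((hct x).tendsto.mono_left nhdsWithin_le_nhds)).congr fun t => ?_
    simp only [slope, hk0, vsub_eq_sub, smul_eq_mul, zero_mul, sub_zero]
    ring
  have hkb : ∀ x, ∀ t ∈ ball t₀ ρ, ‖k t x - k t₀ x‖ ≤ C * ‖t - t₀‖ := fun x t ht =>
    (convex_ball t₀ ρ).norm_image_sub_le_of_norm_hasDerivWithin_le
      (fun s hs => (hd s (hrI (hb hs)) x).hasDerivWithinAt) (fun s hs => hC s (hb hs) x)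
      (mem_ball_self hρ0) ht
  have key := hasFDerivAt_integral_of_dominated_loc_of_lip' (μ := μ) (𝕜 := ℝ)
    (F := fun t x => k t x * c t x) (x₀ := t₀) (bound := fun _ => C * C')
    (F' := fun x => ContinuousLinearMap.toSpanSingleton ℝ (k' t₀ x * c t₀ x))
    (ball_mem_nhds t₀ hρ0)
    (fun t ht => (continuous_slice (F := fun t x => k t x * c t x) hkc (hrI (hb ht))).aestronglyMeasurable)
    (integrable_of_continuous (continuous_slice
      (F := fun t x => k t x * c t x) hkc ht₀)) ?_
    (Filter.Eventually.of_forall fun x t ht => ?_) (integrable_const _)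
    (Filter.Eventually.of_forall fun x => (hprod x).hasFDerivAt)
  · have h1 := key.2.hasDerivAt
    rw [ContinuousLinearMap.integral_apply key.1] at h1
    simpa using h1
  · have h1 : (fun x => ContinuousLinearMap.toSpanSingleton ℝ (k' t₀ x * c t₀ x)) =
        fun x => (k' t₀ x * c t₀ x) • (1 : ℝ →L[ℝ] ℝ) := by
      funext x
      ext
      simp
    rw [h1]
    exact (continuous_slice (F := fun t x => k' t x * c t x) hkc' ht₀).aestronglyMeasurable.smul_const _
  · have h1 := hkb x t ht
    rw [hk0, sub_zero] at h1
    rw [hk0, zero_mul, sub_zero, norm_mul, mul_right_comm]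
    exact mul_le_mul h1 (hC' t (hb' ht) x) (norm_nonneg _) ((norm_nonneg _).trans h1)

end ParametricIntegrals

/-! ### First and second variation of area at the unit sphere -/

section SecondVariation

open scoped Topology

variable {N : ℕ}

lemma norm_sq_eq_sum_apply_single (L : Space N →L[ℝ] ℝ) :
    ‖L‖ ^ 2 = ∑ i, L (EuclideanSpace.single i 1) ^ 2 := by
  set g := (InnerProductSpace.toDual ℝ (Space N)).symm L with hg
  have h4 : ‖g‖ = ‖L‖ := by rw [hg, LinearIsometryEquiv.norm_map]
  have hgx : ∀ x, ⟪g, x⟫ = L x := fun x => by rw [hg, InnerProductSpace.toDual_symm_apply]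
  rw [← h4, EuclideanSpace.real_norm_sq_eq]
  refine Finset.sum_congr rfl fun i _ => ?_
  rw [← hgx, EuclideanSpace.inner_single_right]
  simp

variable {ε : ℝ} {s : ℝ → Space N → ℝ}

/-- First and second variation, at the unit sphere, of the area of radial graphs `exp s`
enclosing a fixed volume. -/
theorem radialGraph_variation (hε : 0 < ε)
    (hs : ContDiffOn ℝ 2 (fun q : ℝ × Space N => s q.1 q.2) (Ioo (-ε) ε ×ˢ {0}ᶜ))
    (hs0 : ∀ x ≠ 0, s 0 x = 0) {a : ℝ}
    (hV : ∀ t ∈ Ioo (-ε) ε, ∫ p : sphere (0 : Space N) 1,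
      Real.exp ((a + 1) * s t p) ∂(sphereMeasure N) = ∫ p : sphere (0 : Space N) 1,
      Real.exp ((a + 1) * s 0 p) ∂(sphereMeasure N)) (ha : a + 1 ≠ 0) :
    ContDiffOn ℝ 1 (fun x => deriv (fun t => s t x) 0) {0}ᶜ ∧
    ∫ p : sphere (0 : Space N) 1, deriv (fun t => s t p) 0 ∂(sphereMeasure N) = 0 ∧
    (∀ t ∈ Ioo (-ε) ε, DifferentiableAt ℝ (fun t => ∫ p : sphere (0 : Space N) 1,
      Real.exp (a * s t p) * √(1 + ‖fderiv ℝ (s t) p‖ ^ 2) ∂(sphereMeasure N)) t) ∧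
    deriv (fun t => ∫ p : sphere (0 : Space N) 1,
      Real.exp (a * s t p) * √(1 + ‖fderiv ℝ (s t) p‖ ^ 2) ∂(sphereMeasure N)) 0 = 0 ∧
    HasDerivAt (deriv (fun t => ∫ p : sphere (0 : Space N) 1,
      Real.exp (a * s t p) * √(1 + ‖fderiv ℝ (s t) p‖ ^ 2) ∂(sphereMeasure N)))
      (∫ p : sphere (0 : Space N) 1, (‖fderiv ℝ (fun x => deriv (fun t => s t x) 0) p‖ ^ 2 -
        a * deriv (fun t => s t p) 0 ^ 2) ∂(sphereMeasure N)) 0 := by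
  set S : ℝ × Space N → ℝ := fun q => s q.1 q.2 with hS
  set I := Ioo (-ε) ε with hI
  have hIo : IsOpen I := isOpen_Ioo
  have h0I : (0 : ℝ) ∈ I := ⟨by linarith, hε⟩
  set V := I ×ˢ ({0}ᶜ : Set (Space N)) with hVdef
  have hVo : IsOpen V := hIo.prod isOpen_compl_singleton
  have hmem : ∀ {t : ℝ} {x : Space N}, t ∈ I → x ≠ 0 → (t, x) ∈ V := fun ht hx => ⟨ht, hx⟩
  have hp0 : ∀ p : sphere (0 : Space N) 1, (p : Space N) ≠ 0 := ne_zero_of_mem_unit_sphere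
  have hScont : ContinuousOn S V := hs.continuousOn
  have hS1 : ContDiffOn ℝ 1 (fderiv ℝ S) V := hs.fderiv_of_isOpen hVo (by norm_num)
  have hS2c : ContinuousOn (fderiv ℝ (fderiv ℝ S)) V := hS1.continuousOn_fderiv_of_isOpen hVo le_rfl
  have hSd : ∀ {t : ℝ} {x : Space N}, t ∈ I → x ≠ 0 → HasFDerivAt S (fderiv ℝ S (t, x)) (t, x) :=
    fun ht hx => ((hs.contDiffAt (hVo.mem_nhds (hmem ht hx))).differentiableAt
      two_ne_zero).hasFDerivAt
  have hDSd : ∀ {t : ℝ} {x : Space N}, t ∈ I → x ≠ 0 →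
      HasFDerivAt (fderiv ℝ S) (fderiv ℝ (fderiv ℝ S) (t, x)) (t, x) :=
    fun ht hx => ((hS1.contDiffAt (hVo.mem_nhds (hmem ht hx))).differentiableAt
      one_ne_zero).hasFDerivAt
  have hcurve : ∀ (t : ℝ) (x : Space N),
      HasDerivAt (fun t : ℝ => (t, x)) ((1 : ℝ), (0 : Space N)) t :=
    fun t x => (hasDerivAt_id t).prodMk (hasDerivAt_const _ _)
  -- time derivative, space derivatives and mixed derivatives
  set σ : ℝ → Space N → ℝ := fun t x => fderiv ℝ S (t, x) (1, 0) with hσ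
  set D : Fin N → ℝ → Space N → ℝ :=
    fun i t x => fderiv ℝ S (t, x) (0, EuclideanSpace.single i 1) with hD
  set D' : Fin N → ℝ → Space N → ℝ :=
    fun i t x => fderiv ℝ (fderiv ℝ S) (t, x) (1, 0) (0, EuclideanSpace.single i 1) with hD'
  have hst : ∀ {t : ℝ} {x : Space N}, t ∈ I → x ≠ 0 →
      HasDerivAt (fun t => s t x) (σ t x) t := by
    intro t x ht hx
    exact (hSd ht hx).comp_hasDerivAt t (hcurve t x)
  have hDt : ∀ {t : ℝ} {x : Space N}, t ∈ I → x ≠ 0 → ∀ i,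
      HasDerivAt (fun t => D i t x) (D' i t x) t := by
    intro t x ht hx i
    have h1 : HasDerivAt (fun t => fderiv ℝ S (t, x))
        (fderiv ℝ (fderiv ℝ S) (t, x) (1, 0)) t :=
      (hDSd ht hx).comp_hasDerivAt t (hcurve t x)
    have h2 := h1.clm_apply (hasDerivAt_const t ((0 : ℝ), EuclideanSpace.single i (1 : ℝ)))
    simpa using h2
  have hsx : ∀ {t : ℝ} {x : Space N}, t ∈ I → x ≠ 0 →
      HasFDerivAt (s t) ((fderiv ℝ S (t, x)).comp (ContinuousLinearMap.inr ℝ ℝ (Space N))) x :=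
    fun {t x} ht hx => (hSd ht hx).comp x (hasFDerivAt_prodMk_right t x)
  have hnorm : ∀ {t : ℝ} {x : Space N}, t ∈ I → x ≠ 0 →
      ‖fderiv ℝ (s t) x‖ ^ 2 = ∑ i, D i t x ^ 2 := fun ht hx => by
    rw [(hsx ht hx).fderiv, norm_sq_eq_sum_apply_single]
    rfl
  have hderiv0 : ∀ x ≠ 0, deriv (fun t => s t x) 0 = σ 0 x := fun x hx => (hst h0I hx).deriv
  have hσ1 : ContDiffOn ℝ 1 (fun x => σ 0 x) {0}ᶜ := by
    have h1 : ContDiffOn ℝ 1 (fun x : Space N => fderiv ℝ S (0, x)) {0}ᶜ :=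
      hS1.comp (f := fun x : Space N => ((0 : ℝ), x)) (by fun_prop) fun x hx => ⟨h0I, hx⟩
    exact h1.clm_apply contDiffOn_const
  have hu1 : ContDiffOn ℝ 1 (fun x => deriv (fun t => s t x) 0) {0}ᶜ :=
    hσ1.congr fun x hx => hderiv0 x hx
  have hux : ∀ {x : Space N}, x ≠ 0 →
      ‖fderiv ℝ (fun x => deriv (fun t => s t x) 0) x‖ ^ 2 = ∑ i, D' i 0 x ^ 2 := by
    intro x hx
    have h1 : HasFDerivAt (fun x => deriv (fun t => s t x) 0)
        (((fderiv ℝ (fderiv ℝ S) (0, x)).flip (1, 0)).comp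
          (ContinuousLinearMap.inr ℝ ℝ (Space N))) x := by
      have h2 : HasFDerivAt (fun x => σ 0 x) (((fderiv ℝ (fderiv ℝ S) (0, x)).flip (1, 0)).comp
          (ContinuousLinearMap.inr ℝ ℝ (Space N))) x := by
        have h3 := ((hDSd h0I hx).comp x (hasFDerivAt_prodMk_right 0 x)).clm_apply
          (hasFDerivAt_const ((1 : ℝ), (0 : Space N)) x)
        refine h3.congr_fderiv ?_
        ext v
        simp
      refine h2.congr_of_eventuallyEq ?_
      filter_upwards [isOpen_compl_singleton.mem_nhds (show x ∈ ({0}ᶜ : Set (Space N)) from hx)]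
        with y hy
      exact hderiv0 y hy
    -- Symmetry of second derivatives turns the gradient of the initial velocity into the time
    -- derivative of `∇s`.
    have hsymm : IsSymmSndFDerivAt ℝ S (0, x) :=
      (hs.contDiffAt (hVo.mem_nhds (hmem h0I hx))).isSymmSndFDerivAt (by simp)
    rw [h1.fderiv, norm_sq_eq_sum_apply_single]
    refine Finset.sum_congr rfl fun i _ => ?_
    simp only [ContinuousLinearMap.comp_apply, ContinuousLinearMap.flip_apply, hD',
      ContinuousLinearMap.inr_apply]
    rw [hsymm.eq]
  -- joint continuity on `I × sphere`
  have hcomp : ∀ {f : ℝ × Space N → ℝ}, ContinuousOn f V →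
      ContinuousOn (fun q : ℝ × sphere (0 : Space N) 1 => f (q.1, q.2)) (I ×ˢ univ) := fun hf =>
    hf.comp (f := fun q : ℝ × sphere (0 : Space N) 1 => (q.1, (q.2 : Space N))) (by fun_prop)
      fun q hq => ⟨hq.1, hp0 q.2⟩
  have hsC : ContinuousOn (fun q : ℝ × sphere (0 : Space N) 1 => s q.1 q.2) (I ×ˢ univ) :=
    hcomp hScont
  have hσC : ContinuousOn (fun q : ℝ × sphere (0 : Space N) 1 => σ q.1 q.2) (I ×ˢ univ) :=
    hcomp (f := fun q => fderiv ℝ S q (1, 0)) (hS1.continuousOn.clm_apply continuousOn_const)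
  have hDC : ∀ i, ContinuousOn (fun q : ℝ × sphere (0 : Space N) 1 => D i q.1 q.2) (I ×ˢ univ) :=
    fun i => hcomp (f := fun q => fderiv ℝ S q (0, EuclideanSpace.single i 1))
      (hS1.continuousOn.clm_apply continuousOn_const)
  have hD'C : ∀ i, ContinuousOn (fun q : ℝ × sphere (0 : Space N) 1 => D' i q.1 q.2)
      (I ×ˢ univ) :=
    fun i => hcomp (f := fun q => fderiv ℝ (fderiv ℝ S) q (1, 0) (0, EuclideanSpace.single i 1))
      ((hS2c.clm_apply continuousOn_const).clm_apply continuousOn_const)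
  set W : ℝ → Space N → ℝ := fun t x => 1 + ∑ i, D i t x ^ 2 with hW
  have hWpos : ∀ t x, 0 < W t x := fun t x => by
    have : 0 ≤ ∑ i, D i t x ^ 2 := Finset.sum_nonneg fun i _ => sq_nonneg _
    simp only [hW]; linarith
  have hWC : ContinuousOn (fun q : ℝ × sphere (0 : Space N) 1 => √(W q.1 q.2)) (I ×ˢ univ) := by
    exact (continuousOn_const.add (continuousOn_finsetSum _ fun i _ => (hDC i).pow 2)).sqrt
  have hWt : ∀ {t : ℝ} {x : Space N}, t ∈ I → x ≠ 0 →
      HasDerivAt (fun t => √(W t x)) ((∑ i, D i t x * D' i t x) / √(W t x)) t := by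
    intro t x ht hx
    have h1 : HasDerivAt (fun t => W t x) (∑ i, 2 * D i t x * D' i t x) t := by
      refine HasDerivAt.const_add _ (HasDerivAt.fun_sum fun i _ => ?_)
      simpa using (hDt ht hx i).fun_pow 2
    refine (h1.sqrt (hWpos t x).ne').congr_deriv ?_
    have h2 : ∑ i, 2 * D i t x * D' i t x = 2 * ∑ i, D i t x * D' i t x := by
      rw [Finset.mul_sum]
      exact Finset.sum_congr rfl fun i _ => mul_assoc _ _ _
    rw [h2, mul_div_mul_left _ _ two_ne_zero]
  have hD0 : ∀ {x : Space N}, x ≠ 0 → ∀ i, D i 0 x = 0 := by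
    intro x hx i
    have h1 : HasFDerivAt (s 0) (0 : Space N →L[ℝ] ℝ) x := by
      refine (hasFDerivAt_const (0 : ℝ) x).congr_of_eventuallyEq ?_
      filter_upwards [isOpen_compl_singleton.mem_nhds (show x ∈ ({0}ᶜ : Set (Space N)) from hx)]
        with y hy
      exact hs0 y hy
    exact congrArg (fun L => L (EuclideanSpace.single i 1)) ((hsx h0I hx).unique h1)
  have hW0 : ∀ {x : Space N}, x ≠ 0 → W 0 x = 1 := fun hx => by
    simp only [hW, hD0 hx]; simp
  -- volume
  have hexpC : ∀ b : ℝ, ContinuousOn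
      (fun q : ℝ × sphere (0 : Space N) 1 => Real.exp (b * s q.1 q.2)) (I ×ˢ univ) := fun b =>
    (continuousOn_const.mul hsC).rexp
  have hexpt : ∀ b : ℝ, ∀ {t : ℝ} {x : Space N}, t ∈ I → x ≠ 0 →
      HasDerivAt (fun t => Real.exp (b * s t x)) (b * σ t x * Real.exp (b * s t x)) t := by
    intro b t x ht hx
    refine ((hst ht hx).const_mul b).exp.congr_deriv ?_
    ring
  -- Differentiate the constant volume integral and divide by `a + 1`.
  have hvol : ∀ t ∈ I, ∫ p : sphere (0 : Space N) 1,
      σ t p * Real.exp ((a + 1) * s t p) ∂(sphereMeasure N) = 0 := by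
    intro t ht
    have h1 := hasDerivAt_integral_of_continuousOn (μ := sphereMeasure N) hIo
      (F := fun t p => Real.exp ((a + 1) * s t p))
      (F' := fun t p => (a + 1) * σ t p * Real.exp ((a + 1) * s t p)) (hexpC (a + 1))
      ((continuousOn_const.mul hσC).mul (hexpC (a + 1)))
      (fun t ht p => hexpt (a + 1) ht (hp0 p)) ht
    have h2 : HasDerivAt (fun t => ∫ p : sphere (0 : Space N) 1,
        Real.exp ((a + 1) * s t p) ∂(sphereMeasure N)) 0 t := by
      refine (hasDerivAt_const t (∫ p : sphere (0 : Space N) 1,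
        Real.exp ((a + 1) * s 0 p) ∂(sphereMeasure N))).congr_of_eventuallyEq ?_
      filter_upwards [hIo.mem_nhds ht] with t' ht'
      exact hV t' ht'
    have h3 := h1.unique h2
    simp_rw [mul_assoc] at h3
    rw [integral_const_mul] at h3
    exact (mul_eq_zero.1 h3).resolve_left ha
  -- first variation of area
  set A : ℝ → ℝ := fun t => ∫ p : sphere (0 : Space N) 1,
    Real.exp (a * s t p) * √(1 + ‖fderiv ℝ (s t) p‖ ^ 2) ∂(sphereMeasure N) with hA
  -- This is the coefficient of `a σ` in the derivative of area after `a` times the volume identity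
  -- has been subtracted. The subtraction makes it vanish at time 0, where `s = 0` and `∇s = 0`.
  set b : ℝ → sphere (0 : Space N) 1 → ℝ := fun t p =>
    Real.exp (a * s t p) * √(W t p) - Real.exp ((a + 1) * s t p) with hb
  set b' : ℝ → sphere (0 : Space N) 1 → ℝ := fun t p =>
    a * σ t p * Real.exp (a * s t p) * √(W t p) +
      Real.exp (a * s t p) * ((∑ i, D i t p * D' i t p) / √(W t p)) -
      (a + 1) * σ t p * Real.exp ((a + 1) * s t p) with hb'
  set c : Fin N → ℝ → sphere (0 : Space N) 1 → ℝ := fun i t p =>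
    Real.exp (a * s t p) * (D' i t p / √(W t p)) with hc
  have hWne : ∀ t x, √(W t x) ≠ 0 := fun t x => (Real.sqrt_pos.2 (hWpos t x)).ne'
  have hsumC : ContinuousOn (fun q : ℝ × sphere (0 : Space N) 1 =>
      (∑ i, D i q.1 q.2 * D' i q.1 q.2) / √(W q.1 q.2)) (I ×ˢ univ) :=
    (continuousOn_finsetSum _ fun i _ => (hDC i).mul (hD'C i)).div hWC fun q _ => hWne _ _
  have hcC : ∀ i, ContinuousOn (fun q : ℝ × sphere (0 : Space N) 1 => c i q.1 q.2) (I ×ˢ univ) :=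
    fun i => (hexpC a).mul ((hD'C i).div hWC fun q _ => hWne _ _)
  have hbC : ContinuousOn (fun q : ℝ × sphere (0 : Space N) 1 => b q.1 q.2) (I ×ˢ univ) :=
    ((hexpC a).mul hWC).sub (hexpC (a + 1))
  have hFC' : ContinuousOn (fun q : ℝ × sphere (0 : Space N) 1 =>
      a * σ q.1 q.2 * Real.exp (a * s q.1 q.2) * √(W q.1 q.2) +
      Real.exp (a * s q.1 q.2) * ((∑ i, D i q.1 q.2 * D' i q.1 q.2) / √(W q.1 q.2)))
      (I ×ˢ univ) :=
    (((continuousOn_const.mul hσC).mul (hexpC a)).mul hWC).add ((hexpC a).mul hsumC)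
  have hbC' : ContinuousOn (fun q : ℝ × sphere (0 : Space N) 1 => b' q.1 q.2) (I ×ˢ univ) :=
    hFC'.sub ((continuousOn_const.mul hσC).mul (hexpC (a + 1)))
  have hA1 : ∀ t ∈ I, HasDerivAt A (∫ p : sphere (0 : Space N) 1,
      (a * σ t p * Real.exp (a * s t p) * √(W t p) +
      Real.exp (a * s t p) * ((∑ i, D i t p * D' i t p) / √(W t p))) ∂(sphereMeasure N)) t := by
    intro t ht
    have h1 := hasDerivAt_integral_of_continuousOn (μ := sphereMeasure N) hIo
      (F := fun t p => Real.exp (a * s t p) * √(W t p))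
      (F' := fun t p => a * σ t p * Real.exp (a * s t p) * √(W t p) +
      Real.exp (a * s t p) * ((∑ i, D i t p * D' i t p) / √(W t p))) ((hexpC a).mul hWC) hFC'
      (fun t ht p => (hexpt a ht (hp0 p)).mul (hWt ht (hp0 p))) ht
    refine h1.congr_of_eventuallyEq ?_
    filter_upwards [hIo.mem_nhds ht] with t' ht'
    refine integral_congr_ae (Filter.Eventually.of_forall fun p => ?_)
    simp only [hnorm ht' (hp0 p), hW]
  -- Each integrand is a product whose first factor, `b` or `D i`, vanishes at time 0 and is
  -- differentiable in time, while the second is only known to be continuous. Differentiating the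
  -- second factors would require third derivatives of `s`.
  have hA2 : ∀ t ∈ I, deriv A t = ∫ p : sphere (0 : Space N) 1, b t p * (a * σ t p)
      ∂(sphereMeasure N) + ∑ i, ∫ p : sphere (0 : Space N) 1, D i t p * c i t p
      ∂(sphereMeasure N) := by
    intro t ht
    have hint : ∀ {F : ℝ → sphere (0 : Space N) 1 → ℝ}, ContinuousOn
        (fun q : ℝ × sphere (0 : Space N) 1 => F q.1 q.2) (I ×ˢ univ) →
        Integrable (F t) (sphereMeasure N) := fun hF =>
      integrable_of_continuous (continuous_slice hF ht)
    have i1 := hint (F := fun t p => b t p * (a * σ t p)) (hbC.mul (continuousOn_const.mul hσC))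
    have i2 : ∀ i ∈ Finset.univ, Integrable (fun p : sphere (0 : Space N) 1 => D i t p * c i t p)
      (sphereMeasure N) := fun i _ => hint (F := fun t p => D i t p * c i t p) ((hDC i).mul (hcC i))
    have i3 := hint (F := fun t p => σ t p * Real.exp ((a + 1) * s t p)) (hσC.mul (hexpC (a + 1)))
    rw [(hA1 t ht).deriv, ← integral_finsetSum _ i2, ← integral_add i1 (integrable_finsetSum _ i2),
      ← sub_zero (∫ p : sphere (0 : Space N) 1, _ ∂_), ← mul_zero a, ← hvol t ht,
      ← integral_const_mul, ← integral_sub (hint (F := fun t p => a * σ t p * Real.exp (a * s t p) * √(W t p) +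
        Real.exp (a * s t p) * ((∑ i, D i t p * D' i t p) / √(W t p))) hFC') (i3.const_mul a)]
    refine integral_congr_ae (Filter.Eventually.of_forall fun p => ?_)
    have h1 : ∑ i, D i t p * c i t p =
        Real.exp (a * s t p) * ((∑ i, D i t p * D' i t p) / √(W t p)) := by
      rw [Finset.sum_div, Finset.mul_sum]
      refine Finset.sum_congr rfl fun i _ => ?_
      simp only [hc]
      ring
    simp only [h1, hb]
    ring
  have hb0 : ∀ p, b 0 p = 0 := fun p => by
    simp only [hb, hs0 _ (hp0 p), hW0 (hp0 p)]; simp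
  have hb1 : ∀ t ∈ I, ∀ p, HasDerivAt (fun t => b t p) (b' t p) t := fun t ht p =>
    ((hexpt a ht (hp0 p)).mul (hWt ht (hp0 p))).sub (hexpt (a + 1) ht (hp0 p))
  have d1 := hasDerivAt_integral_mul_of_vanishing (μ := sphereMeasure N) hIo hbC hbC'
    (c := fun t p => a * σ t p) (continuousOn_const.mul hσC) hb1 h0I hb0
  have d2 : ∀ i ∈ Finset.univ, _ := fun i (_ : i ∈ Finset.univ) =>
    hasDerivAt_integral_mul_of_vanishing (μ := sphereMeasure N) hIo (k := fun t p => D i t p)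
      (k' := fun t p => D' i t p) (hDC i) (hD'C i) (hcC i)
      (fun t ht p => hDt ht (hp0 p) i) h0I (fun p => hD0 (hp0 p) i)
  have d3 := d1.add (HasDerivAt.fun_sum d2)
  refine ⟨hu1, ?_, fun t ht => (hA1 t ht).differentiableAt, ?_, ?_⟩
  · refine Eq.trans ?_ (hvol 0 h0I)
    refine integral_congr_ae (Filter.Eventually.of_forall fun p => ?_)
    simp only [hderiv0 _ (hp0 p), hs0 _ (hp0 p)]
    simp
  · rw [hA2 0 h0I]
    simp [hb0, hD0 (hp0 _)]
  · have h1 : deriv A =ᶠ[𝓝 0] fun t => ∫ p : sphere (0 : Space N) 1, b t p * (a * σ t p)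
      ∂(sphereMeasure N) + ∑ i, ∫ p : sphere (0 : Space N) 1, D i t p * c i t p
      ∂(sphereMeasure N) := by
      filter_upwards [hIo.mem_nhds h0I] with t ht
      exact hA2 t ht
    refine (d3.congr_of_eventuallyEq h1).congr_deriv ?_
    have hint : ∀ {F : ℝ → sphere (0 : Space N) 1 → ℝ}, ContinuousOn
        (fun q : ℝ × sphere (0 : Space N) 1 => F q.1 q.2) (I ×ˢ univ) →
        Integrable (F 0) (sphereMeasure N) := fun hF =>
      integrable_of_continuous (continuous_slice hF h0I)
    have i1 := hint (F := fun t p => b' t p * (a * σ t p)) (hbC'.mul (continuousOn_const.mul hσC))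
    have i2 : ∀ i ∈ Finset.univ, Integrable (fun p : sphere (0 : Space N) 1 => D' i 0 p * c i 0 p)
      (sphereMeasure N) := fun i _ =>
        hint (F := fun t p => D' i t p * c i t p) ((hD'C i).mul (hcC i))
    rw [← integral_finsetSum _ i2, ← integral_add i1 (integrable_finsetSum _ i2)]
    refine integral_congr_ae (Filter.Eventually.of_forall fun p => ?_)
    have h2 : ∑ i, D' i 0 p * c i 0 p = ∑ i, D' i 0 p ^ 2 := by
      refine Finset.sum_congr rfl fun i _ => ?_
      simp only [hc, hs0 _ (hp0 p), hW0 (hp0 p)]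
      simp [pow_two]
    -- At time 0, `b' = a σ - (a + 1) σ = -σ`, which produces the term `-a σ²`.
    simp only [h2, hux (hp0 p), hderiv0 _ (hp0 p), hb', hs0 _ (hp0 p), hW0 (hp0 p), hD0 (hp0 p)]
    simp
    ring

end SecondVariation

/-! ### Polynomials, the Euler operator and the degree filtration -/

section Polynomials

open MvPolynomial

variable {N : ℕ}

/-- Polynomials of degree less than `m`. -/
def polyDegreeLT (N m : ℕ) : Submodule ℝ (MvPolynomial (Fin N) ℝ) :=
  Submodule.span ℝ ((fun s => monomial s (1 : ℝ)) '' {s : Fin N →₀ ℕ | s.degree < m})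

lemma monomial_mem_polyDegreeLT {m : ℕ} {s : Fin N →₀ ℕ} (hs : s.degree < m) (a : ℝ) :
    monomial s a ∈ polyDegreeLT N m := by
  have : monomial s a = a • monomial s (1 : ℝ) := by simp [smul_monomial]
  rw [this]
  exact Submodule.smul_mem _ _ (Submodule.subset_span ⟨s, hs, rfl⟩)

lemma polyDegreeLT_le_comap {m : ℕ} (T : MvPolynomial (Fin N) ℝ →ₗ[ℝ] MvPolynomial (Fin N) ℝ)
    (W : Submodule ℝ (MvPolynomial (Fin N) ℝ))
    (h : ∀ s : Fin N →₀ ℕ, s.degree < m → T (monomial s 1) ∈ W) :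
    ∀ q ∈ polyDegreeLT N m, T q ∈ W := by
  have : polyDegreeLT N m ≤ W.comap T := by
    refine Submodule.span_le.2 ?_
    rintro _ ⟨s, hs, rfl⟩
    exact h s hs
  exact this

lemma polyDegreeLT_mono {m k : ℕ} (h : m ≤ k) : polyDegreeLT N m ≤ polyDegreeLT N k :=
  Submodule.span_mono (image_mono fun _ hs => lt_of_lt_of_le hs h)

lemma polyDegreeLT_zero : polyDegreeLT N 0 = ⊥ := by
  simp [polyDegreeLT]

lemma exists_mem_polyDegreeLT (q : MvPolynomial (Fin N) ℝ) : ∃ m, q ∈ polyDegreeLT N m := by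
  induction q using MvPolynomial.monomial_add_induction_on with
  | C a => exact ⟨1, monomial_mem_polyDegreeLT (by simp) a⟩
  | monomial_add s a q _ _ hq =>
    obtain ⟨m, hm⟩ := hq
    refine ⟨max m (s.degree + 1), Submodule.add_mem _ ?_ ?_⟩
    · exact monomial_mem_polyDegreeLT (by omega) a
    · exact polyDegreeLT_mono (le_max_left _ _) hm

instance (m : ℕ) : FiniteDimensional ℝ (polyDegreeLT N m) :=
  FiniteDimensional.span_of_finite ℝ
    (((Finsupp.finite_of_degree_le (σ := Fin N) m).subset
      fun _ (hs : Finsupp.degree _ < m) => hs.le).image _)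

/-- The Euler operator `∑ Xᵢ ∂ᵢ`. -/
def eulerOp (N : ℕ) : MvPolynomial (Fin N) ℝ →ₗ[ℝ] MvPolynomial (Fin N) ℝ :=
  ∑ i, LinearMap.mulLeft ℝ (X i) ∘ₗ (pderiv i).toLinearMap

/-- The Laplace operator `∑ ∂ᵢ∂ᵢ`. -/
def polyLaplacian (N : ℕ) : MvPolynomial (Fin N) ℝ →ₗ[ℝ] MvPolynomial (Fin N) ℝ :=
  ∑ i, (pderiv i).toLinearMap ∘ₗ (pderiv i).toLinearMap

/-- The operator on polynomials inducing the negative of the Laplace-Beltrami operator on the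
restrictions to the unit sphere. -/
def sphereOp (N : ℕ) : MvPolynomial (Fin N) ℝ →ₗ[ℝ] MvPolynomial (Fin N) ℝ :=
  eulerOp N ∘ₗ eulerOp N + ((N : ℝ) - 2) • eulerOp N - polyLaplacian N

lemma eulerOp_apply (q : MvPolynomial (Fin N) ℝ) : eulerOp N q = ∑ i, X i * pderiv i q := by
  simp [eulerOp]

lemma polyLaplacian_apply (q : MvPolynomial (Fin N) ℝ) :
    polyLaplacian N q = ∑ i, pderiv i (pderiv i q) := by
  simp [polyLaplacian]

lemma sphereOp_apply (q : MvPolynomial (Fin N) ℝ) : sphereOp N q =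
    eulerOp N (eulerOp N q) + ((N : ℝ) - 2) • eulerOp N q - polyLaplacian N q := by
  simp [sphereOp]

lemma eulerOp_monomial (s : Fin N →₀ ℕ) (a : ℝ) :
    eulerOp N (monomial s a) = (s.degree : ℝ) • monomial s a := by
  rw [eulerOp_apply]
  simp only [X_mul_pderiv_monomial]
  rw [← Finset.sum_smul, ← Nat.cast_smul_eq_nsmul ℝ, Finsupp.degree_eq_sum]

lemma pderiv_mem_polyDegreeLT {m : ℕ} (i : Fin N) {q : MvPolynomial (Fin N) ℝ}
    (hq : q ∈ polyDegreeLT N (m + 1)) : pderiv i q ∈ polyDegreeLT N m := by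
  refine polyDegreeLT_le_comap (pderiv i).toLinearMap _ (fun s hs => ?_) q hq
  rw [Derivation.coeFn_coe, pderiv_monomial]
  by_cases hi : s i = 0
  · simp [hi]
  · refine monomial_mem_polyDegreeLT ?_ _
    have h1 : s = (s - Finsupp.single i 1) + Finsupp.single i 1 := by
      ext j
      by_cases hj : j = i
      · subst hj; simp; omega
      · simp [Ne.symm hj]
    have h2 := congrArg Finsupp.degree h1
    simp at h2
    omega

/-- On monomials of degree `d` the Euler terms act as `d (d + N - 2)`, and the Laplacian lowers the
degree. So `sphereOp` is triangular for the degree filtration, and its diagonal entries are the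
eigenvalues. -/
lemma sphereOp_sub_smul_mem {k : ℕ} {q : MvPolynomial (Fin N) ℝ}
    (hq : q ∈ polyDegreeLT N (k + 1)) :
    sphereOp N q - ((k : ℝ) * (k + N - 2)) • q ∈ polyDegreeLT N k := by
  have h1 : polyLaplacian N q ∈ polyDegreeLT N k := by
    rw [polyLaplacian_apply]
    exact Submodule.sum_mem _ fun i _ => pderiv_mem_polyDegreeLT i
      (polyDegreeLT_mono (Nat.le_succ k) (pderiv_mem_polyDegreeLT i hq))
  have h2 : eulerOp N (eulerOp N q) + ((N : ℝ) - 2) • eulerOp N q - ((k : ℝ) * (k + N - 2)) • q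
      ∈ polyDegreeLT N k := by
    refine polyDegreeLT_le_comap (eulerOp N ∘ₗ eulerOp N + ((N : ℝ) - 2) • eulerOp N
      - ((k : ℝ) * (k + N - 2)) • LinearMap.id) _ (fun s hs => ?_) q hq
    have : (eulerOp N ∘ₗ eulerOp N + ((N : ℝ) - 2) • eulerOp N
      - ((k : ℝ) * (k + N - 2)) • LinearMap.id : MvPolynomial (Fin N) ℝ →ₗ[ℝ] MvPolynomial (Fin N) ℝ)
        (monomial s (1 : ℝ)) =
        ((s.degree : ℝ) * (s.degree + N - 2) - (k : ℝ) * (k + N - 2)) • monomial s (1 : ℝ) := by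
      simp only [LinearMap.sub_apply, LinearMap.add_apply, LinearMap.comp_apply,
        LinearMap.smul_apply, eulerOp_monomial, map_smul, LinearMap.id_apply, smul_smul,
        ← add_smul, ← sub_smul]
      congr 1
      ring
    rw [this]
    rcases Nat.lt_succ_iff_lt_or_eq.1 hs with h | h
    · exact Submodule.smul_mem _ _ (monomial_mem_polyDegreeLT h 1)
    · simp [h]
  have h3 := Submodule.sub_mem _ h2 h1
  rw [sphereOp_apply]
  convert h3 using 1
  abel

lemma sphereOp_mem {m : ℕ} {q : MvPolynomial (Fin N) ℝ} (hq : q ∈ polyDegreeLT N m) :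
    sphereOp N q ∈ polyDegreeLT N m := by
  rcases m with _ | k
  · rw [polyDegreeLT_zero, Submodule.mem_bot] at hq ⊢
    rw [hq, map_zero]
  · have h1 := polyDegreeLT_mono (Nat.le_succ k) (sphereOp_sub_smul_mem hq)
    have h2 := Submodule.add_mem _ h1 (Submodule.smul_mem _ ((k : ℝ) * (k + N - 2)) hq)
    simpa using h2

/-- The polynomial function defined by `q`. -/
def polyEval (q : MvPolynomial (Fin N) ℝ) (x : Space N) : ℝ := eval (fun i => x i) q

lemma polyEval_add (p q : MvPolynomial (Fin N) ℝ) (x : Space N) :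
    polyEval (p + q) x = polyEval p x + polyEval q x := by simp [polyEval]

lemma polyEval_sub (p q : MvPolynomial (Fin N) ℝ) (x : Space N) :
    polyEval (p - q) x = polyEval p x - polyEval q x := by simp [polyEval]

lemma polyEval_smul (c : ℝ) (q : MvPolynomial (Fin N) ℝ) (x : Space N) :
    polyEval (c • q) x = c * polyEval q x := by simp [polyEval, smul_eval]

lemma polyEval_mul (p q : MvPolynomial (Fin N) ℝ) (x : Space N) :
    polyEval (p * q) x = polyEval p x * polyEval q x := by simp [polyEval]

lemma polyEval_sum {ι : Type*} (s : Finset ι) (q : ι → MvPolynomial (Fin N) ℝ) (x : Space N) :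
    polyEval (∑ i ∈ s, q i) x = ∑ i ∈ s, polyEval (q i) x := by simp [polyEval]

lemma polyEval_X (i : Fin N) (x : Space N) : polyEval (X i) x = x i := by simp [polyEval]

lemma contDiff_polyEval {n : WithTop ℕ∞} (q : MvPolynomial (Fin N) ℝ) :
    ContDiff ℝ n (polyEval q) := by
  induction q using MvPolynomial.induction_on with
  | C a =>
    have : polyEval (N := N) (C a) = fun _ => a := funext fun x => by simp [polyEval]
    rw [this]
    exact contDiff_const
  | add p q hp hq =>
    rw [show polyEval (p + q) = fun x => polyEval p x + polyEval q x from
      funext (polyEval_add p q)]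
    exact hp.add hq
  | mul_X p i hp =>
    rw [show polyEval (p * X i) = fun x => polyEval p x * x i from
      funext fun x => by rw [polyEval_mul, polyEval_X]]
    refine hp.mul ?_
    exact (EuclideanSpace.proj (𝕜 := ℝ) i : Space N →L[ℝ] ℝ).contDiff

lemma hasFDerivAt_polyEval (q : MvPolynomial (Fin N) ℝ) (x : Space N) :
    HasFDerivAt (polyEval q)
      (∑ i, polyEval (pderiv i q) x • (EuclideanSpace.proj i : Space N →L[ℝ] ℝ)) x := by
  induction q using MvPolynomial.induction_on with
  | C a =>
    have : polyEval (N := N) (C a) = fun _ => a := funext fun x => by simp [polyEval]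
    rw [this]
    simpa [polyEval] using hasFDerivAt_const a x
  | add p q hp hq =>
    have := hp.add hq
    simp only [← Finset.sum_add_distrib, ← add_smul, ← polyEval_add, ← map_add] at this
    exact this.congr_of_eventuallyEq (Filter.Eventually.of_forall fun x => polyEval_add p q x)
  | mul_X p i hp =>
    have h1 : HasFDerivAt (fun x : Space N => x i) (EuclideanSpace.proj i : Space N →L[ℝ] ℝ) x :=
      (EuclideanSpace.proj i : Space N →L[ℝ] ℝ).hasFDerivAt
    have := hp.mul h1
    have h2 : ∀ y, polyEval (p * X i) y = polyEval p y * y i := fun y => by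
      rw [polyEval_mul, polyEval_X]
    refine (this.congr_of_eventuallyEq (Filter.Eventually.of_forall h2)).congr_fderiv ?_
    ext v
    simp only [Derivation.leibniz, pderiv_X, smul_eq_mul, polyEval_add, polyEval_mul, polyEval_X]
    simp [add_mul, Finset.sum_add_distrib, Finset.mul_sum, Pi.single_apply, apply_ite, polyEval,
      mul_assoc]

lemma fderiv_polyEval (q : MvPolynomial (Fin N) ℝ) (x v : Space N) :
    fderiv ℝ (polyEval q) x v = ∑ i, polyEval (pderiv i q) x * v i := by
  simp [(hasFDerivAt_polyEval q x).fderiv]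

lemma fderiv_polyEval_self (q : MvPolynomial (Fin N) ℝ) (x : Space N) :
    fderiv ℝ (polyEval q) x x = polyEval (eulerOp N q) x := by
  rw [fderiv_polyEval, eulerOp_apply, polyEval_sum]
  exact Finset.sum_congr rfl fun i _ => by rw [polyEval_mul, polyEval_X, mul_comm]

lemma fderiv_polyEval_single (q : MvPolynomial (Fin N) ℝ) (x : Space N) (i : Fin N) :
    fderiv ℝ (polyEval q) x (EuclideanSpace.single i 1) = polyEval (pderiv i q) x := by
  simp [fderiv_polyEval]

lemma eulerOp_X_mul (i : Fin N) (q : MvPolynomial (Fin N) ℝ) :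
    eulerOp N (X i * q) = X i * q + X i * eulerOp N q := by
  simp only [eulerOp_apply, Derivation.leibniz, pderiv_X, smul_eq_mul, mul_add,
    Finset.sum_add_distrib]
  simp [Pi.single_apply, apply_ite, Finset.mul_sum, mul_comm, mul_left_comm, add_comm]

lemma polyLaplacian_X_mul (i : Fin N) (q : MvPolynomial (Fin N) ℝ) :
    polyLaplacian N (X i * q) = X i * polyLaplacian N q + 2 * pderiv i q := by
  have h : ∀ j, pderiv j (pderiv j (X i * q)) =
      X i * pderiv j (pderiv j q) + if j = i then 2 * pderiv i q else 0 := by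
    intro j
    by_cases hj : j = i
    · subst hj
      simp [pderiv_X]
      ring
    · simp [pderiv_X, hj, Ne.symm hj]
  simp only [polyLaplacian_apply, h, Finset.sum_add_distrib, ← Finset.mul_sum]
  simp

/-- This is the form in which `E²` arises in Green's formula, where each `∂ᵢ q` is differentiated
radially. -/
lemma eulerOp_eulerOp (q : MvPolynomial (Fin N) ℝ) :
    eulerOp N (eulerOp N q) = eulerOp N q + ∑ i, X i * eulerOp N (pderiv i q) := by
  conv_lhs => rw [eulerOp_apply q]
  rw [map_sum]
  simp only [eulerOp_X_mul, Finset.sum_add_distrib, ← eulerOp_apply]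

end Polynomials

/-! ### Green's formula and the Dirichlet integral -/

section Green

open MvPolynomial

variable {N : ℕ}

lemma contDiffOn_radialExtension {n : WithTop ℕ∞} {f : Space N → ℝ}
    (hf : ContDiffOn ℝ n f {0}ᶜ) : ContDiffOn ℝ n (radialExtension f) {0}ᶜ := by
  have h1 : ContDiffOn ℝ n (fun x : Space N => ‖x‖) {0}ᶜ := fun x hx =>
    (contDiffAt_norm ℝ hx).contDiffWithinAt
  refine hf.comp ((h1.inv fun x hx => norm_ne_zero_iff.2 hx).smul contDiffOn_id) fun x hx => ?_
  have : ‖x‖ ≠ 0 := norm_ne_zero_iff.2 hx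
  simp only [mem_compl_iff, mem_singleton_iff, smul_eq_zero, inv_eq_zero, not_or]
  exact ⟨this, hx⟩

/-- At a point of the sphere the derivative of `x ↦ x / ‖x‖` is the orthogonal projection onto the
tangent space. -/
lemma fderiv_radialExtension {f : Space N → ℝ} {p : Space N} (hf : DifferentiableAt ℝ f p)
    (hp : p ∈ sphere (0 : Space N) 1) (v : Space N) :
    fderiv ℝ (radialExtension f) p v = fderiv ℝ f p (v - ⟪p, v⟫ • p) := by
  have hp1 : ‖p‖ = 1 := mem_sphere_zero_iff_norm.1 hp
  have h1 := (hasFDerivAt_norm_of_mem_sphere hp)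
  have h2 : HasFDerivAt (fun x : Space N => ‖x‖⁻¹) (-(innerSL ℝ p)) p := by
    have := (hasDerivAt_inv (x := ‖p‖) (by simp [hp1])).comp_hasFDerivAt p h1
    simpa [hp1, Function.comp_def] using this
  have h3 : HasFDerivAt (fun x : Space N => ‖x‖⁻¹ • x)
      (ContinuousLinearMap.id ℝ (Space N) - (innerSL ℝ p).smulRight p) p := by
    refine (h2.smul (hasFDerivAt_id p)).congr_fderiv ?_
    ext1 w
    simp [hp1, sub_eq_add_neg]
  have h4 : HasFDerivAt f (fderiv ℝ f p) (‖p‖⁻¹ • p) := by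
    simpa [hp1] using hf.hasFDerivAt
  have h5 : HasFDerivAt (radialExtension f) _ p :=
    HasFDerivAt.comp (f := fun x : Space N => ‖x‖⁻¹ • x) p h4 h3
  rw [h5.fderiv]
  simp

/-- Divergence theorem on the unit sphere, for the tangential part of a constant field. -/
lemma integral_sphere_fderiv_tangential (hN : 2 ≤ N) {φ : Space N → ℝ}
    (hφ : ContDiffOn ℝ 1 φ {0}ᶜ) (v : Space N) :
    ∫ p : sphere (0 : Space N) 1, fderiv ℝ φ p (v - ⟪(p : Space N), v⟫ • (p : Space N))
        ∂(sphereMeasure N) =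
      (N - 1 : ℝ) * ∫ p : sphere (0 : Space N) 1, φ p * ⟪(p : Space N), v⟫ ∂(sphereMeasure N) := by
  have h := integral_sphere_fderiv hN (isRadiallyConstant_radialExtension φ)
    (contDiffOn_radialExtension hφ) v
  have hd : ∀ p : sphere (0 : Space N) 1, DifferentiableAt ℝ φ p := fun p =>
    (hφ.differentiableOn one_ne_zero).differentiableAt
      (isOpen_compl_singleton.mem_nhds (ne_zero_of_mem_unit_sphere p))
  simpa only [fderiv_radialExtension (hd _) (Subtype.prop _),
    radialExtension_of_mem_sphere φ (Subtype.prop _)] using h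

lemma inner_single_one (x : Space N) (i : Fin N) : ⟪x, EuclideanSpace.single i (1 : ℝ)⟫ = x i := by
  simp [EuclideanSpace.inner_single_right]

lemma sum_smul_single (x : Space N) : ∑ i, x i • EuclideanSpace.single i (1 : ℝ) = x := by
  ext j
  simp [Finset.sum_apply, Pi.single_apply]

/-- Green's formula on the unit sphere. -/
theorem integral_fderiv_mul_pderiv (hN : 2 ≤ N) {u : Space N → ℝ} (hu : IsRadiallyConstant u)
    (hc : ContDiffOn ℝ 1 u {0}ᶜ) (q : MvPolynomial (Fin N) ℝ) :
    ∫ p : sphere (0 : Space N) 1, ∑ i, fderiv ℝ u p (EuclideanSpace.single i 1) *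
        polyEval (pderiv i q) p ∂(sphereMeasure N) =
      ∫ p : sphere (0 : Space N) 1, u p * polyEval (sphereOp N q) p ∂(sphereMeasure N) := by
  have hopen : IsOpen ({0}ᶜ : Set (Space N)) := isOpen_compl_singleton
  have hφ : ∀ i, ContDiffOn ℝ 1 (fun x => u x * polyEval (pderiv i q) x) {0}ᶜ := fun i =>
    hc.mul (contDiff_polyEval _).contDiffOn
  have hpc : ∀ r : MvPolynomial (Fin N) ℝ, Continuous (polyEval r) := fun r =>
    (contDiff_polyEval (n := 0) r).continuous
  have hud : ContinuousOn (fderiv ℝ u) {0}ᶜ := hc.continuousOn_fderiv_of_isOpen hopen le_rfl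
  have hi1 : ∀ i : Fin N, Integrable (fun p : sphere (0 : Space N) 1 =>
      fderiv ℝ (fun x => u x * polyEval (pderiv i q) x) p (EuclideanSpace.single i (1 : ℝ) -
        ⟪(p : Space N), EuclideanSpace.single i (1 : ℝ)⟫ • (p : Space N))) (sphereMeasure N) := by
    intro i
    refine integrable_sphere_of_continuousOn (f := fun x =>
      fderiv ℝ (fun x => u x * polyEval (pderiv i q) x) x (EuclideanSpace.single i (1 : ℝ) -
        ⟪x, EuclideanSpace.single i (1 : ℝ)⟫ • x)) ?_
    exact ((hφ i).continuousOn_fderiv_of_isOpen hopen le_rfl).clm_apply (by fun_prop)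
  have hi2 : ∀ i : Fin N, Integrable (fun p : sphere (0 : Space N) 1 =>
      (N - 1 : ℝ) * (u p * polyEval (pderiv i q) p *
        ⟪(p : Space N), EuclideanSpace.single i (1 : ℝ)⟫)) (sphereMeasure N) := by
    intro i
    refine integrable_sphere_of_continuousOn (f := fun x => (N - 1 : ℝ) *
      (u x * polyEval (pderiv i q) x * ⟪x, EuclideanSpace.single i (1 : ℝ)⟫)) ?_
    exact continuousOn_const.mul ((hφ i).continuousOn.mul (by fun_prop))
  -- The divergence theorem is applied to `u ∂ᵢ q` in direction `eᵢ` and summed. The radial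
  -- derivative of `u` is zero, so what remains is `∇u · ∇q + u (Δq - ∑ xᵢ E ∂ᵢ q)` against `(N - 1)
  -- u E q`. Since `∑ xᵢ E ∂ᵢ q = E² q - E q`, the coefficient of `E q` becomes `N - 2`.
  have key : ∑ i : Fin N, ∫ p : sphere (0 : Space N) 1,
      (fderiv ℝ (fun x => u x * polyEval (pderiv i q) x) p (EuclideanSpace.single i (1 : ℝ) -
        ⟪(p : Space N), EuclideanSpace.single i (1 : ℝ)⟫ • (p : Space N)) -
      (N - 1 : ℝ) * (u p * polyEval (pderiv i q) p *
        ⟪(p : Space N), EuclideanSpace.single i (1 : ℝ)⟫)) ∂(sphereMeasure N) = 0 := by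
    refine Finset.sum_eq_zero fun i _ => ?_
    rw [integral_sub (hi1 i) (hi2 i), integral_const_mul,
      integral_sphere_fderiv_tangential hN (hφ i), sub_self]
  have hi : ∀ i ∈ Finset.univ, Integrable (fun p : sphere (0 : Space N) 1 =>
      fderiv ℝ (fun x => u x * polyEval (pderiv i q) x) p (EuclideanSpace.single i (1 : ℝ) -
        ⟪(p : Space N), EuclideanSpace.single i (1 : ℝ)⟫ • (p : Space N)) -
      (N - 1 : ℝ) * (u p * polyEval (pderiv i q) p *
        ⟪(p : Space N), EuclideanSpace.single i (1 : ℝ)⟫)) (sphereMeasure N) :=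
    fun i _ => (hi1 i).sub (hi2 i)
  rw [← integral_finsetSum _ hi] at key
  rw [← sub_eq_zero, ← integral_sub, ← key]
  · refine integral_congr_ae (Filter.Eventually.of_forall fun p => ?_)
    have hp0 : (p : Space N) ≠ 0 := ne_zero_of_mem_unit_sphere p
    have hd : DifferentiableAt ℝ u p :=
      (hc.differentiableOn one_ne_zero).differentiableAt (hopen.mem_nhds hp0)
    have h1 : ∀ i, fderiv ℝ (fun x => u x * polyEval (pderiv i q) x) p
        (EuclideanSpace.single i (1 : ℝ) - ⟪(p : Space N), EuclideanSpace.single i (1 : ℝ)⟫ •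
          (p : Space N)) = fderiv ℝ u p (EuclideanSpace.single i 1) * polyEval (pderiv i q) p +
        u p * (polyEval (pderiv i (pderiv i q)) p -
          polyEval (X i * eulerOp N (pderiv i q)) p) := by
      intro i
      have h2 : HasFDerivAt (fun x => u x * polyEval (pderiv i q) x) _ (p : Space N) :=
        hd.hasFDerivAt.mul (hasFDerivAt_polyEval (pderiv i q) p).differentiableAt.hasFDerivAt
      rw [h2.fderiv]
      simp only [add_apply, smul_apply, map_sub, map_smul,
        hu.fderiv_self p hd, fderiv_polyEval_single, fderiv_polyEval_self, inner_single_one,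
        smul_eq_mul, polyEval_mul, polyEval_X]
      ring
    simp only [h1]
    simp only [inner_single_one]
    rw [sphereOp_apply, eulerOp_eulerOp]
    simp only [polyEval_sub, polyEval_add, polyEval_smul, polyLaplacian_apply, eulerOp_apply q,
      polyEval_sum, Finset.sum_sub_distrib, Finset.sum_add_distrib, ← Finset.mul_sum,
      polyEval_mul, polyEval_X]
    have h3 : ∑ i, u p * polyEval (pderiv i q) p * (p : Space N) i =
        u p * ∑ i, (p : Space N) i * polyEval (pderiv i q) p := by
      rw [Finset.mul_sum]
      exact Finset.sum_congr rfl fun i _ => by ring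
    rw [h3]
    ring
  · refine integrable_sphere_of_continuousOn (f := fun x => ∑ i, fderiv ℝ u x
      (EuclideanSpace.single i 1) * polyEval (pderiv i q) x) ?_
    exact continuousOn_finsetSum _ fun i _ =>
      (hud.clm_apply continuousOn_const).mul (hpc _).continuousOn
  · exact integrable_sphere_of_continuousOn (f := fun x => u x * polyEval (sphereOp N q) x)
      (hc.continuousOn.mul (hpc _).continuousOn)

lemma fderiv_radialExtension_polyEval (q : MvPolynomial (Fin N) ℝ) {p : Space N}
    (hp : p ∈ sphere (0 : Space N) 1) (i : Fin N) :
    fderiv ℝ (radialExtension (polyEval q)) p (EuclideanSpace.single i 1) =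
      polyEval (pderiv i q) p - p i * polyEval (eulerOp N q) p := by
  rw [fderiv_radialExtension (hasFDerivAt_polyEval q p).differentiableAt hp, map_sub, map_smul,
    fderiv_polyEval_single, fderiv_polyEval_self, inner_single_one, smul_eq_mul]

lemma contDiffOn_radialExtension_polyEval {n : WithTop ℕ∞} (q : MvPolynomial (Fin N) ℝ) :
    ContDiffOn ℝ n (radialExtension (polyEval q)) {0}ᶜ :=
  contDiffOn_radialExtension (contDiff_polyEval q).contDiffOn

lemma sum_mul_pderiv (q : MvPolynomial (Fin N) ℝ) (x : Space N) :
    ∑ i, x i * polyEval (pderiv i q) x = polyEval (eulerOp N q) x := by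
  simp only [eulerOp_apply, polyEval_sum, polyEval_mul, polyEval_X]

/-- The restriction to the unit sphere of the operator `sphereOp` is symmetric. -/
theorem integral_mul_sphereOp_comm (hN : 2 ≤ N) (q r : MvPolynomial (Fin N) ℝ) :
    ∫ p : sphere (0 : Space N) 1, polyEval q p * polyEval (sphereOp N r) p ∂(sphereMeasure N) =
      ∫ p : sphere (0 : Space N) 1, polyEval r p * polyEval (sphereOp N q) p
        ∂(sphereMeasure N) := by
  -- With `u` the radial extension of `q`, the left side of Green's formula is the integral of `∑ ∂ᵢ
  -- q ∂ᵢ r - (E q) (E r)`, which is symmetric in `q` and `r`.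
  have h := fun q r : MvPolynomial (Fin N) ℝ => integral_fderiv_mul_pderiv hN
    (isRadiallyConstant_radialExtension (polyEval q)) (contDiffOn_radialExtension_polyEval q) r
  simp only [radialExtension_of_mem_sphere _ (Subtype.prop _),
    fderiv_radialExtension_polyEval _ (Subtype.prop _), sub_mul, Finset.sum_sub_distrib,
    mul_assoc, mul_left_comm _ (polyEval (eulerOp N _) _), ← Finset.mul_sum, sum_mul_pderiv] at h
  rw [← h, ← h]
  simp only [mul_comm]

/-- Lower bound of the Dirichlet integral by its first order expansion at a polynomial. -/
theorem le_integral_norm_fderiv_sq (hN : 2 ≤ N) {u : Space N → ℝ} (hu : IsRadiallyConstant u)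
    (hc : ContDiffOn ℝ 1 u {0}ᶜ) (q : MvPolynomial (Fin N) ℝ) :
    2 * ∫ p : sphere (0 : Space N) 1, u p * polyEval (sphereOp N q) p ∂(sphereMeasure N) -
      ∫ p : sphere (0 : Space N) 1, polyEval q p * polyEval (sphereOp N q) p ∂(sphereMeasure N) ≤
      ∫ p : sphere (0 : Space N) 1, ‖fderiv ℝ u p‖ ^ 2 ∂(sphereMeasure N) := by
  have hopen : IsOpen ({0}ᶜ : Set (Space N)) := isOpen_compl_singleton
  have hpc : ∀ r : MvPolynomial (Fin N) ℝ, Continuous (polyEval r) := fun r =>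
    (contDiff_polyEval (n := 0) r).continuous
  have h1 := integral_fderiv_mul_pderiv hN hu hc q
  have h2 := integral_fderiv_mul_pderiv hN (isRadiallyConstant_radialExtension (polyEval q))
    (contDiffOn_radialExtension_polyEval q) q
  simp only [radialExtension_of_mem_sphere _ (Subtype.prop _)] at h2
  have hint : ∀ {w : Space N → ℝ}, ContDiffOn ℝ 1 w {0}ᶜ →
      Integrable (fun p : sphere (0 : Space N) 1 => ∑ i, fderiv ℝ w p
      (EuclideanSpace.single i 1) * polyEval (pderiv i q) p) (sphereMeasure N) := fun {w} hw =>
    integrable_sphere_of_continuousOn (f := fun x => ∑ i, fderiv ℝ w x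
      (EuclideanSpace.single i 1) * polyEval (pderiv i q) x)
      (continuousOn_finsetSum _ fun i _ => ((hw.continuousOn_fderiv_of_isOpen hopen
        le_rfl).clm_apply continuousOn_const).mul (hpc _).continuousOn)
  rw [← h1, ← h2, ← integral_const_mul, ← integral_sub ((hint hc).const_mul 2)
    (hint (contDiffOn_radialExtension_polyEval q))]
  refine integral_mono (((hint hc).const_mul 2).sub
    (hint (contDiffOn_radialExtension_polyEval q))) ?_ fun p => ?_
  · exact integrable_sphere_of_continuousOn (f := fun x => ‖fderiv ℝ u x‖ ^ 2)
      ((hc.continuousOn_fderiv_of_isOpen hopen le_rfl).norm.pow 2)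
  · have hp0 : (p : Space N) ≠ 0 := ne_zero_of_mem_unit_sphere p
    have hp1 : ‖(p : Space N)‖ = 1 := mem_sphere_zero_iff_norm.1 p.2
    have hd : DifferentiableAt ℝ u p :=
      (hc.differentiableOn one_ne_zero).differentiableAt (hopen.mem_nhds hp0)
    have h3 : ∑ i, (p : Space N) i * fderiv ℝ u p (EuclideanSpace.single i 1) = 0 := by
      have := congrArg (fderiv ℝ u p) (sum_smul_single (p : Space N))
      simpa only [map_sum, map_smul, smul_eq_mul, hu.fderiv_self p hd] using this
    have h4 : ∑ i, (p : Space N) i * (p : Space N) i = 1 := by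
      have := EuclideanSpace.real_norm_sq_eq (p : Space N)
      rw [hp1] at this
      simpa [pow_two] using this.symm
    simp only [fderiv_radialExtension_polyEval q p.2, norm_sq_eq_sum_apply_single]
    -- The inequality is `|∇u - ∇ᵀq|² ≥ 0`, where `∇ᵀq` has components `∂ᵢ q - xᵢ E q`. The
    -- remaining terms cancel after summation, because `∇u` is orthogonal to `p` and `‖p‖ = 1`.
    have h5 : ∀ i, fderiv ℝ u p (EuclideanSpace.single i 1) ^ 2 -
        (2 * (fderiv ℝ u p (EuclideanSpace.single i 1) * polyEval (pderiv i q) p) -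
        (polyEval (pderiv i q) p - (p : Space N) i * polyEval (eulerOp N q) p) *
          polyEval (pderiv i q) p) =
        (fderiv ℝ u p (EuclideanSpace.single i 1) -
          (polyEval (pderiv i q) p - (p : Space N) i * polyEval (eulerOp N q) p)) ^ 2
        - 2 * polyEval (eulerOp N q) p * ((p : Space N) i *
          fderiv ℝ u p (EuclideanSpace.single i 1)) +
        polyEval (eulerOp N q) p * ((p : Space N) i * polyEval (pderiv i q) p) -
        polyEval (eulerOp N q) p ^ 2 * ((p : Space N) i * (p : Space N) i) := fun i => by ring
    rw [← sub_nonneg, Finset.mul_sum, ← Finset.sum_sub_distrib, ← Finset.sum_sub_distrib,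
      Finset.sum_congr rfl fun i _ => h5 i]
    simp only [Finset.sum_sub_distrib, Finset.sum_add_distrib, ← Finset.mul_sum, h3, h4,
      sum_mul_pderiv]
    have : 0 ≤ ∑ i, (fderiv ℝ u p (EuclideanSpace.single i 1) - (polyEval (pderiv i q) p -
      (p : Space N) i * polyEval (eulerOp N q) p)) ^ 2 := Finset.sum_nonneg fun i _ => sq_nonneg _
    linarith

end Green

/-! ### Spectral lower bound by projection onto polynomials -/

section Galerkin

open MvPolynomial

variable {N : ℕ}

/-- Restriction of polynomial functions to the unit sphere. -/
def polyRestrict (N : ℕ) : MvPolynomial (Fin N) ℝ →ₐ[ℝ] C(sphere (0 : Space N) 1, ℝ) :=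
  aeval fun i => ⟨fun p => (p : Space N) i, by fun_prop⟩

lemma polyRestrict_apply (q : MvPolynomial (Fin N) ℝ) (p : sphere (0 : Space N) 1) :
    polyRestrict N q p = polyEval q p := by
  induction q using MvPolynomial.induction_on with
  | C a => simp [polyRestrict, polyEval]
  | add q r hq hr => rw [map_add, ContinuousMap.add_apply, hq, hr, polyEval_add]
  | mul_X q i hq =>
    rw [map_mul, ContinuousMap.mul_apply, hq, polyEval_mul, polyEval_X]
    simp [polyRestrict]

/-- The class in `L²` of a continuous function on the unit sphere. -/
def toSphereL2 (N : ℕ) : C(sphere (0 : Space N) 1, ℝ) →L[ℝ] Lp ℝ 2 (sphereMeasure N) :=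
  ContinuousMap.toLp 2 (sphereMeasure N) ℝ

/-- The class in `L²` of a polynomial function on the unit sphere. -/
def polyL2 (N : ℕ) : MvPolynomial (Fin N) ℝ →ₗ[ℝ] Lp ℝ 2 (sphereMeasure N) :=
  (toSphereL2 N).toLinearMap ∘ₗ (polyRestrict N).toLinearMap

lemma polyL2_apply (q : MvPolynomial (Fin N) ℝ) :
    polyL2 N q = toSphereL2 N (polyRestrict N q) := rfl

lemma inner_toSphereL2 (f g : C(sphere (0 : Space N) 1, ℝ)) :
    ⟪toSphereL2 N f, toSphereL2 N g⟫ = ∫ p, f p * g p ∂(sphereMeasure N) := by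
  rw [toSphereL2, ContinuousMap.inner_toLp]
  simp [mul_comm]

lemma inner_toSphereL2_polyL2 (f : C(sphere (0 : Space N) 1, ℝ)) (q : MvPolynomial (Fin N) ℝ) :
    ⟪toSphereL2 N f, polyL2 N q⟫ = ∫ p, f p * polyEval q p ∂(sphereMeasure N) := by
  simp only [polyL2_apply, inner_toSphereL2, polyRestrict_apply]

lemma inner_polyL2 (q r : MvPolynomial (Fin N) ℝ) :
    ⟪polyL2 N q, polyL2 N r⟫ =
      ∫ p : sphere (0 : Space N) 1, polyEval q p * polyEval r p ∂(sphereMeasure N) := by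
  simp only [polyL2_apply q, inner_toSphereL2_polyL2, polyRestrict_apply]

lemma inner_polyL2_sphereOp_comm (hN : 2 ≤ N) (q r : MvPolynomial (Fin N) ℝ) :
    ⟪polyL2 N q, polyL2 N (sphereOp N r)⟫ = ⟪polyL2 N r, polyL2 N (sphereOp N q)⟫ := by
  simp only [inner_polyL2, integral_mul_sphereOp_comm hN q r]

lemma toSphereL2_injective (hN : 1 ≤ N) : Function.Injective (toSphereL2 N) := by
  have : Nonempty (Fin N) := ⟨⟨0, hN⟩⟩
  exact ContinuousMap.toLp_injective (sphereMeasure N)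

/-- Stone-Weierstrass: the coordinates separate the points of the sphere. Uniform density passes to
L². -/
lemma toSphereL2_mem_closure (f : C(sphere (0 : Space N) 1, ℝ)) :
    toSphereL2 N f ∈ closure (Set.range (polyL2 N)) := by
  have h1 := ContinuousMap.continuousMap_mem_subalgebra_closure_of_separatesPoints
    (polyRestrict N).range (fun p q hpq => by
      have h2 : ∃ i, (p : Space N) i ≠ (q : Space N) i := by
        by_contra! h
        exact hpq (Subtype.ext (PiLp.ext h))
      obtain ⟨i, hi⟩ := h2
      refine ⟨_, ⟨polyRestrict N (X i), ⟨X i, rfl⟩, rfl⟩, ?_⟩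
      simpa [polyRestrict_apply, polyEval_X] using hi) f
  have h2 : f ∈ closure ((polyRestrict N).range : Set C(sphere (0 : Space N) 1, ℝ)) := h1
  refine map_mem_closure (toSphereL2 N).continuous h2 ?_
  rintro _ ⟨q, rfl⟩
  exact ⟨q, rfl⟩

lemma toSphereL2_eq_zero_of_orthogonal {f : C(sphere (0 : Space N) 1, ℝ)}
    (h : ∀ q, ⟪toSphereL2 N f, polyL2 N q⟫ = 0) : toSphereL2 N f = 0 := by
  have h1 : IsClosed {w : Lp ℝ 2 (sphereMeasure N) | ⟪toSphereL2 N f, w⟫ = 0} :=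
    isClosed_eq (by fun_prop) continuous_const
  have h2 : Set.range (polyL2 N) ⊆ {w | ⟪toSphereL2 N f, w⟫ = 0} := by
    rintro _ ⟨q, rfl⟩
    exact h q
  exact inner_self_eq_zero.1 (h1.closure_subset_iff.2 h2 (toSphereL2_mem_closure f))

lemma exists_poly_projection (w : Lp ℝ 2 (sphereMeasure N)) (m : ℕ) :
    ∃ q ∈ polyDegreeLT N m, ∀ r ∈ polyDegreeLT N m, ⟪w - polyL2 N q, polyL2 N r⟫ = 0 := by
  obtain ⟨v, ⟨q, hq, rfl⟩, hv⟩ := Submodule.HasOrthogonalProjection.exists_orthogonal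
    (K := (polyDegreeLT N m).map (polyL2 N)) w
  exact ⟨q, hq, fun r hr => by
    rw [real_inner_comm]
    exact hv _ ⟨r, hr, rfl⟩⟩

/-- The increment `v = q' - q` is orthogonal to degree less than `m`, and `sphereOp` multiplies it
by `m (m + N - 2)` modulo that space. The cross terms vanish by symmetry and Pythagoras applies, so
each degree contributes its eigenvalue times its squared norm. -/
lemma energy_succ_sub_energy (hN : 2 ≤ N) {w : Lp ℝ 2 (sphereMeasure N)} {m : ℕ}
    {q q' : MvPolynomial (Fin N) ℝ} (hq : q ∈ polyDegreeLT N m)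
    (hqo : ∀ r ∈ polyDegreeLT N m, ⟪w - polyL2 N q, polyL2 N r⟫ = 0)
    (hq' : q' ∈ polyDegreeLT N (m + 1))
    (hqo' : ∀ r ∈ polyDegreeLT N (m + 1), ⟪w - polyL2 N q', polyL2 N r⟫ = 0) :
    ⟪polyL2 N q', polyL2 N (sphereOp N q')⟫ - ⟪polyL2 N q, polyL2 N (sphereOp N q)⟫ =
      ((m : ℝ) * (m + N - 2)) * (‖polyL2 N q'‖ ^ 2 - ‖polyL2 N q‖ ^ 2) := by
  set v := q' - q with hv
  have hvm : v ∈ polyDegreeLT N (m + 1) :=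
    Submodule.sub_mem _ hq' (polyDegreeLT_mono (Nat.le_succ m) hq)
  have ho : ∀ r ∈ polyDegreeLT N m, ⟪polyL2 N v, polyL2 N r⟫ = 0 := by
    intro r hr
    have h1 := hqo r hr
    have h2 := hqo' r (polyDegreeLT_mono (Nat.le_succ m) hr)
    rw [inner_sub_left] at h1 h2
    rw [hv, map_sub, inner_sub_left]
    linarith
  have hq'v : q' = q + v := by rw [hv]; abel
  set d := sphereOp N v - ((m : ℝ) * (m + N - 2)) • v with hd
  have hdm : d ∈ polyDegreeLT N m := sphereOp_sub_smul_mem hvm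
  have hLv : sphereOp N v = ((m : ℝ) * (m + N - 2)) • v + d := by rw [hd]; abel
  have h1 : ⟪polyL2 N v, polyL2 N (sphereOp N v)⟫ =
      ((m : ℝ) * (m + N - 2)) * ‖polyL2 N v‖ ^ 2 := by
    rw [hLv, map_add, map_smul, inner_add_right, inner_smul_right, ho d hdm, add_zero,
      real_inner_self_eq_norm_sq]
  have h2 : ⟪polyL2 N v, polyL2 N (sphereOp N q)⟫ = 0 := ho _ (sphereOp_mem hq)
  have h3 : ⟪polyL2 N q, polyL2 N (sphereOp N v)⟫ = 0 := by
    rw [inner_polyL2_sphereOp_comm hN, h2]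
  have h4 : ‖polyL2 N q + polyL2 N v‖ ^ 2 = ‖polyL2 N q‖ ^ 2 + ‖polyL2 N v‖ ^ 2 := by
    rw [norm_add_sq_real, real_inner_comm, ho q hq]
    ring
  rw [hq'v]
  simp only [map_add, inner_add_left, inner_add_right]
  rw [h1, h2, h3, h4]
  ring

/-- The variational characterisation of the second nonzero eigenvalue `2N` of the sphere. -/
theorem le_energy (hN : 2 ≤ N) {f : C(sphere (0 : Space N) 1, ℝ)} {D : ℝ}
    (hD : ∀ q, 2 * ⟪toSphereL2 N f, polyL2 N (sphereOp N q)⟫ -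
      ⟪polyL2 N q, polyL2 N (sphereOp N q)⟫ ≤ D)
    (h0 : ∀ r ∈ polyDegreeLT N 1, ⟪toSphereL2 N f, polyL2 N r⟫ = 0)
    {q₂ : MvPolynomial (Fin N) ℝ} (hq : q₂ ∈ polyDegreeLT N 2)
    (hqo : ∀ r ∈ polyDegreeLT N 2, ⟪toSphereL2 N f - polyL2 N q₂, polyL2 N r⟫ = 0) :
    (N + 1 : ℝ) * ‖toSphereL2 N f - polyL2 N q₂‖ ^ 2 ≤ D - (N - 1) * ‖toSphereL2 N f‖ ^ 2 := by
  set w := toSphereL2 N f with hw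
  choose q hqm hqo' using exists_poly_projection (N := N) w
  have hpyth : ∀ {m : ℕ} {q : MvPolynomial (Fin N) ℝ}, q ∈ polyDegreeLT N m →
      (∀ r ∈ polyDegreeLT N m, ⟪w - polyL2 N q, polyL2 N r⟫ = 0) →
      ‖w - polyL2 N q‖ ^ 2 = ‖w‖ ^ 2 - ‖polyL2 N q‖ ^ 2 := by
    intro m q hq hqo
    have h1 := hqo q hq
    rw [inner_sub_left, real_inner_self_eq_norm_sq] at h1
    rw [norm_sub_sq_real]
    linarith
  have hstep := fun m => energy_succ_sub_energy hN (hqm m) (hqo' m) (hqm (m + 1)) (hqo' (m + 1))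
  have hN' : (2 : ℝ) ≤ N := by exact_mod_cast hN
  have hmono : ∀ m, ‖polyL2 N (q m)‖ ^ 2 ≤ ‖polyL2 N (q (m + 1))‖ ^ 2 := by
    intro m
    have h1 := hqo' (m + 1) (q m) (polyDegreeLT_mono (Nat.le_succ m) (hqm m))
    have h2 := hqo' m (q m) (hqm m)
    rw [inner_sub_left, sub_eq_zero] at h1 h2
    have h3 : ⟪polyL2 N (q (m + 1)), polyL2 N (q m)⟫ = ‖polyL2 N (q m)‖ ^ 2 := by
      rw [← h1, h2, real_inner_self_eq_norm_sq]
    have h4 := norm_sub_sq_real (polyL2 N (q (m + 1))) (polyL2 N (q m))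
    have h5 := sq_nonneg ‖polyL2 N (q (m + 1)) - polyL2 N (q m)‖
    linarith
  have hz : ∀ r, (∀ s ∈ polyDegreeLT N 1, ⟪w - polyL2 N r, polyL2 N s⟫ = 0) →
      r ∈ polyDegreeLT N 1 → polyL2 N r = 0 := by
    intro r hr hrm
    have h1 := hr r hrm
    rw [inner_sub_left, h0 r hrm, zero_sub, neg_eq_zero] at h1
    exact inner_self_eq_zero.1 h1
  have hE1 : ⟪polyL2 N (q 1), polyL2 N (sphereOp N (q 1))⟫ = 0 := by
    rw [hz _ (hqo' 1) (hqm 1), inner_zero_left]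
  -- The constant part is zero by `h0`, and degree one carries the eigenvalue `1 · (1 + N - 2) = N -
  -- 1`.
  have hE2 : ⟪polyL2 N (q 2), polyL2 N (sphereOp N (q 2))⟫ =
      (N - 1 : ℝ) * ‖polyL2 N (q 2)‖ ^ 2 := by
    have := hstep 1
    rw [hE1, hz _ (hqo' 1) (hqm 1)] at this
    norm_num at this
    rw [this]
    ring
  have hEm : ∀ k, 2 * (N : ℝ) * (‖polyL2 N (q (k + 2))‖ ^ 2 - ‖polyL2 N (q 2)‖ ^ 2) +
      (N - 1 : ℝ) * ‖polyL2 N (q 2)‖ ^ 2 ≤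
      ⟪polyL2 N (q (k + 2)), polyL2 N (sphereOp N (q (k + 2)))⟫ := by
    intro k
    induction k with
    | zero => simp [hE2]
    | succ k ih =>
      have h1 := hstep (k + 2)
      have h2 := hmono (k + 2)
      -- All later eigenvalues are at least the one of degree two, `2 · (2 + N - 2) = 2N`.
      have h3 : 2 * (N : ℝ) ≤ ((k + 2 : ℕ) : ℝ) * ((k + 2 : ℕ) + N - 2) := by
        push_cast
        have : (0 : ℝ) ≤ k := Nat.cast_nonneg k
        nlinarith
      rw [show k + 1 + 2 = k + 2 + 1 by ring]
      nlinarith [mul_le_mul_of_nonneg_right h3 (sub_nonneg.2 h2)]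
  have hbound : ∀ k, 2 * (N : ℝ) * (‖polyL2 N (q (k + 2))‖ ^ 2 - ‖polyL2 N (q 2)‖ ^ 2) +
      (N - 1 : ℝ) * ‖polyL2 N (q 2)‖ ^ 2 ≤ D := by
    intro k
    -- Testing `hD` with the projection itself gives its energy: `sphereOp` preserves the degree
    -- bound, so `f` may be replaced by its projection in the pairing.
    refine (hEm k).trans (le_trans (le_of_eq ?_) (hD (q (k + 2))))
    have h1 := hqo' (k + 2) _ (sphereOp_mem (hqm (k + 2)))
    rw [inner_sub_left, sub_eq_zero] at h1
    rw [h1]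
    ring
  -- Different polynomials may agree on the sphere; only the projection in L² is unique.
  have hq2 : ‖polyL2 N (q 2)‖ ^ 2 = ‖polyL2 N q₂‖ ^ 2 := by
    have h1 : polyL2 N (q 2) - polyL2 N q₂ = 0 := by
      have h2 := Submodule.sub_mem _ (hqm 2) hq
      have h3 := hqo _ h2
      have h4 := hqo' 2 _ h2
      rw [inner_sub_left] at h3 h4
      rw [← inner_self_eq_zero (𝕜 := ℝ), inner_sub_left, ← map_sub]
      linarith
    rw [sub_eq_zero.1 h1]
  have hlim : 2 * (N : ℝ) * (‖w‖ ^ 2 - ‖polyL2 N (q 2)‖ ^ 2) +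
      (N - 1 : ℝ) * ‖polyL2 N (q 2)‖ ^ 2 ≤ D := by
    -- By density some projection is within `√(ε / (2N))` of `f`. Its squared distance, multiplied
    -- by `2N`, costs at most `ε`.
    refine le_of_forall_pos_le_add fun ε hε => ?_
    obtain ⟨_, ⟨r, rfl⟩, hr⟩ := Metric.mem_closure_iff.1 (toSphereL2_mem_closure f)
      (√(ε / (2 * N))) (by positivity)
    obtain ⟨m, hm⟩ := exists_mem_polyDegreeLT r
    have hm' : r ∈ polyDegreeLT N (m + 2) := polyDegreeLT_mono (by omega) hm
    have h1 : ‖w - polyL2 N (q (m + 2))‖ ^ 2 ≤ ‖w - polyL2 N r‖ ^ 2 := by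
      have h2 := hqo' (m + 2) _ (Submodule.sub_mem _ (hqm (m + 2)) hm')
      have h3 : w - polyL2 N r = (w - polyL2 N (q (m + 2))) + polyL2 N (q (m + 2) - r) := by
        rw [map_sub]; abel
      rw [h3, norm_add_sq_real, h2]
      nlinarith [sq_nonneg ‖polyL2 N (q (m + 2) - r)‖]
    have h4 : ‖w - polyL2 N r‖ ^ 2 ≤ ε / (2 * N) := by
      rw [dist_eq_norm] at hr
      have := (Real.lt_sqrt (norm_nonneg _)).1 hr
      exact this.le
    rw [hpyth (hqm _) (hqo' _)] at h1
    have h5 := mul_le_mul_of_nonneg_left (h1.trans h4) (show (0 : ℝ) ≤ 2 * N by positivity)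
    rw [mul_div_cancel₀ _ (by positivity)] at h5
    linarith [hbound m]
  -- The constant `N + 1` is the gap `2N - (N - 1)` between the second and first nonzero
  -- eigenvalues.
  rw [hpyth hq hqo, ← hq2]
  linarith

lemma exists_affine_of_mem_polyDegreeLT {q : MvPolynomial (Fin N) ℝ}
    (hq : q ∈ polyDegreeLT N 2) : ∃ (c : ℝ) (e : Space N), ∀ x, polyEval q x = c + ⟪e, x⟫ := by
  induction hq using Submodule.span_induction with
  | mem q h =>
    obtain ⟨s, hs, rfl⟩ := h
    by_cases h0 : s = 0
    · exact ⟨1, 0, fun x => by simp [h0, polyEval]⟩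
    · obtain ⟨i, hi⟩ := Finsupp.ne_iff.1 h0
      have h1 : s = Finsupp.single i 1 := by
        have h2 : Finsupp.single i 1 ≤ s := by
          simp at hi ⊢
          omega
        obtain ⟨t, rfl⟩ := exists_add_of_le h2
        have h3 : (Finsupp.single i 1 + t).degree < 2 := hs
        rw [map_add, Finsupp.degree_single] at h3
        have : t = 0 := (Finsupp.degree_eq_zero_iff t).1 (by omega)
        rw [this, add_zero]
      refine ⟨0, EuclideanSpace.single i 1, fun x => ?_⟩
      rw [h1]
      simp [polyEval, EuclideanSpace.inner_single_left, eval_monomial]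
  | zero => exact ⟨0, 0, fun x => by simp [polyEval]⟩
  | add q r _ _ hq hr =>
    obtain ⟨c, e, h⟩ := hq
    obtain ⟨c', e', h'⟩ := hr
    exact ⟨c + c', e + e', fun x => by rw [polyEval_add, h, h', inner_add_left]; ring⟩
  | smul a q _ hq =>
    obtain ⟨c, e, h⟩ := hq
    exact ⟨a * c, a • e, fun x => by rw [polyEval_smul, h, real_inner_smul_left]; ring⟩

lemma exists_const_of_mem_polyDegreeLT {q : MvPolynomial (Fin N) ℝ}
    (hq : q ∈ polyDegreeLT N 1) : ∃ c : ℝ, q = C c := by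
  induction hq using Submodule.span_induction with
  | mem q h =>
    obtain ⟨s, hs, rfl⟩ := h
    have : s = 0 := (Finsupp.degree_eq_zero_iff s).1 (Nat.lt_one_iff.1 hs)
    exact ⟨1, by rw [this]; rfl⟩
  | zero => exact ⟨0, by simp⟩
  | add q r _ _ hq hr =>
    obtain ⟨c, rfl⟩ := hq
    obtain ⟨c', rfl⟩ := hr
    exact ⟨c + c', by simp⟩
  | smul a q _ hq =>
    obtain ⟨c, rfl⟩ := hq
    exact ⟨a * c, by simp [smul_eq_C_mul]⟩

/-- The polynomial defining the linear form `x ↦ ⟪e, x⟫`. -/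
def linearPoly (e : Space N) : MvPolynomial (Fin N) ℝ := ∑ i, e i • X i

lemma polyEval_linearPoly (e x : Space N) : polyEval (linearPoly e) x = ⟪e, x⟫ := by
  simp only [linearPoly, polyEval_sum, polyEval_smul, polyEval_X, PiLp.inner_apply]
  simp [mul_comm]

lemma sphereOp_linearPoly (e : Space N) :
    sphereOp N (linearPoly e) = ((N : ℝ) - 1) • linearPoly e := by
  have h : ∀ i : Fin N, sphereOp N (X i) = ((N : ℝ) - 1) • X i := by
    intro i
    have h1 : eulerOp N (X i) = X i := by
      rw [X, eulerOp_monomial]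
      simp
    have h2 : polyLaplacian N (X i) = 0 := by
      rw [polyLaplacian_apply]
      refine Finset.sum_eq_zero fun j _ => ?_
      rw [pderiv_X, Pi.single_apply]
      split_ifs <;> simp
    rw [sphereOp_apply, h1, h1, h2, sub_zero, ← one_smul ℝ (X i), smul_smul, smul_smul, ← add_smul]
    congr 1
    ring
  simp only [linearPoly, map_sum, map_smul, h, Finset.smul_sum, smul_comm _ ((N : ℝ) - 1)]

lemma sphereOp_C (c : ℝ) : sphereOp N (C c) = 0 := by
  have h1 : eulerOp N (C c) = 0 := by simp [eulerOp_apply]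
  have h2 : polyLaplacian N (C c) = 0 := by simp [polyLaplacian_apply]
  rw [sphereOp_apply, h1, h2]
  simp

/-- Symmetry of `sphereOp` tested on the constant 1 gives `N - 1` times the integral equal to zero.
-/
lemma integral_inner_sphere (hN : 2 ≤ N) (e : Space N) :
    ∫ p : sphere (0 : Space N) 1, ⟪e, (p : Space N)⟫ ∂(sphereMeasure N) = 0 := by
  have h := integral_mul_sphereOp_comm hN (C 1) (linearPoly e)
  simp only [sphereOp_linearPoly, sphereOp_C, polyEval_smul, polyEval_linearPoly] at h
  have h1 : ∀ x : Space N, polyEval (C 1) x = 1 := fun x => by simp [polyEval]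
  have h0 : ∀ x : Space N, polyEval 0 x = 0 := fun x => by simp [polyEval]
  simp only [h1, h0, one_mul, mul_zero, integral_zero] at h
  rw [integral_const_mul] at h
  have : (N : ℝ) - 1 ≠ 0 := by
    have : (2 : ℝ) ≤ N := by exact_mod_cast hN
    linarith
  exact (mul_eq_zero.1 h).resolve_left this

lemma sphereMeasure_real_univ_ne_zero (hN : 1 ≤ N) : (sphereMeasure N).real univ ≠ 0 := by
  have : Nonempty (Fin N) := ⟨⟨0, hN⟩⟩
  have : (sphere (0 : Space N) 1).Nonempty := NormedSpace.sphere_nonempty.2 zero_le_one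
  have : Nonempty (sphere (0 : Space N) 1) := this.to_subtype
  rw [Measure.real, ENNReal.toReal_ne_zero]
  exact ⟨isOpen_univ.measure_ne_zero _ univ_nonempty, measure_ne_top _ _⟩

/-- The second variation of area on functions of mean value zero is positive, except on the
normal components of translations. -/
theorem secondVariation_pos (hN : 2 ≤ N) {u : Space N → ℝ} (hu : IsRadiallyConstant u)
    (hc : ContDiffOn ℝ 1 u {0}ᶜ)
    (h0 : ∫ p : sphere (0 : Space N) 1, u p ∂(sphereMeasure N) = 0)
    (hne : ¬ ∃ e : Space N, ∀ p ∈ sphere (0 : Space N) 1, u p = ⟪e, p⟫) :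
    0 < ∫ p : sphere (0 : Space N) 1, (‖fderiv ℝ u p‖ ^ 2 - ((N : ℝ) - 1) * u p ^ 2)
      ∂(sphereMeasure N) := by
  have hopen : IsOpen ({0}ᶜ : Set (Space N)) := isOpen_compl_singleton
  have hN' : (2 : ℝ) ≤ N := by exact_mod_cast hN
  set f : C(sphere (0 : Space N) 1, ℝ) := ⟨fun p => u p, hc.continuousOn.comp_continuous
    continuous_subtype_val fun p => ne_zero_of_mem_unit_sphere p⟩ with hf
  have hfp : ∀ p, f p = u p := fun p => rfl
  rw [integral_sub, integral_const_mul]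
  rotate_left
  · exact integrable_sphere_of_continuousOn (f := fun x => ‖fderiv ℝ u x‖ ^ 2)
      ((hc.continuousOn_fderiv_of_isOpen hopen le_rfl).norm.pow 2)
  · exact integrable_sphere_of_continuousOn (f := fun x => ((N : ℝ) - 1) * u x ^ 2)
      (continuousOn_const.mul (hc.continuousOn.pow 2))
  have hnorm : ∫ p : sphere (0 : Space N) 1, u p ^ 2 ∂(sphereMeasure N) =
      ‖toSphereL2 N f‖ ^ 2 := by
    rw [← real_inner_self_eq_norm_sq, inner_toSphereL2]
    simp only [hfp, pow_two]
  obtain ⟨q, hq, hqo⟩ := exists_poly_projection (toSphereL2 N f) 2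
  have h01 : ∀ r ∈ polyDegreeLT N 1, ⟪toSphereL2 N f, polyL2 N r⟫ = 0 := by
    intro r hr
    obtain ⟨c, rfl⟩ := exists_const_of_mem_polyDegreeLT hr
    rw [inner_toSphereL2_polyL2]
    simp only [hfp, polyEval, eval_C]
    rw [integral_mul_const, h0, zero_mul]
  have key := le_energy hN (f := f) (D := ∫ p : sphere (0 : Space N) 1, ‖fderiv ℝ u p‖ ^ 2
    ∂(sphereMeasure N)) (fun q => by
      rw [inner_toSphereL2_polyL2, inner_polyL2]
      exact le_integral_norm_fderiv_sq hN hu hc q) h01 hq hqo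
  rw [hnorm]
  -- If the distance to degree less than two were zero, `u` would be affine on the sphere. Its mean
  -- value zero kills the constant, leaving a translation, which is excluded.
  refine lt_of_lt_of_le (mul_pos (by linarith) (pow_pos (norm_pos_iff.2 fun h => hne ?_) 2)) key
  obtain ⟨c, e, hce⟩ := exists_affine_of_mem_polyDegreeLT hq
  have h1 : f = polyRestrict N q := toSphereL2_injective (by omega) (sub_eq_zero.1 h)
  have h2 : ∀ p : sphere (0 : Space N) 1, u p = c + ⟪e, (p : Space N)⟫ := fun p => by
    rw [← hfp, h1, polyRestrict_apply, hce]
  simp only [h2] at h0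
  rw [integral_add (integrable_const c) (integrable_of_continuous (by fun_prop)),
    integral_inner_sphere hN, add_zero, integral_const, smul_eq_mul, mul_eq_zero] at h0
  have h3 : c = 0 := h0.resolve_left (sphereMeasure_real_univ_ne_zero (by omega))
  exact ⟨e, fun p hp => by rw [h2 ⟨p, hp⟩, h3, zero_add]⟩

/-- The second variation of area vanishes on the normal components of translations. -/
theorem secondVariation_translation (hN : 2 ≤ N) {u : Space N → ℝ} (hu : IsRadiallyConstant u)
    {e : Space N} (he : ∀ p ∈ sphere (0 : Space N) 1, u p = ⟪e, p⟫) :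
    ∫ p : sphere (0 : Space N) 1, (‖fderiv ℝ u p‖ ^ 2 - ((N : ℝ) - 1) * u p ^ 2)
      ∂(sphereMeasure N) = 0 := by
  have hopen : IsOpen ({0}ᶜ : Set (Space N)) := isOpen_compl_singleton
  have hue : ∀ x ≠ 0, u x = radialExtension (polyEval (linearPoly e)) x := by
    intro x hx
    have hx' : 0 < ‖x‖ := norm_pos_iff.2 hx
    rw [radialExtension, polyEval_linearPoly, ← he _ (by simp [norm_smul, hx'.ne']),
      hu _ (inv_pos.2 hx')]
  have hc : ContDiffOn ℝ 1 u {0}ᶜ :=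
    (contDiffOn_radialExtension_polyEval (linearPoly e)).congr fun x hx => hue x hx
  have h1 := integral_fderiv_mul_pderiv hN hu hc (linearPoly e)
  -- The gradient of `u` differs from that of the linear form by a radial vector, to which it is
  -- orthogonal. Green's formula then gives the eigenvalue `N - 1`.
  have h2 : ∀ p : sphere (0 : Space N) 1, ‖fderiv ℝ u p‖ ^ 2 =
      ∑ i, fderiv ℝ u p (EuclideanSpace.single i 1) * polyEval (pderiv i (linearPoly e)) p := by
    intro p
    have hp0 : (p : Space N) ≠ 0 := ne_zero_of_mem_unit_sphere p
    have hd : DifferentiableAt ℝ u p :=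
      (hc.differentiableOn one_ne_zero).differentiableAt (hopen.mem_nhds hp0)
    have h3 : ∀ i, fderiv ℝ u p (EuclideanSpace.single i 1) =
        polyEval (pderiv i (linearPoly e)) p -
          (p : Space N) i * polyEval (eulerOp N (linearPoly e)) p := by
      intro i
      rw [← fderiv_radialExtension_polyEval _ p.2, Filter.EventuallyEq.fderiv_eq]
      filter_upwards [hopen.mem_nhds hp0] with x hx using hue x hx
    have h4 : ∑ i, (p : Space N) i * fderiv ℝ u p (EuclideanSpace.single i 1) = 0 := by
      have := congrArg (fderiv ℝ u p) (sum_smul_single (p : Space N))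
      simpa only [map_sum, map_smul, smul_eq_mul, hu.fderiv_self p hd] using this
    rw [norm_sq_eq_sum_apply_single, ← sub_eq_zero, ← Finset.sum_sub_distrib]
    have h5 : ∀ i, fderiv ℝ u p (EuclideanSpace.single i 1) ^ 2 -
        fderiv ℝ u p (EuclideanSpace.single i 1) * polyEval (pderiv i (linearPoly e)) p =
        -polyEval (eulerOp N (linearPoly e)) p * ((p : Space N) i *
          fderiv ℝ u p (EuclideanSpace.single i 1)) := by
      intro i
      conv_lhs => rw [pow_two, ← mul_sub]
      nth_rewrite 2 [h3 i]
      ring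
    rw [Finset.sum_congr rfl fun i _ => h5 i, ← Finset.mul_sum, h4, mul_zero]
  rw [integral_sub]
  · simp only [h2, h1, sphereOp_linearPoly, polyEval_smul, polyEval_linearPoly, he _ (Subtype.prop _)]
    rw [sub_eq_zero]
    congr 1
    ext p
    ring
  · exact integrable_sphere_of_continuousOn (f := fun x => ‖fderiv ℝ u x‖ ^ 2)
      ((hc.continuousOn_fderiv_of_isOpen hopen le_rfl).norm.pow 2)
  · exact integrable_sphere_of_continuousOn (f := fun x => ((N : ℝ) - 1) * u x ^ 2)
      (continuousOn_const.mul (hc.continuousOn.pow 2))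

end Galerkin

/-! ### Spectrum and modes of the unit sphere -/

section Modes

open MvPolynomial

variable {N : ℕ}

lemma contDiffOn_fderiv_radialExtension {f : Space N → ℝ} (hf : IsC2OnSphere f) (v : Space N) :
    ContDiffOn ℝ 1 (fun x => fderiv ℝ (radialExtension f) x v) {0}ᶜ :=
  (ContDiffOn.fderiv_of_isOpen hf isOpen_compl_singleton (by norm_num)).clm_apply contDiffOn_const

lemma differentiableAt_radialExtension {f : Space N → ℝ} (hf : IsC2OnSphere f) {x : Space N}
    (hx : x ≠ 0) : DifferentiableAt ℝ (radialExtension f) x :=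
  (ContDiffOn.differentiableOn hf two_ne_zero).differentiableAt
    (isOpen_compl_singleton.mem_nhds hx)

/-- The Laplace-Beltrami operator in coordinates. -/
lemma sphereLaplacian_eq_sum {f : Space N → ℝ} (hf : IsC2OnSphere f) {p : Space N}
    (hp : p ∈ sphere (0 : Space N) 1) :
    sphereLaplacian f p = ∑ i, fderiv ℝ (fun x => fderiv ℝ (radialExtension f) x
      (EuclideanSpace.single i 1)) p (EuclideanSpace.single i (1 : ℝ) -
        ⟪p, EuclideanSpace.single i (1 : ℝ)⟫ • p) := by
  have hp1 : ‖p‖ = 1 := mem_sphere_zero_iff_norm.1 hp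
  have hp0 : p ≠ 0 := ne_zero_of_mem_unit_sphere ⟨p, hp⟩
  have hopen : IsOpen ({0}ᶜ : Set (Space N)) := isOpen_compl_singleton
  set g := radialExtension f with hg
  -- The radial extension has no radial derivative, so near `p` its tangential gradient is its full
  -- gradient.
  have h1 : tangentialGradient (fun x => ‖x‖⁻¹ • x) g =ᶠ[nhds p] ∇ g := by
    filter_upwards [hopen.mem_nhds hp0] with x hx
    rw [tangentialGradient, real_inner_smul_right, inner_gradient_left,
      (isRadiallyConstant_radialExtension f).fderiv_self x (differentiableAt_radialExtension hf hx),
      mul_zero, zero_smul, sub_zero]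
  have h2 : DifferentiableAt ℝ (∇ g) p := by
    have h3 : ContDiffOn ℝ 1 (fderiv ℝ g) {0}ᶜ :=
      ContDiffOn.fderiv_of_isOpen hf hopen (by norm_num)
    have h4 := (h3.differentiableOn one_ne_zero).differentiableAt (hopen.mem_nhds hp0)
    exact (InnerProductSpace.toDual ℝ (Space N)).symm.toContinuousLinearEquiv.differentiableAt.comp
      p h4
  have h3 : ∀ i w, fderiv ℝ (fun x => fderiv ℝ g x (EuclideanSpace.single i 1)) p w =
      ⟪fderiv ℝ (∇ g) p w, EuclideanSpace.single i (1 : ℝ)⟫ := by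
    intro i w
    have h4 : (fun x => fderiv ℝ g x (EuclideanSpace.single i 1)) =
        fun x => ⟪∇ g x, EuclideanSpace.single i (1 : ℝ)⟫ := by
      ext x
      rw [inner_gradient_left]
    rw [h4, fderiv_inner_apply ℝ h2 (differentiableAt_const _)]
    simp
  rw [sphereLaplacian, tangentialDivergence, h1.fderiv_eq,
    LinearMap.trace_eq_sum_inner _ (EuclideanSpace.basisFun (Fin N) ℝ)]
  simp only [h3, map_sub, map_smul, inner_sub_left, real_inner_smul_left, inner_single_one,
    Finset.sum_sub_distrib, hp1, inv_one, one_smul, EuclideanSpace.basisFun_apply]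
  congr 1
  refine Finset.sum_congr rfl fun i _ => ?_
  rw [real_inner_comm, inner_single_one]
  rfl

lemma continuousOn_sum_fderiv {f : Space N → ℝ} (hf : IsC2OnSphere f) :
    ContinuousOn (fun p => ∑ i, fderiv ℝ (fun x => fderiv ℝ (radialExtension f) x
      (EuclideanSpace.single i 1)) p (EuclideanSpace.single i (1 : ℝ) -
        ⟪p, EuclideanSpace.single i (1 : ℝ)⟫ • p)) {0}ᶜ := by
  refine continuousOn_finsetSum _ fun i _ => ?_
  exact ((contDiffOn_fderiv_radialExtension hf _).continuousOn_fderiv_of_isOpen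
    isOpen_compl_singleton le_rfl).clm_apply (by fun_prop)

lemma continuous_sphereLaplacian {f : Space N → ℝ} (hf : IsC2OnSphere f) :
    Continuous fun p : sphere (0 : Space N) 1 => sphereLaplacian f p := by
  simp only [sphereLaplacian_eq_sum hf (Subtype.prop _)]
  exact (continuousOn_sum_fderiv hf).comp_continuous continuous_subtype_val
    fun p => ne_zero_of_mem_unit_sphere p

lemma continuous_of_isC2OnSphere {f : Space N → ℝ} (hf : IsC2OnSphere f) :
    Continuous fun p : sphere (0 : Space N) 1 => f p := by
  have := hf.continuousOn.comp_continuous continuous_subtype_val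
    fun p : sphere (0 : Space N) 1 => ne_zero_of_mem_unit_sphere p
  exact this.congr fun p => radialExtension_of_mem_sphere f p.2

/-- Green's second formula on the unit sphere. -/
theorem integral_sphereLaplacian_mul (hN : 2 ≤ N) {f : Space N → ℝ} (hf : IsC2OnSphere f)
    (q : MvPolynomial (Fin N) ℝ) :
    ∫ p : sphere (0 : Space N) 1, sphereLaplacian f p * polyEval q p ∂(sphereMeasure N) =
      -∫ p : sphere (0 : Space N) 1, f p * polyEval (sphereOp N q) p ∂(sphereMeasure N) := by
  have hopen : IsOpen ({0}ᶜ : Set (Space N)) := isOpen_compl_singleton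
  set g := radialExtension f with hg
  have hgr : IsRadiallyConstant g := isRadiallyConstant_radialExtension f
  have hgc : ContDiffOn ℝ 1 g {0}ᶜ := ContDiffOn.of_le hf (by norm_num)
  have hpc : ∀ r : MvPolynomial (Fin N) ℝ, Continuous (polyEval r) := fun r =>
    (contDiff_polyEval (n := 0) r).continuous
  have hgi := fun i : Fin N => contDiffOn_fderiv_radialExtension hf (EuclideanSpace.single i 1)
  have hφ : ∀ i : Fin N, ContDiffOn ℝ 1 (fun x => fderiv ℝ g x (EuclideanSpace.single i 1) *
    polyEval q x) {0}ᶜ := fun i => (hgi i).mul (contDiff_polyEval _).contDiffOn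
  have hi1 : ∀ i : Fin N, Integrable (fun p : sphere (0 : Space N) 1 =>
      fderiv ℝ (fun x => fderiv ℝ g x (EuclideanSpace.single i 1) * polyEval q x) p
        (EuclideanSpace.single i (1 : ℝ) -
        ⟪(p : Space N), EuclideanSpace.single i (1 : ℝ)⟫ • (p : Space N))) (sphereMeasure N) := by
    intro i
    refine integrable_sphere_of_continuousOn (f := fun x =>
      fderiv ℝ (fun x => fderiv ℝ g x (EuclideanSpace.single i 1) * polyEval q x) x
        (EuclideanSpace.single i (1 : ℝ) - ⟪x, EuclideanSpace.single i (1 : ℝ)⟫ • x)) ?_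
    exact ((hφ i).continuousOn_fderiv_of_isOpen hopen le_rfl).clm_apply (by fun_prop)
  have hi2 : ∀ i : Fin N, Integrable (fun p : sphere (0 : Space N) 1 =>
      (N - 1 : ℝ) * (fderiv ℝ g p (EuclideanSpace.single i 1) * polyEval q p *
        ⟪(p : Space N), EuclideanSpace.single i (1 : ℝ)⟫)) (sphereMeasure N) := by
    intro i
    refine integrable_sphere_of_continuousOn (f := fun x => (N - 1 : ℝ) *
      (fderiv ℝ g x (EuclideanSpace.single i 1) * polyEval q x *
        ⟪x, EuclideanSpace.single i (1 : ℝ)⟫)) ?_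
    exact continuousOn_const.mul ((hφ i).continuousOn.mul (by fun_prop))
  -- The divergence theorem for `q ∂ᵢ g` in direction `eᵢ`, summed over `i`. Both the `E q` terms
  -- and the `N - 1` terms drop out, because `∇g` is orthogonal to `p`.
  have key : ∑ i : Fin N, ∫ p : sphere (0 : Space N) 1,
      (fderiv ℝ (fun x => fderiv ℝ g x (EuclideanSpace.single i 1) * polyEval q x) p
        (EuclideanSpace.single i (1 : ℝ) -
        ⟪(p : Space N), EuclideanSpace.single i (1 : ℝ)⟫ • (p : Space N)) -
      (N - 1 : ℝ) * (fderiv ℝ g p (EuclideanSpace.single i 1) * polyEval q p *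
        ⟪(p : Space N), EuclideanSpace.single i (1 : ℝ)⟫)) ∂(sphereMeasure N) = 0 := by
    refine Finset.sum_eq_zero fun i _ => ?_
    rw [integral_sub (hi1 i) (hi2 i), integral_const_mul,
      integral_sphere_fderiv_tangential hN (hφ i), sub_self]
  have hi : ∀ i ∈ Finset.univ, Integrable (fun p : sphere (0 : Space N) 1 =>
      fderiv ℝ (fun x => fderiv ℝ g x (EuclideanSpace.single i 1) * polyEval q x) p
        (EuclideanSpace.single i (1 : ℝ) -
        ⟪(p : Space N), EuclideanSpace.single i (1 : ℝ)⟫ • (p : Space N)) -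
      (N - 1 : ℝ) * (fderiv ℝ g p (EuclideanSpace.single i 1) * polyEval q p *
        ⟪(p : Space N), EuclideanSpace.single i (1 : ℝ)⟫)) (sphereMeasure N) :=
    fun i _ => (hi1 i).sub (hi2 i)
  rw [← integral_finsetSum _ hi] at key
  have hgreen := integral_fderiv_mul_pderiv hN hgr hgc q
  have hgf : ∀ p : sphere (0 : Space N) 1, g p = f p := fun p =>
    radialExtension_of_mem_sphere f p.2
  simp only [hgf] at hgreen
  rw [← hgreen, eq_neg_iff_add_eq_zero, ← integral_add, ← key]
  · refine integral_congr_ae (Filter.Eventually.of_forall fun p => ?_)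
    have hp0 : (p : Space N) ≠ 0 := ne_zero_of_mem_unit_sphere p
    have hd : DifferentiableAt ℝ g p := differentiableAt_radialExtension hf hp0
    have h4 : ∑ i, fderiv ℝ g p (EuclideanSpace.single i 1) * (p : Space N) i = 0 := by
      have := congrArg (fderiv ℝ g p) (sum_smul_single (p : Space N))
      simpa only [map_sum, map_smul, smul_eq_mul, hgr.fderiv_self p hd, mul_comm] using this
    have h1 : ∀ i, fderiv ℝ (fun x => fderiv ℝ g x (EuclideanSpace.single i 1) * polyEval q x) p
        (EuclideanSpace.single i (1 : ℝ) - ⟪(p : Space N), EuclideanSpace.single i (1 : ℝ)⟫ •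
          (p : Space N)) -
        (N - 1 : ℝ) * (fderiv ℝ g p (EuclideanSpace.single i 1) * polyEval q p *
          ⟪(p : Space N), EuclideanSpace.single i (1 : ℝ)⟫) =
        fderiv ℝ (fun x => fderiv ℝ g x (EuclideanSpace.single i 1)) p
          (EuclideanSpace.single i (1 : ℝ) - ⟪(p : Space N), EuclideanSpace.single i (1 : ℝ)⟫ •
          (p : Space N)) * polyEval q p +
        fderiv ℝ g p (EuclideanSpace.single i 1) * polyEval (pderiv i q) p -
        (polyEval (eulerOp N q) p + (N - 1) * polyEval q p) *
          (fderiv ℝ g p (EuclideanSpace.single i 1) * (p : Space N) i) := by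
      intro i
      have hdi := ((hgi i).differentiableOn one_ne_zero).differentiableAt (hopen.mem_nhds hp0)
      have h2 : HasFDerivAt (fun x => fderiv ℝ g x (EuclideanSpace.single i 1) * polyEval q x) _
          (p : Space N) :=
        hdi.hasFDerivAt.mul (hasFDerivAt_polyEval q p).differentiableAt.hasFDerivAt
      rw [h2.fderiv]
      simp only [add_apply, smul_apply, map_sub, map_smul,
        fderiv_polyEval_single, fderiv_polyEval_self, inner_single_one, smul_eq_mul]
      ring
    simp only [h1]
    rw [Finset.sum_sub_distrib, Finset.sum_add_distrib, ← Finset.mul_sum, h4, mul_zero, sub_zero,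
      ← Finset.sum_mul, sphereLaplacian_eq_sum hf p.2]
  · exact integrable_of_continuous ((continuous_sphereLaplacian hf).mul
      ((hpc q).comp continuous_subtype_val))
  · refine integrable_sphere_of_continuousOn (f := fun x => ∑ i, fderiv ℝ g x
      (EuclideanSpace.single i 1) * polyEval (pderiv i q) x) ?_
    exact continuousOn_finsetSum _ fun i _ =>
      (hgi i).continuousOn.mul (hpc _).continuousOn

/-- A function of class `C²` is a mode if and only if it is one in the weak sense. -/
theorem isSphereMode_iff_weak (hN : 2 ≤ N) {f : Space N → ℝ} (hf : IsC2OnSphere f) {c : ℝ} :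
    IsSphereMode f c ↔ ∀ q,
      ⟪toSphereL2 N ⟨fun p => f p, continuous_of_isC2OnSphere hf⟩, polyL2 N (sphereOp N q)⟫ =
        -c * ⟪toSphereL2 N ⟨fun p => f p, continuous_of_isC2OnSphere hf⟩, polyL2 N q⟫ := by
  set F : C(sphere (0 : Space N) 1, ℝ) := ⟨fun p => f p, continuous_of_isC2OnSphere hf⟩ with hF
  set G : C(sphere (0 : Space N) 1, ℝ) :=
    ⟨fun p => sphereLaplacian f p, continuous_sphereLaplacian hf⟩ with hG
  have h1 : ∀ q, ⟪toSphereL2 N F, polyL2 N (sphereOp N q)⟫ = -⟪toSphereL2 N G, polyL2 N q⟫ := by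
    intro q
    rw [inner_toSphereL2_polyL2, inner_toSphereL2_polyL2, eq_neg_iff_add_eq_zero, add_comm,
      ← eq_neg_iff_add_eq_zero]
    exact integral_sphereLaplacian_mul hN hf q
  simp only [h1, neg_mul, neg_inj]
  constructor
  · rintro ⟨-, h⟩ q
    have : G = c • F := by
      ext p
      exact h p p.2
    rw [this, map_smul, real_inner_smul_left]
  · intro h
    refine ⟨hf, fun p hp => ?_⟩
    -- The continuous function `Δf - c f` is orthogonal to all polynomials, hence zero by density.
    have h2 : toSphereL2 N (G - c • F) = 0 := by
      refine toSphereL2_eq_zero_of_orthogonal fun q => ?_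
      rw [map_sub, map_smul, inner_sub_left, real_inner_smul_left, h, sub_self]
    have h3 := toSphereL2_injective (by omega) (h2.trans (map_zero _).symm)
    have h4 := congrArg (fun k : C(sphere (0 : Space N) 1, ℝ) => k ⟨p, hp⟩) h3
    simpa [hF, hG, sub_eq_zero] using h4

/-- Symmetry of `sphereOp` gives the weak equation, which is equivalent to the strong one. -/
lemma isSphereMode_of_sphereOp_eq (hN : 2 ≤ N) {q : MvPolynomial (Fin N) ℝ} {μ : ℝ}
    (hq : sphereOp N q = μ • q) {f : Space N → ℝ}
    (hf : ∀ p ∈ sphere (0 : Space N) 1, f p = polyEval q p) : IsSphereMode f (-μ) := by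
  have hf2 : IsC2OnSphere f := by
    refine (contDiffOn_radialExtension_polyEval q).congr fun x hx => ?_
    have hx' : ‖x‖ ≠ 0 := norm_ne_zero_iff.2 hx
    exact hf _ (by simp [norm_smul, hx'])
  rw [isSphereMode_iff_weak hN hf2]
  have h1 : (⟨fun p => f p, continuous_of_isC2OnSphere hf2⟩ : C(sphere (0 : Space N) 1, ℝ)) =
      polyRestrict N q := by
    ext p
    rw [polyRestrict_apply]
    exact hf p p.2
  intro r
  rw [h1, ← polyL2_apply, inner_polyL2_sphereOp_comm hN, hq, map_smul, inner_smul_right,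
    real_inner_comm, neg_neg]

/-- Induction on the degree: at stage `m` the operator is multiplication by `m (m + N - 2)` modulo
the previous stage, so the weak equation gives `(μ - m (m + N - 2)) ⟪w, q⟫ = 0`. -/
lemma inner_eq_zero_of_weak_mode {w : Lp ℝ 2 (sphereMeasure N)} {μ : ℝ}
    (hw : ∀ q, ⟪w, polyL2 N (sphereOp N q)⟫ = μ * ⟪w, polyL2 N q⟫) {k : ℕ}
    (hk : ∀ q ∈ polyDegreeLT N k, ⟪w, polyL2 N q⟫ = 0)
    (hμ : ∀ m : ℕ, k ≤ m → (m : ℝ) * (m + N - 2) ≠ μ) (q : MvPolynomial (Fin N) ℝ) :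
    ⟪w, polyL2 N q⟫ = 0 := by
  have h : ∀ m, k ≤ m → ∀ q ∈ polyDegreeLT N m, ⟪w, polyL2 N q⟫ = 0 := by
    intro m hm
    induction m, hm using Nat.le_induction with
    | base => exact hk
    | succ m hm ih =>
      intro q hq
      have h1 := ih _ (sphereOp_sub_smul_mem hq)
      rw [map_sub, inner_sub_right, hw, map_smul, inner_smul_right, ← sub_mul] at h1
      exact (mul_eq_zero.1 h1).resolve_left (sub_ne_zero.2 (hμ m hm).symm)
  obtain ⟨m, hm⟩ := exists_mem_polyDegreeLT q
  exact h (max k m) (le_max_left _ _) q (polyDegreeLT_mono (le_max_right _ _) hm)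

lemma sphereEigenvalue_strictMono (hN : 2 ≤ N) :
    StrictMono fun m : ℕ => (m : ℝ) * (m + N - 2) := by
  have hN' : (2 : ℝ) ≤ N := by exact_mod_cast hN
  refine strictMono_nat_of_lt_succ fun m => ?_
  have : (0 : ℝ) ≤ m := Nat.cast_nonneg m
  push_cast
  nlinarith

/-- Every mode of the unit sphere is the restriction of a polynomial of degree `l`, where
`-l (l + N - 2)` is its eigenvalue. -/
theorem IsSphereMode.exists_poly (hN : 2 ≤ N) {f : Space N → ℝ} {l : ℕ}
    (hf : IsSphereMode f (-((l : ℝ) * (l + N - 2)))) :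
    ∃ q ∈ polyDegreeLT N (l + 1), ∀ p ∈ sphere (0 : Space N) 1, f p = polyEval q p := by
  have hw := (isSphereMode_iff_weak hN hf.1).1 hf
  set F : C(sphere (0 : Space N) 1, ℝ) := ⟨fun p => f p, continuous_of_isC2OnSphere hf.1⟩ with hF
  rw [neg_neg] at hw
  set μ := (l : ℝ) * (l + N - 2) with hμ
  obtain ⟨q, hq, hqo⟩ := exists_poly_projection (toSphereL2 N F) (l + 1)
  have h1 : ∀ r ∈ polyDegreeLT N (l + 1), ⟪toSphereL2 N F, polyL2 N r⟫ = ⟪polyL2 N q, polyL2 N r⟫ :=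
    fun r hr => by
      have := hqo r hr
      rwa [inner_sub_left, sub_eq_zero] at this
  -- The degree space is invariant under the symmetric operator, so the projection of a weak mode is
  -- again a mode.
  have h2 : polyL2 N (sphereOp N q) = μ • polyL2 N q := by
    have h3 : ∀ r ∈ polyDegreeLT N (l + 1), ⟪polyL2 N (sphereOp N q - μ • q), polyL2 N r⟫ = 0 := by
      intro r hr
      rw [map_sub, map_smul, inner_sub_left, real_inner_smul_left, real_inner_comm,
        inner_polyL2_sphereOp_comm hN, ← h1 _ (sphereOp_mem hr), hw, h1 r hr, sub_self]
    have h4 := inner_self_eq_zero.1 (h3 _ (Submodule.sub_mem _ (sphereOp_mem hq)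
      (Submodule.smul_mem _ μ hq)))
    rwa [map_sub, map_smul, sub_eq_zero] at h4
  -- The remainder is a weak mode orthogonal to all degrees up to `l`, and the diagonal entries of
  -- higher degree exceed `μ`.
  have h3 : toSphereL2 N (F - polyRestrict N q) = 0 := by
    refine toSphereL2_eq_zero_of_orthogonal ?_
    rw [map_sub, ← polyL2_apply]
    refine inner_eq_zero_of_weak_mode (μ := μ) (k := l + 1) (fun r => ?_) hqo fun m hm => ?_
    · rw [inner_sub_left, inner_sub_left, hw, inner_polyL2_sphereOp_comm hN, h2, inner_smul_right,
        real_inner_comm (polyL2 N q)]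
      ring
    · exact (sphereEigenvalue_strictMono hN (show l < m by omega)).ne'
  have h4 := toSphereL2_injective (by omega) (h3.trans (map_zero _).symm)
  refine ⟨q, hq, fun p hp => ?_⟩
  have h5 := congrArg (fun k : C(sphere (0 : Space N) 1, ℝ) => k ⟨p, hp⟩) h4
  simpa [hF, sub_eq_zero, polyRestrict_apply] using h5

/-- Otherwise no diagonal entry equals `-c`. The induction on degree can then start from the zero
space, and `f` is orthogonal to every polynomial. -/
lemma IsSphereMode.eigenvalue_mem (hN : 2 ≤ N) {f : Space N → ℝ} {c : ℝ} (hf : IsSphereMode f c)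
    (h0 : ∃ p ∈ sphere (0 : Space N) 1, f p ≠ 0) :
    ∃ l : ℕ, -((l : ℝ) * (l + N - 2)) = c := by
  by_contra! h
  obtain ⟨p, hp, hfp⟩ := h0
  have hw := (isSphereMode_iff_weak hN hf.1).1 hf
  have h1 := toSphereL2_eq_zero_of_orthogonal (inner_eq_zero_of_weak_mode hw (k := 0)
    (fun q hq => by
      rw [polyDegreeLT_zero, Submodule.mem_bot] at hq
      rw [hq, map_zero, inner_zero_right])
    fun m _ h2 => h m (by rw [h2, neg_neg]))
  have h2 := toSphereL2_injective (by omega) (h1.trans (map_zero _).symm)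
  exact hfp (congrArg (fun k : C(sphere (0 : Space N) 1, ℝ) => k ⟨p, hp⟩) h2)

/-- The real part of `(X₀ + i X₁) ^ l` is a harmonic polynomial. -/
lemma exists_harmonic_poly (hN : 2 ≤ N) (l : ℕ) : ∃ q : MvPolynomial (Fin N) ℝ,
    sphereOp N q = ((l : ℝ) * (l + N - 2)) • q ∧
      polyEval q (EuclideanSpace.single ⟨0, by omega⟩ 1) = 1 := by
  set i₀ : Fin N := ⟨0, by omega⟩ with h₀
  set i₁ : Fin N := ⟨1, by omega⟩ with h₁
  have h01 : i₀ ≠ i₁ := by simp [h₀, h₁]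
  -- Here `a` and `b` are the real and imaginary parts of the power. The Cauchy-Riemann equations
  -- are carried along because they cancel the first-order terms in the Laplacian of the next power.
  have key : ∃ a b : MvPolynomial (Fin N) ℝ, eulerOp N a = (l : ℝ) • a ∧ eulerOp N b = (l : ℝ) • b ∧
      polyLaplacian N a = 0 ∧ polyLaplacian N b = 0 ∧ pderiv i₀ a = pderiv i₁ b ∧
      pderiv i₁ a = -pderiv i₀ b ∧ polyEval a (EuclideanSpace.single i₀ 1) = 1 := by
    induction l with
    | zero => exact ⟨1, 0, by simp [eulerOp_apply], by simp, by simp [polyLaplacian_apply], by simp,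
        by simp, by simp, by simp [polyEval]⟩
    | succ l ih =>
      obtain ⟨a, b, ha, hb, hla, hlb, h0, h1, he⟩ := ih
      refine ⟨X i₀ * a - X i₁ * b, X i₀ * b + X i₁ * a, ?_, ?_, ?_, ?_, ?_, ?_, ?_⟩
      · rw [map_sub, eulerOp_X_mul, eulerOp_X_mul, ha, hb]
        push_cast
        simp only [mul_smul_comm]
        module
      · rw [map_add, eulerOp_X_mul, eulerOp_X_mul, ha, hb]
        push_cast
        simp only [mul_smul_comm]
        module
      · rw [map_sub, polyLaplacian_X_mul, polyLaplacian_X_mul, hla, hlb, h0]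
        ring
      · rw [map_add, polyLaplacian_X_mul, polyLaplacian_X_mul, hla, hlb, h1]
        ring
      · simp [pderiv_X, h01, h01.symm, h0, h1]
        ring
      · simp [pderiv_X, h01, h01.symm, h0, h1]
        ring
      · rw [polyEval_sub, polyEval_mul, polyEval_mul, polyEval_X, polyEval_X, he]
        simp [h01.symm]
  obtain ⟨a, b, ha, -, hla, -, -, -, he⟩ := key
  refine ⟨a, ?_, he⟩
  rw [sphereOp_apply, hla, ha, map_smul, ha]
  module

/-- The spectrum of the Laplace-Beltrami operator of the unit sphere. -/
theorem sphereEigenvalues_eq (hN : 2 ≤ N) : sphereEigenvalues N =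
    Set.range (fun l : ℕ => -((l : ℝ) * ((l : ℝ) + (N : ℝ) - 2))) := by
  ext c
  constructor
  · rintro ⟨f, hf, h0⟩
    exact hf.eigenvalue_mem hN h0
  · rintro ⟨l, rfl⟩
    obtain ⟨q, hq, he⟩ := exists_harmonic_poly hN l
    exact ⟨polyEval q, isSphereMode_of_sphereOp_eq hN hq fun _ _ => rfl, EuclideanSpace.single ⟨0, by omega⟩ 1, by simp,
      by rw [he]; exact one_ne_zero⟩

theorem isSphereMode_zero_iff (hN : 2 ≤ N) (f : Space N → ℝ) : IsSphereMode f 0 ↔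
    ∃ c : ℝ, ∀ p ∈ sphere (0 : Space N) 1, f p = c := by
  constructor
  · intro hf
    obtain ⟨q, hq, h⟩ := IsSphereMode.exists_poly hN (l := 0) (by simpa using hf)
    obtain ⟨c, rfl⟩ := exists_const_of_mem_polyDegreeLT hq
    exact ⟨c, fun p hp => by rw [h p hp]; simp [polyEval]⟩
  · rintro ⟨c, h⟩
    have := isSphereMode_of_sphereOp_eq hN (q := C c) (μ := 0) (by rw [sphereOp_C, zero_smul])
      (f := f) fun p hp => by rw [h p hp]; simp [polyEval]
    simpa using this

theorem isSphereMode_one_iff (hN : 2 ≤ N) (f : Space N → ℝ) : IsSphereMode f (-((N : ℝ) - 1)) ↔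
    ∃ e : Space N, ∀ p ∈ sphere (0 : Space N) 1, f p = ⟪e, p⟫ := by
  constructor
  · intro hf
    obtain ⟨q, hq, h⟩ := IsSphereMode.exists_poly hN (l := 1) (by
      convert hf using 2
      push_cast
      ring)
    obtain ⟨c, e, hce⟩ := exists_affine_of_mem_polyDegreeLT hq
    -- Testing against the constant 1 shows that the mode has mean value zero, which eliminates the
    -- constant `c`.
    have h1 := (isSphereMode_iff_weak hN hf.1).1 hf (C 1)
    rw [sphereOp_C, map_zero, inner_zero_right, inner_toSphereL2_polyL2, neg_neg, eq_comm,
      mul_eq_zero] at h1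
    have hN' : (2 : ℝ) ≤ N := by exact_mod_cast hN
    have h2 := h1.resolve_left (by linarith)
    have h3 : ∀ p : sphere (0 : Space N) 1, f p = c + ⟪e, (p : Space N)⟫ := fun p => by
      rw [h p p.2, hce]
    simp only [ContinuousMap.coe_mk, h3, polyEval, eval_C, mul_one] at h2
    rw [integral_add (integrable_const c) (integrable_of_continuous (by fun_prop)),
      integral_inner_sphere hN, add_zero, integral_const, smul_eq_mul, mul_eq_zero] at h2
    have h4 := h2.resolve_left (sphereMeasure_real_univ_ne_zero (by omega))
    exact ⟨e, fun p hp => by rw [h3 ⟨p, hp⟩, h4, zero_add]⟩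
  · rintro ⟨e, h⟩
    exact isSphereMode_of_sphereOp_eq hN (sphereOp_linearPoly e)
      fun p hp => by rw [h p hp, polyEval_linearPoly]

end Modes

/-! ### Variations of a round sphere -/

section SphericalInterface

open scoped Pointwise

variable {N : ℕ} {x₀ : Space N} {R : ℝ}

lemma image_affine_eq (x₀ : Space N) (R : ℝ) (T : Set (Space N)) :
    (fun y => x₀ + R • y) '' T = (fun y => x₀ + y) '' (R • T) := by
  rw [← image_smul, image_image]

lemma image_affine_sphere (hR : 0 < R) :
    (fun y => x₀ + R • y) '' sphere (0 : Space N) 1 = sphere x₀ R := by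
  rw [image_affine_eq, smul_sphere' hR.ne']
  simp [abs_of_pos hR]

lemma image_affine_ball (hR : 0 < R) :
    (fun y => x₀ + R • y) '' ball (0 : Space N) 1 = ball x₀ R := by
  rw [image_affine_eq, smul_unitBall hR.ne']
  simp [abs_of_pos hR]

lemma volume_image_affine (hR : 0 < R) (T : Set (Space N)) :
    volume ((fun y => x₀ + R • y) '' T) = ENNReal.ofReal (R ^ N) * volume T := by
  rw [image_affine_eq, image_add_left, measure_preimage_add, Measure.addHaar_smul,
    finrank_euclideanSpace_fin, abs_of_pos (pow_pos hR _)]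

lemma hausdorffMeasure_image_affine (hR : 0 < R) (n : ℕ) (T : Set (Space N)) :
    (Measure.hausdorffMeasure (n : ℝ) ((fun y => x₀ + R • y) '' T)).toReal =
      R ^ n * (Measure.hausdorffMeasure (n : ℝ) T).toReal := by
  have h : (fun y => x₀ + y) = IsometryEquiv.addLeft x₀ := rfl
  rw [image_affine_eq, h, IsometryEquiv.hausdorffMeasure_image,
    Measure.hausdorffMeasure_smul₀ (Nat.cast_nonneg n) hR.ne']
  rw [ENNReal.smul_def, smul_eq_mul, ENNReal.toReal_mul, ENNReal.coe_toReal, NNReal.coe_rpow,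
    coe_nnnorm, Real.rpow_natCast, Real.norm_of_nonneg hR.le]

/-- The area of a round sphere under a volume preserving variation: the first variation vanishes,
and the second variation is a positive multiple of the Jacobi quadratic form of the normal
velocity. -/
theorem Variation.hasSecondVariation_sphere (hN : 2 ≤ N) (hR : 0 < R) (v : Variation N)
    (hv : ∀ t ∈ Ioo (-v.δ) v.δ, volume (v.ξ t '' ball x₀ R) = volume (ball x₀ R)) :
    HasDerivAt (v.areaAt (sphere x₀ R)) 0 0 ∧
    ∃ C > 0, ∃ u : Space N → ℝ, IsRadiallyConstant u ∧ ContDiffOn ℝ 1 u {0}ᶜ ∧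
      ∫ p : sphere (0 : Space N) 1, u p ∂(sphereMeasure N) = 0 ∧
      (∀ p ∈ sphere (0 : Space N) 1, u p = R⁻¹ * ⟪v.velocity (x₀ + R • p), p⟫) ∧
      HasSecondVariation (sphere x₀ R) v (C * ∫ p : sphere (0 : Space N) 1,
        (‖fderiv ℝ u p‖ ^ 2 - ((N : ℝ) - 1) * u p ^ 2) ∂(sphereMeasure N)) := by
  obtain ⟨n, rfl⟩ : ∃ n, N = n + 1 := ⟨N - 1, by omega⟩
  choose! η hη hl hr using v.diffeo
  have hRR : ∀ y : Space (n + 1), R • R⁻¹ • y = y := fun y => smul_inv_smul₀ hR.ne' y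
  have hRR' : ∀ y : Space (n + 1), R⁻¹ • R • y = y := fun y => inv_smul_smul₀ hR.ne' y
  -- The isotopy is conjugated by `y ↦ x₀ + R • y` so that it acts on the unit sphere.
  obtain ⟨ε, hε, s, hεδ, hs, hsr, hsS, hsB, hs0, hsd⟩ := exists_radialGraph v.δ_pos
    (ψ := fun t x => R⁻¹ • (v.ξ t (x₀ + R • x) - x₀))
    (η := fun t x => R⁻¹ • (η t (x₀ + R • x) - x₀)) (by
      have h1 : ContDiff ℝ 2 (fun q : ℝ × Space (n + 1) => (q.1, x₀ + R • q.2)) := by fun_prop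
      have h2 := v.contDiffOn.comp h1.contDiffOn (s := Ioo (-v.δ) v.δ ×ˢ univ)
        fun q hq => ⟨hq.1, mem_univ _⟩
      exact (h2.sub contDiffOn_const).const_smul R⁻¹)
    (fun t ht => by
      have := hη t ht
      fun_prop)
    (fun t ht x => by simp [hRR, hRR', hl t ht (x₀ + R • x)])
    (fun t ht x => by simp [hRR, hRR', hr t ht (x₀ + R • x)])
    (fun x => by simp [v.map_zero, hRR'])
  have hconj : ∀ t (T : Set (Space (n + 1))), v.ξ t '' ((fun y => x₀ + R • y) '' T) =
      (fun y => x₀ + R • y) '' ((fun x => R⁻¹ • (v.ξ t (x₀ + R • x) - x₀)) '' T) := by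
    intro t T
    simp only [image_image, hRR, add_sub_cancel]
  have hst : ∀ t ∈ Ioo (-ε) ε, ContDiffOn ℝ 1 (s t) {0}ᶜ := by
    intro t ht
    have h1 : ContDiff ℝ 2 (fun x : Space (n + 1) => (t, x)) := by fun_prop
    exact (hs.comp h1.contDiffOn fun x hx => ⟨ht, hx⟩).of_le (by norm_num)
  have h0ε : (0 : ℝ) ∈ Ioo (-ε) ε := ⟨by linarith, hε⟩
  have hV : ∀ t ∈ Ioo (-ε) ε, ∫ p : sphere (0 : Space (n + 1)) 1,
      Real.exp ((n + 1) * s t p) ∂(sphereMeasure (n + 1)) = ∫ p : sphere (0 : Space (n + 1)) 1,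
      Real.exp ((n + 1) * s 0 p) ∂(sphereMeasure (n + 1)) := by
    have h1 : ∀ t ∈ Ioo (-ε) ε, ENNReal.ofReal (R ^ (n + 1)) * volume {x | starGauge (s t) x < 1} =
        volume (ball x₀ R) := by
      intro t ht
      rw [← hv t ⟨by linarith [ht.1], by linarith [ht.2]⟩, ← hsB t ht, ← image_affine_ball hR,
        hconj, volume_image_affine hR]
    intro t ht
    have h2 := (h1 t ht).trans (h1 0 h0ε).symm
    rw [ENNReal.mul_right_inj (by simpa using pow_pos hR _) ENNReal.ofReal_ne_top] at h2
    have h3 := congrArg ENNReal.toReal h2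
    rw [volume_radialGraph (hsr t) (hst t ht), volume_radialGraph (hsr 0) (hst 0 h0ε)] at h3
    exact mul_left_cancel₀ (by positivity) h3
  obtain ⟨huc, hu0, hd, hd0, hdd⟩ := radialGraph_variation hε hs hs0 hV (by positivity)
  set A : ℝ → ℝ := fun t => ∫ p : sphere (0 : Space (n + 1)) 1,
      Real.exp (n * s t p) * √(1 + ‖fderiv ℝ (s t) p‖ ^ 2) ∂(sphereMeasure (n + 1)) with hA
  -- The factors are the normalisation of `area`, the scaling of an `n`-dimensional measure by `R`,
  -- and the constant of the radial graph formula; only positivity is used.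
  set C : ℝ := (volume (ball (0 : Space (n + 1 - 1)) 1)).toReal / 2 ^ (n + 1 - 1) *
    (R ^ n * (coneFactor n / (n + 1))) with hC
  have hCpos : 0 < C := by
    have h1 : 0 < (volume (ball (0 : Space (n + 1 - 1)) 1)).toReal :=
      ENNReal.toReal_pos (measure_ball_pos _ _ one_pos).ne' measure_ball_lt_top.ne
    have h2 : (0 : ℝ) < coneFactor n := coneFactor_pos n
    positivity
  have hIo : Ioo (-ε) ε ∈ nhds (0 : ℝ) := isOpen_Ioo.mem_nhds h0ε
  have hcast : ((n + 1 : ℕ) : ℝ) - 1 = n := by push_cast; ring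
  have hareaI : ∀ t ∈ Ioo (-ε) ε, v.areaAt (sphere x₀ R) t = C * A t := by
    intro t ht
    rw [Variation.areaAt, area, hcast, ← image_affine_sphere hR, hconj,
      hausdorffMeasure_image_affine hR, hsS t ht, hausdorffMeasure_radialGraph (hsr t) (hst t ht),
      hC]
    ring
  have harea : ∀ t ∈ Ioo (-ε) ε, v.areaAt (sphere x₀ R) =ᶠ[nhds t] fun t => C * A t := by
    intro t ht
    filter_upwards [isOpen_Ioo.mem_nhds ht] with t ht using hareaI t ht
  refine ⟨?_, C, hCpos, fun x => deriv (fun t => s t x) 0, ?_, huc, hu0, ?_, ?_, ?_⟩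
  · have h1 := (hd 0 h0ε).hasDerivAt
    rw [hd0] at h1
    simpa using (h1.const_mul C).congr_of_eventuallyEq (harea 0 h0ε)
  · intro r hr x
    simp only [hsr _ r hr x]
  · intro p hp
    refine (hsd p hp).trans ?_
    rw [deriv_fun_const_smul_field, deriv_sub_const, real_inner_smul_left]
    rfl
  · filter_upwards [hIo] with t ht
    exact ((hd t ht).const_mul C).congr_of_eventuallyEq (harea t ht)
  · rw [hcast]
    refine (hdd.const_mul C).congr_of_eventuallyEq ?_
    filter_upwards [hIo] with t ht
    rw [(harea t ht).deriv_eq, deriv_const_mul_field]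

lemma interface_ball {Ω : Set (Space N)} (hR : 0 < R) (hΩ : closure (ball x₀ R) ⊆ Ω) :
    interface Ω (ball x₀ R) = sphere x₀ R := by
  rw [interface, frontier_ball x₀ hR.ne', inter_eq_left]
  refine subset_trans ?_ hΩ
  rw [closure_ball x₀ hR.ne']
  exact sphere_subset_closedBall

/-- The rescaling of the velocity by `R⁻¹` is absorbed into the vector `e`. -/
lemma isTranslational_sphere_iff (hR : 0 < R) (v : Variation N) {u : Space N → ℝ}
    (hu : ∀ p ∈ sphere (0 : Space N) 1, u p = R⁻¹ * ⟪v.velocity (x₀ + R • p), p⟫) :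
    IsTranslational (sphere x₀ R) (fun p => R⁻¹ • (p - x₀)) v ↔
      ∃ e : Space N, ∀ p ∈ sphere (0 : Space N) 1, u p = ⟪e, p⟫ := by
  rw [IsTranslational, ← image_affine_sphere hR]
  simp only [forall_mem_image, add_sub_cancel_left, inv_smul_smul₀ hR.ne']
  constructor
  · rintro ⟨e, he⟩
    exact ⟨R⁻¹ • e, fun p hp => by rw [hu p hp, he hp, real_inner_smul_left]⟩
  · rintro ⟨e, he⟩
    refine ⟨R • e, fun p hp => ?_⟩
    rw [real_inner_smul_left, ← he p hp, hu p hp, mul_inv_cancel_left₀ hR.ne']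

/-- A spherical interface is stable after discarding translations, and translations are neutral. -/
theorem isStableModTranslations_ball (hN : 2 ≤ N) {Ω : Set (Space N)} (hR : 0 < R)
    (hΩ : closure (ball x₀ R) ⊆ Ω) :
    IsStableModTranslations Ω (ball x₀ R) (fun p => R⁻¹ • (p - x₀)) ∧
      ∀ v : Variation N, IsAdmissible Ω (ball x₀ R) v →
        IsTranslational (interface Ω (ball x₀ R)) (fun p => R⁻¹ • (p - x₀)) v →
        HasSecondVariation (interface Ω (ball x₀ R)) v 0 := by
  rw [IsStableModTranslations, IsMinimal, interface_ball hR hΩ]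
  refine ⟨⟨fun v hv => (v.hasSecondVariation_sphere hN hR hv.volume_phase₁).1, ?_⟩, ?_⟩
  · intro v hv hnt
    obtain ⟨-, C, hC, u, hur, huc, hu0, hu, h2⟩ :=
      v.hasSecondVariation_sphere hN hR hv.volume_phase₁
    rw [isTranslational_sphere_iff hR v hu] at hnt
    exact ⟨_, h2, mul_pos hC (secondVariation_pos hN hur huc hu0 hnt)⟩
  · intro v hv ht
    obtain ⟨-, C, hC, u, hur, huc, hu0, hu, h2⟩ :=
      v.hasSecondVariation_sphere hN hR hv.volume_phase₁
    obtain ⟨e, he⟩ := (isTranslational_sphere_iff hR v hu).1 ht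
    rwa [secondVariation_translation hN hur he, mul_zero] at h2

end SphericalInterface

end Partitioning

end

theorem mainTheorem12 (N : ℕ) (hN : 2 ≤ N) :
    -- the spherical partitioning is stable after discarding translations,
    -- and translational variations are neutral
    (∀ (Ω : Set (Partitioning.Space N)) (x₀ : Partitioning.Space N) (R : ℝ),
      IsOpen Ω → 0 < R → closure (ball x₀ R) ⊆ Ω →
        Partitioning.IsStableModTranslations Ω (ball x₀ R) (fun p => R⁻¹ • (p - x₀)) ∧
        ∀ v : Partitioning.Variation N, Partitioning.IsAdmissible Ω (ball x₀ R) v →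
          Partitioning.IsTranslational (Partitioning.interface Ω (ball x₀ R))
            (fun p => R⁻¹ • (p - x₀)) v →
          Partitioning.HasSecondVariation (Partitioning.interface Ω (ball x₀ R)) v 0) ∧
    -- the eigenvalues of the Laplacian of the unit sphere
    Partitioning.sphereEigenvalues N =
      Set.range (fun l : ℕ => -((l : ℝ) * ((l : ℝ) + (N : ℝ) - 2))) ∧
    -- the modes for `l = 0` are the constants
    (∀ f : Partitioning.Space N → ℝ, Partitioning.IsSphereMode f 0 ↔
      ∃ c : ℝ, ∀ p ∈ sphere (0 : Partitioning.Space N) 1, f p = c) ∧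
    -- the modes for `l = 1` are the normal components of translations
    (∀ f : Partitioning.Space N → ℝ, Partitioning.IsSphereMode f (-((N : ℝ) - 1)) ↔
      ∃ e : Partitioning.Space N, ∀ p ∈ sphere (0 : Partitioning.Space N) 1, f p = ⟪e, p⟫) := by
  refine ⟨fun Ω x₀ R _ hR hΩ => Partitioning.isStableModTranslations_ball hN hR hΩ,
    Partitioning.sphereEigenvalues_eq hN, Partitioning.isSphereMode_zero_iff hN,
    Partitioning.isSphereMode_one_iff hN⟩
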